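/- Let $(X_1,Y_1),(X_2,Y_2),\dots$ be independent observations from the model $Y=m(X)+\sigma(X)\varepsilon$, where $X$ has density $f$ and the error $\varepsilon$ is independent of $X$ with mean $0$ and variance $1$. Fix a point $x\in\mathbb R$ and assume that * $m$ is twice differentiable in a neighbourhood of $x$ and $m''$ is continuous at $x$ (hence bounded near $x$); * $f(x)>0$, and there are $c$ and $0<\alpha<1$ with $|f(x)-f(y)|\le c|x-y|^{\alpha}$ for all $y$ in a neighbourhood of $x$; * $\sigma^2(\cdot)$ is continuous at $x$ (hence bounded near $x$). Let $K$ be a symmetric probability density on $\mathbb R$ with compact support and $\int K^2<\infty$, let $\delta>0$ be a constant, and let $h=h_n>0$ satisfy $h\to0$ and $nh\to\infty$ as $n\to\infty$. Put $K_h(t)=K(t/h)/h$, $S_{n,l}(z)=h\sum_{i=1}^n(z-X_i)^lK_h(z-X_i)$, $T_{n,l}(z)=h\sum_{i=1}^n(z-X_i)^lK_h(z-X_i)Y_i$, let $$\hat m(z)=\frac{S_{n,2}(z)T_{n,0}(z)-S_{n,1}(z)T_{n,1}(z)}{S_{n,0}(z)S_{n,2}(z)-S_{n,1}(z)^2+n^{-2}}$$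 be the local linear estimator with ridge term $n^{-2}$, and, for $r=\pm1/\sqrt2$, let $$\tilde m_\pm(x)=\tfrac{r(r-1)}2\,\hat m\bigl(x-(r+1)\delta h\bigr)+(1-r^2)\,\hat m\bigl(x-r\delta h\bigr)+\tfrac{r(r+1)}2\,\hat m\bigl(x-(r-1)\delta h\bigr).$$ Write $\nu_{20}=\int s^2K(s)\,ds$, $\nu_{02}=\int K(s)^2\,ds$, $C(a,\delta)=\int K(t-a\delta)K(t+a\delta)\,dt$ and $C(\delta)=\tfrac32C(0,\delta)-2C(\tfrac12,\delta)+\tfrac12C(1,\delta)$. Then, for each of $\tilde m_+$ and $\tilde m_-$, the second moment of $\tilde m_\pm(x)$ is finite for all large $n$ and, as $n\to\infty$, $$\mathbb E\{\tilde m_\pm(x)\}-m(x)=\tfrac12m''(x)\nu_{20}h^2+o\{h^2+(nh)^{-1/2}\},$$ $$\operatorname{Var}\{\tilde m_\pm(x)\}=\frac{\sigma^2(x)}{nhf(x)}\Bigl\{\nu_{02}-\frac{C(\delta)}4\Bigr\}+o\{h^4+(nh)^{-1}\}.$$ -/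

import Mathlib

open MeasureTheory ProbabilityTheory Filter Topology Asymptotics

noncomputable section

namespace LocalLinear

/-- Rescaled kernel `K_h(t) = K(t / h) / h`. -/
def rescale (K : ℝ → ℝ) (h t : ℝ) : ℝ := K (t / h) / h

/-- `S_{n,l}(z) = h ∑_{i<n} (z - X_i)^l K_h(z - X_i)`, for given design points `X`. -/
def designSum (K : ℝ → ℝ) (h : ℝ) (n : ℕ) (X : ℕ → ℝ) (l : ℕ) (z : ℝ) : ℝ :=
  h * ∑ i ∈ Finset.range n, (z - X i) ^ l * rescale K h (z - X i)

/-- `T_{n,l}(z) = h ∑_{i<n} (z - X_i)^l K_h(z - X_i) Y_i`, for given data `X`, `Y`. -/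
def responseSum (K : ℝ → ℝ) (h : ℝ) (n : ℕ) (X Y : ℕ → ℝ) (l : ℕ) (z : ℝ) : ℝ :=
  h * ∑ i ∈ Finset.range n, (z - X i) ^ l * rescale K h (z - X i) * Y i

/-- The local linear estimator `m̂(z)` from the first `n` observations, with the ridge term
`n⁻²` in the denominator that makes unconditional moments finite. -/
def mHat (K : ℝ → ℝ) (h : ℝ) (n : ℕ) (X Y : ℕ → ℝ) (z : ℝ) : ℝ :=
  (designSum K h n X 2 z * responseSum K h n X Y 0 z
      - designSum K h n X 1 z * responseSum K h n X Y 1 z) /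
    (designSum K h n X 0 z * designSum K h n X 2 z
      - designSum K h n X 1 z * designSum K h n X 1 z + ((n : ℝ) ^ 2)⁻¹)

/-- Quadratic interpolation coefficients `A_0(r), A_1(r), A_2(r)`. -/
def interpCoeff (r : ℝ) : Fin 3 → ℝ :=
  ![r * (r - 1) / 2, 1 - r ^ 2, r * (r + 1) / 2]

/-- `m̃_q(x) = ∑_{j=0,1,2} A_j(r) m̂(x - (r + 1 - j) ω_n)` with `ω_n = δ h`. -/
def mTilde (K : ℝ → ℝ) (δ r h : ℝ) (n : ℕ) (X Y : ℕ → ℝ) (x : ℝ) : ℝ :=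
  ∑ j : Fin 3, interpCoeff r j * mHat K h n X Y (x - (r + 1 - (j : ℕ)) * (δ * h))

/-- `m̃_+(x)`: the estimator with `r = 1/√2`. -/
def mPlus (K : ℝ → ℝ) (δ h : ℝ) (n : ℕ) (X Y : ℕ → ℝ) (x : ℝ) : ℝ :=
  mTilde K δ (1 / √2) h n X Y x

/-- `m̃_-(x)`: the estimator with `r = -1/√2`. -/
def mMinus (K : ℝ → ℝ) (δ h : ℝ) (n : ℕ) (X Y : ℕ → ℝ) (x : ℝ) : ℝ :=
  mTilde K δ (-(1 / √2)) h n X Y x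

/-- `ν₂₀ = ∫ s² K(s) ds`, the second moment of the kernel. -/
def nu20 (K : ℝ → ℝ) : ℝ := ∫ s, s ^ 2 * K s

/-- `ν₀₂ = ∫ K(s)² ds`. -/
def nu02 (K : ℝ → ℝ) : ℝ := ∫ s, K s ^ 2

/-- `C(a, δ) = ∫ K(t - aδ) K(t + aδ) dt`. -/
def kernelCorr (K : ℝ → ℝ) (a δ : ℝ) : ℝ := ∫ t, K (t - a * δ) * K (t + a * δ)

/-- `C(δ) = 1.5 C(0, δ) - 2 C(0.5, δ) + 0.5 C(1, δ)`. -/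
def varReduction (K : ℝ → ℝ) (δ : ℝ) : ℝ :=
  3 / 2 * kernelCorr K 0 δ - 2 * kernelCorr K (1 / 2) δ + 1 / 2 * kernelCorr K 1 δ

/-- `K` is a symmetric probability density with compact support, and `ν₀₂ = ∫ K²` is finite. -/
structure IsKernel (K : ℝ → ℝ) : Prop where
  measurable : Measurable K
  nonneg : ∀ t, 0 ≤ K t
  integral_eq_one : ∫ t, K t = 1
  symmetric : ∀ t, K (-t) = K t
  compactSupport : HasCompactSupport K
  sq_integrable : Integrable (fun t => K t ^ 2)

/-- Local regularity of the regression function `m`, the design density `f` and the variance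
function `σ²` at the point `x`. Boundedness of `m''` and of `σ²` near `x` is contained in
their continuity at `x`; nothing is required away from `x`. -/
structure RegularAt (m f σ : ℝ → ℝ) (x : ℝ) : Prop where
  twice_differentiable :
    ∀ᶠ y in 𝓝 x, DifferentiableAt ℝ m y ∧ DifferentiableAt ℝ (deriv m) y
  continuousAt_deriv2 : ContinuousAt (deriv (deriv m)) x
  density_pos : 0 < f x
  density_holder : ∃ c α : ℝ, 0 < α ∧ α < 1 ∧
    ∀ᶠ y in 𝓝 x, |f x - f y| ≤ c * |x - y| ^ α
  continuousAt_variance : ContinuousAt (fun y => σ y ^ 2) x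

/-- `(X_i, Y_i)` are independent observations from the model `Y = m(X) + σ(X) ε`, where `X` has
density `f` and the error `ε` is independent of `X` with zero mean and unit variance. -/
structure IsRegressionSample {Ω : Type*} [MeasurableSpace Ω] (P : Measure Ω)
    (m f σ : ℝ → ℝ) (X ε Y : ℕ → Ω → ℝ) : Prop where
  measurable_m : Measurable m
  measurable_sigma : Measurable σ
  measurable_f : Measurable f
  f_nonneg : ∀ y, 0 ≤ f y
  measurable_X : ∀ i, Measurable (X i)
  measurable_eps : ∀ i, Measurable (ε i)
  model : ∀ i w, Y i w = m (X i w) + σ (X i w) * ε i w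
  independent : iIndepFun (fun i w => (X i w, ε i w)) P
  identDistrib : ∀ i, IdentDistrib (fun w => (X i w, ε i w)) (fun w => (X 0 w, ε 0 w)) P P
  law_X : ∀ i, P.map (X i) = volume.withDensity (fun y => ENNReal.ofReal (f y))
  indep_error : ∀ i, IndepFun (X i) (ε i) P
  error_memLp : ∀ i, MemLp (ε i) 2 P
  error_mean : ∀ i, P[ε i] = 0
  error_variance : ∀ i, Var[ε i; P] = 1

/-- The estimators `Z n` of `m(x)` have finite second moments for all large `n`, bias
`½ m''(x) ν₂₀ h² + o{h² + (nh)^{-1/2}}` and variance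
`σ²(x) / (n h f(x)) {ν₀₂ - C(δ)/4} + o{h⁴ + (nh)⁻¹}`. -/
def HasBiasVarianceExpansion {Ω : Type*} [MeasurableSpace Ω] (P : Measure Ω)
    (K m f σ : ℝ → ℝ) (δ x : ℝ) (h : ℕ → ℝ) (Z : ℕ → Ω → ℝ) : Prop :=
  (∀ᶠ n in atTop, MemLp (Z n) 2 P) ∧
  (fun n : ℕ => P[Z n] - m x - 1 / 2 * deriv (deriv m) x * nu20 K * h n ^ 2)
    =o[atTop] (fun n : ℕ => h n ^ 2 + (√(n * h n))⁻¹) ∧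
  (fun n : ℕ => Var[Z n; P]
      - σ x ^ 2 / (n * h n * f x) * (nu02 K - varReduction K δ / 4))
    =o[atTop] (fun n : ℕ => h n ^ 4 + ((n : ℝ) * h n)⁻¹)

end LocalLinear

end

/-! Write `lam = nh` and `v_i = (x - X_i)/h`. The interpolated estimator is linear in the responses,
with weights `W_i` that depend on the design alone, so it splits as `H + ∑ W_i σ(X_i) ε_i` with `H =
∑ W_i m(X_i)`. The errors are centred, have variance one, and are independent of the design and of
one another. The noise therefore has mean zero and is uncorrelated with `H`
(`mean_variance_add_noise`): the mean is `E H` and the variance is `Var H + ∑ E (W_i σ(X_i))²`.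

Bias. It suffices that `E (H - m(x) - ½ m''(x) ν₂₀ h²)² = o(h⁴ + 1/lam)` (`bias_tilde`), for this
controls both the mean of `H` and its variance. A local linear fit at `x - bh` reproduces lines up
to the ridge. Hence it returns the quadratic Taylor polynomial at `x - bh`, plus `½ m'' h²` times
the fit of `t²`, plus a remainder (`sum_llWeight_taylor`). The fit of `t²` tends to `ν₂₀` in mean
square (`tendsto_quad`), and the remainder is `o(h²)` for every design
(`eventually_sum_taylorRem_le`). The three-point interpolation is exact on quadratics, so the Taylor
polynomials combine to `m(x)`, while the common term `½ m'' ν₂₀ h²` survives.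

Noise. In mean square, `W_i` is close to `g(v_i) / (lam f(x))`, where `g` is the interpolated kernel
(`tendsto_weight_error`). So `lam ∑ E (W_i σ(X_i))²` tends to `σ²(x)/f(x) ∫ g²`
(`tendsto_noise_variance`), and `r² = 1/2` turns `∫ g²` into `ν₀₂ - C(δ)/4` (`integral_interp_sq`).

Two difficulties shape the argument. The Gram determinant in the denominator may be tiny, but this
happens only on an event of exponentially small probability (`exists_sparse`), where the ridge gives
polynomial bounds. And only `K²` is integrable, so products of several kernel values at the same
point must be avoided: moments without the `i`-th point are used where possible, because they are
independent of that point, and truncation handles the rest. -/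

noncomputable section

namespace LocalLinear

/-! ### Algebra of the ridged local linear fit for a fixed design. -/

section

/-- Weighted power sum `∑ i ∈ I, t i ^ l * k i`. -/
def mom (k t : ℕ → ℝ) (l : ℕ) (I : Finset ℕ) : ℝ := ∑ i ∈ I, t i ^ l * k i

/-- Determinant of the weighted `2 × 2` Gram matrix of local linear regression. -/
def gram (k t : ℕ → ℝ) (I : Finset ℕ) : ℝ :=
  mom k t 0 I * mom k t 2 I - mom k t 1 I * mom k t 1 I

/-- Expand the moments into a double sum and average it with its index swap. Divided by `t j - t i`,
the last factor is the intercept at 0 of the line through two data points; with `gram_eq`, the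
unridged fit is thus a mean of two-point intercepts with weights `k i * k j * (t i - t j) ^ 2`. -/
theorem sum_weight_eq (k t g : ℕ → ℝ) (I : Finset ℕ) :
    ∑ i ∈ I, k i * (mom k t 2 I - t i * mom k t 1 I) * g i =
      (1 / 2) * ∑ i ∈ I, ∑ j ∈ I, k i * k j * ((t j - t i) * (t j * g i - t i * g j)) := by
  have h1 : ∑ i ∈ I, k i * (mom k t 2 I - t i * mom k t 1 I) * g i =
      ∑ i ∈ I, ∑ j ∈ I, k i * k j * ((t j - t i) * t j * g i) := by
    refine Finset.sum_congr rfl fun i _ => ?_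
    simp only [mom, Finset.mul_sum, mul_sub, sub_mul, Finset.sum_mul]
    rw [← Finset.sum_sub_distrib]
    exact Finset.sum_congr rfl fun j _ => by ring
  have h2 : ∑ i ∈ I, ∑ j ∈ I, k i * k j * ((t j - t i) * t j * g i) =
      ∑ i ∈ I, ∑ j ∈ I, k i * k j * ((t i - t j) * t i * g j) := by
    rw [Finset.sum_comm]
    exact Finset.sum_congr rfl fun i _ => Finset.sum_congr rfl fun j _ => by ring
  have h3 : ∑ i ∈ I, ∑ j ∈ I, k i * k j * ((t j - t i) * (t j * g i - t i * g j)) =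
      ∑ i ∈ I, ∑ j ∈ I, k i * k j * ((t j - t i) * t j * g i) +
      ∑ i ∈ I, ∑ j ∈ I, k i * k j * ((t i - t j) * t i * g j) := by
    rw [← Finset.sum_add_distrib]
    refine Finset.sum_congr rfl fun i _ => ?_
    rw [← Finset.sum_add_distrib]
    exact Finset.sum_congr rfl fun j _ => by ring
  rw [h1, h3, ← h2]; ring

theorem sum_weight_one (k t : ℕ → ℝ) (I : Finset ℕ) :
    ∑ i ∈ I, k i * (mom k t 2 I - t i * mom k t 1 I) = gram k t I := by
  have : ∀ i ∈ I, k i * (mom k t 2 I - t i * mom k t 1 I) =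
      t i ^ 0 * k i * mom k t 2 I - t i ^ 1 * k i * mom k t 1 I := fun i _ => by ring
  rw [Finset.sum_congr rfl this, Finset.sum_sub_distrib, ← Finset.sum_mul, ← Finset.sum_mul]
  rfl

theorem sum_weight_linear (k t : ℕ → ℝ) (I : Finset ℕ) :
    ∑ i ∈ I, k i * (mom k t 2 I - t i * mom k t 1 I) * t i = 0 := by
  have : ∀ i ∈ I, k i * (mom k t 2 I - t i * mom k t 1 I) * t i =
      t i ^ 1 * k i * mom k t 2 I - t i ^ 2 * k i * mom k t 1 I := fun i _ => by ring
  rw [Finset.sum_congr rfl this, Finset.sum_sub_distrib, ← Finset.sum_mul, ← Finset.sum_mul]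
  change mom k t 1 I * mom k t 2 I - mom k t 2 I * mom k t 1 I = 0
  ring

theorem sum_weight_sq (k t : ℕ → ℝ) (I : Finset ℕ) :
    ∑ i ∈ I, k i * (mom k t 2 I - t i * mom k t 1 I) * t i ^ 2 =
      mom k t 2 I * mom k t 2 I - mom k t 1 I * mom k t 3 I := by
  have : ∀ i ∈ I, k i * (mom k t 2 I - t i * mom k t 1 I) * t i ^ 2 =
      t i ^ 2 * k i * mom k t 2 I - t i ^ 3 * k i * mom k t 1 I := fun i _ => by ring
  rw [Finset.sum_congr rfl this, Finset.sum_sub_distrib, ← Finset.sum_mul, ← Finset.sum_mul]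
  change mom k t 2 I * mom k t 2 I - mom k t 3 I * mom k t 1 I = _
  ring

theorem gram_eq (k t : ℕ → ℝ) (I : Finset ℕ) :
    gram k t I = (1 / 2) * ∑ i ∈ I, ∑ j ∈ I, k i * k j * (t i - t j) ^ 2 := by
  rw [← sum_weight_one]
  have := sum_weight_eq k t (fun _ => 1) I
  simp only [mul_one] at this
  rw [this]
  congr 1
  exact Finset.sum_congr rfl fun i _ => Finset.sum_congr rfl fun j _ => by ring

theorem gram_nonneg {k t : ℕ → ℝ} (hk : ∀ i, 0 ≤ k i) (I : Finset ℕ) : 0 ≤ gram k t I := by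
  rw [gram_eq]
  exact mul_nonneg (by norm_num) (Finset.sum_nonneg fun i _ => Finset.sum_nonneg fun j _ =>
    mul_nonneg (mul_nonneg (hk i) (hk j)) (sq_nonneg _))

theorem mul_sum_mul_sum_le_gram {k t p q : ℕ → ℝ} {c : ℝ} {I : Finset ℕ}
    (h : ∀ i ∈ I, ∀ j ∈ I, c * (p i * q j + q i * p j) ≤ k i * k j * (t i - t j) ^ 2) :
    c * ((∑ i ∈ I, p i) * ∑ i ∈ I, q i) ≤ gram k t I := by
  have h0 : c * ((∑ i ∈ I, p i) * ∑ i ∈ I, q i) =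
      (1 / 2) * ∑ i ∈ I, ∑ j ∈ I, c * (p i * q j + q i * p j) := by
    simp only [mul_add, Finset.sum_add_distrib, ← Finset.mul_sum, ← Finset.sum_mul]
    ring
  rw [h0, gram_eq]
  exact mul_le_mul_of_nonneg_left
    (Finset.sum_le_sum fun i hi => Finset.sum_le_sum fun j hj => h i hi j hj) (by norm_num)

/-- The hypothesis says that two-point intercepts do not exceed `L` in size; compare `sum_weight_eq`
and `gram_eq` pair by pair. -/
theorem abs_sum_weight_le {k t g : ℕ → ℝ} (hk : ∀ i, 0 ≤ k i) {L : ℝ} {I : Finset ℕ}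
    (h : ∀ i ∈ I, ∀ j ∈ I, k i ≠ 0 → k j ≠ 0 → |t j * g i - t i * g j| ≤ L * |t i - t j|) :
    |∑ i ∈ I, k i * (mom k t 2 I - t i * mom k t 1 I) * g i| ≤ L * gram k t I := by
  rw [sum_weight_eq, gram_eq, abs_mul, abs_of_pos (by norm_num : (0 : ℝ) < 1 / 2)]
  rw [mul_left_comm]
  refine mul_le_mul_of_nonneg_left ?_ (by norm_num)
  rw [Finset.mul_sum]
  refine (Finset.abs_sum_le_sum_abs _ _).trans (Finset.sum_le_sum fun i hi => ?_)
  rw [Finset.mul_sum]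
  refine (Finset.abs_sum_le_sum_abs _ _).trans (Finset.sum_le_sum fun j hj => ?_)
  by_cases hi0 : k i = 0
  · simp [hi0]
  by_cases hj0 : k j = 0
  · simp [hj0]
  rw [abs_mul, abs_mul (t j - t i), abs_of_nonneg (mul_nonneg (hk i) (hk j)), abs_sub_comm (t j)]
  calc k i * k j * (|t i - t j| * |t j * g i - t i * g j|)
      ≤ k i * k j * (|t i - t j| * (L * |t i - t j|)) := by
        have := h i hi j hj hi0 hj0
        have := hk i
        have := hk j
        gcongr
    _ = L * (k i * k j * (t i - t j) ^ 2) := by rw [← sq_abs (t i - t j)]; ring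

theorem mom_erase (k t : ℕ → ℝ) (l : ℕ) {I : Finset ℕ} {i : ℕ} (hi : i ∈ I) :
    mom k t l I = mom k t l (I.erase i) + t i ^ l * k i := by
  simp only [mom]
  rw [Finset.sum_erase_add _ _ hi]

theorem weight_eq_erase (k t : ℕ → ℝ) {I : Finset ℕ} {i : ℕ} (hi : i ∈ I) :
    k i * (mom k t 2 I - t i * mom k t 1 I) =
      k i * (mom k t 2 (I.erase i) - t i * mom k t 1 (I.erase i)) := by
  rw [mom_erase k t 2 hi, mom_erase k t 1 hi]; ring

theorem mom_two_nonneg {k t : ℕ → ℝ} (hk : ∀ i, 0 ≤ k i) (I : Finset ℕ) : 0 ≤ mom k t 2 I :=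
  Finset.sum_nonneg fun i _ => mul_nonneg (sq_nonneg _) (hk i)

/-- The weight does not change when `i` is removed from the moments, and the Gram determinant grows
by an explicit quadratic in `t i` when `i` is put back. The difference of the two sides is then a
sum of nonnegative terms. -/
theorem sq_weight_le {k t : ℕ → ℝ} (hk : ∀ i, 0 ≤ k i) {I : Finset ℕ} {i : ℕ} (hi : i ∈ I) :
    (k i * (mom k t 2 I - t i * mom k t 1 I)) ^ 2 ≤
      k i * mom k t 2 (I.erase i) * gram k t I := by
  rw [weight_eq_erase k t hi]
  have h0 := gram_nonneg (t := t) hk (I.erase i)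
  have hd : gram k t I = gram k t (I.erase i) + k i * (mom k t 2 (I.erase i)
      - 2 * mom k t 1 (I.erase i) * t i + mom k t 0 (I.erase i) * t i ^ 2) := by
    simp only [gram]
    rw [mom_erase k t 0 hi, mom_erase k t 1 hi, mom_erase k t 2 hi]; ring
  have hg : gram k t (I.erase i) = mom k t 0 (I.erase i) * mom k t 2 (I.erase i) -
    mom k t 1 (I.erase i) * mom k t 1 (I.erase i) := rfl
  have hc := mom_two_nonneg (t := t) hk (I.erase i)
  have hki := hk i
  rw [hd]
  generalize mom k t 2 (I.erase i) = c at *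
  generalize mom k t 1 (I.erase i) = b at *
  generalize mom k t 0 (I.erase i) = a at *
  generalize gram k t (I.erase i) = d at *
  have e : k i * c * (d + k i * (c - 2 * b * t i + a * t i ^ 2)) - (k i * (c - t i * b)) ^ 2 =
      k i * c * d + k i ^ 2 * (t i ^ 2 * d) := by rw [hg]; ring
  have : 0 ≤ k i * c * d + k i ^ 2 * (t i ^ 2 * d) := by positivity
  linarith

/-- The weight that the ridged local linear fit gives to the `i`-th response. -/
def llWeight (k t : ℕ → ℝ) (ρ : ℝ) (I : Finset ℕ) (i : ℕ) : ℝ :=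
  k i * (mom k t 2 I - t i * mom k t 1 I) / (gram k t I + ρ)

/-- A bound that needs no lower bound on the Gram determinant, for use on the exceptional event. It
is linear in `k i` times a function of the other points, so its expectation factorises and is finite
under `∫ K² < ∞`. -/
theorem sq_llWeight_le {k t : ℕ → ℝ} (hk : ∀ i, 0 ≤ k i) {ρ : ℝ} (hρ : 0 < ρ)
    {I : Finset ℕ} {i : ℕ} (hi : i ∈ I) :
    llWeight k t ρ I i ^ 2 ≤ k i * mom k t 2 (I.erase i) / ρ := by
  have h0 := gram_nonneg (t := t) hk I
  have h1 := sq_weight_le (t := t) hk hi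
  have h2 : 0 ≤ k i * mom k t 2 (I.erase i) := mul_nonneg (hk i) (mom_two_nonneg hk _)
  rw [llWeight, div_pow, div_le_div_iff₀ (by positivity) hρ]
  calc _ ≤ k i * mom k t 2 (I.erase i) * gram k t I * ρ := by gcongr
    _ ≤ k i * mom k t 2 (I.erase i) * (gram k t I + ρ) ^ 2 := by
      rw [mul_assoc]
      gcongr
      nlinarith [mul_nonneg h0 hρ.le]

theorem sum_llWeight_mul (k t g : ℕ → ℝ) (ρ : ℝ) (I : Finset ℕ) :
    ∑ i ∈ I, llWeight k t ρ I i * g i =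
      (∑ i ∈ I, k i * (mom k t 2 I - t i * mom k t 1 I) * g i) / (gram k t I + ρ) := by
  rw [Finset.sum_div]
  exact Finset.sum_congr rfl fun i _ => by rw [llWeight]; ring

/-- The ridge only shrinks the fit, so the intercept bound persists for every design, however
degenerate. -/
theorem abs_sum_llWeight_le {k t g : ℕ → ℝ} (hk : ∀ i, 0 ≤ k i) {ρ : ℝ} (hρ : 0 < ρ)
    {L : ℝ} (hL : 0 ≤ L) {I : Finset ℕ}
    (h : ∀ i ∈ I, ∀ j ∈ I, k i ≠ 0 → k j ≠ 0 → |t j * g i - t i * g j| ≤ L * |t i - t j|) :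
    |∑ i ∈ I, llWeight k t ρ I i * g i| ≤ L := by
  have h0 := gram_nonneg (t := t) hk I
  rw [sum_llWeight_mul, abs_div, abs_of_pos (by positivity : 0 < gram k t I + ρ),
    div_le_iff₀ (by positivity)]
  refine (abs_sum_weight_le hk h).trans ?_
  gcongr
  linarith

/-- In scaled coordinates numerator and Gram determinant both carry a factor `h ^ 2`; dividing it
out turns the ridge `n⁻²` into `(nh)⁻²`. -/
theorem mHat_eq (K : ℝ → ℝ) {h : ℝ} (hh : 0 < h) (n : ℕ) (X Y : ℕ → ℝ) (x b : ℝ) :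
    mHat K h n X Y (x - b * h) =
      ∑ i ∈ Finset.range n, llWeight (fun i => K ((x - X i) / h - b))
        (fun i => (x - X i) / h - b) ((n * h) ^ 2)⁻¹ (Finset.range n) i * Y i := by
  set k : ℕ → ℝ := fun i => K ((x - X i) / h - b) with hk
  set t : ℕ → ℝ := fun i => (x - X i) / h - b with ht
  have ht' : ∀ i, x - b * h - X i = h * t i := fun i => by simp only [ht]; field_simp; ring
  have hr : ∀ i, rescale K h (x - b * h - X i) = k i / h := fun i => by
    simp only [rescale, ht']; rw [mul_div_cancel_left₀ _ hh.ne']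
  have hS : ∀ l, designSum K h n X l (x - b * h) = h ^ l * mom k t l (Finset.range n) := by
    intro l
    simp only [designSum, mom, Finset.mul_sum]
    refine Finset.sum_congr rfl fun i _ => ?_
    rw [hr, ht', mul_pow]; field_simp
  have hT : ∀ l, responseSum K h n X Y l (x - b * h) =
      h ^ l * ∑ i ∈ Finset.range n, t i ^ l * k i * Y i := by
    intro l
    simp only [responseSum, Finset.mul_sum]
    refine Finset.sum_congr rfl fun i _ => ?_
    rw [hr, ht', mul_pow]; field_simp
  rw [sum_llWeight_mul]
  have hnum : ∑ i ∈ Finset.range n, k i * (mom k t 2 (Finset.range n) -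
      t i * mom k t 1 (Finset.range n)) * Y i = mom k t 2 (Finset.range n) *
        ∑ i ∈ Finset.range n, t i ^ 0 * k i * Y i - mom k t 1 (Finset.range n) *
        ∑ i ∈ Finset.range n, t i ^ 1 * k i * Y i := by
    rw [Finset.mul_sum, Finset.mul_sum, ← Finset.sum_sub_distrib]
    exact Finset.sum_congr rfl fun i _ => by ring
  rw [hnum, mHat]
  simp only [hS, hT]
  have hden : h ^ 0 * mom k t 0 (Finset.range n) * (h ^ 2 * mom k t 2 (Finset.range n)) -
      h ^ 1 * mom k t 1 (Finset.range n) * (h ^ 1 * mom k t 1 (Finset.range n)) + ((n : ℝ) ^ 2)⁻¹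
      = h ^ 2 * (gram k t (Finset.range n) + ((n * h) ^ 2)⁻¹) := by
    rw [gram, mul_pow, mul_inv]
    field_simp
  rw [hden]
  rw [← mul_div_mul_left _ (gram k t (Finset.range n) + ((n * h) ^ 2)⁻¹)
    (pow_ne_zero 2 hh.ne')]
  congr 1
  ring

end

/-! ### Expectations of functions of one scaled design point. -/

section

/-- Design points seen from `x` in the scale `h`. -/
def scaled {Ω : Type*} (X : ℕ → Ω → ℝ) (x h : ℝ) (i : ℕ) (w : Ω) : ℝ := (x - X i w) / h

theorem sub_mul_scaled {Ω : Type*} {X : ℕ → Ω → ℝ} {x h : ℝ} (hh : 0 < h) (i : ℕ) (w : Ω) :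
    x - h * scaled X x h i w = X i w := by
  rw [scaled, mul_div_cancel₀ _ hh.ne']; ring

variable {Ω : Type*} [MeasurableSpace Ω] {P : Measure Ω} {f : ℝ → ℝ} {X : ℕ → Ω → ℝ} {x : ℝ}

/-- `X` is a sequence of independent design points whose common density `f` is continuous
at `x`. -/
structure IsDesign (P : Measure Ω) (f : ℝ → ℝ) (X : ℕ → Ω → ℝ) (x : ℝ) : Prop where
  measurable_f : Measurable f
  f_nonneg : ∀ y, 0 ≤ f y
  measurable_X : ∀ i, Measurable (X i)
  independent : iIndepFun X P
  law_X : ∀ i, P.map (X i) = volume.withDensity (fun y => ENNReal.ofReal (f y))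
  continuousAt_f : ContinuousAt f x

namespace IsDesign

theorem measurable_scaled (hD : IsDesign P f X x) (h : ℝ) (i : ℕ) :
    Measurable (scaled X x h i) :=
  (measurable_const.sub (hD.measurable_X i)).div_const h

/-- Substitution `y = x - h s` in the integral against the density. Integrability is not required:
the change of variables is valid for Bochner integrals with their default value 0. -/
theorem integral_scaled (hD : IsDesign P f X x) {h : ℝ} (hh : 0 < h) {F : ℝ → ℝ}
    (hF : Measurable F) (i : ℕ) :
    ∫ w, F (scaled X x h i w) ∂P = h * ∫ s, f (x - h * s) * F s := by
  have hF' : Measurable (fun y => F ((x - y) / h)) := by fun_prop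
  have h1 : ∫ w, F (scaled X x h i w) ∂P = ∫ y, F ((x - y) / h) ∂(P.map (X i)) := by
    rw [integral_map (hD.measurable_X i).aemeasurable hF'.aestronglyMeasurable]
    rfl
  rw [h1, hD.law_X i, integral_withDensity_eq_integral_toReal_smul
    hD.measurable_f.ennreal_ofReal (ae_of_all _ fun _ => ENNReal.ofReal_lt_top)]
  have h2 : ∫ y, (ENNReal.ofReal (f y)).toReal • F ((x - y) / h) =
      ∫ u, f (x - u) * F (u / h) := by
    rw [← integral_sub_left_eq_self _ volume x]
    refine integral_congr_ae (ae_of_all _ fun u => ?_)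
    simp [ENNReal.toReal_ofReal (hD.f_nonneg _)]
  rw [h2]
  have h3 := Measure.integral_comp_mul_left (fun u => f (x - u) * F (u / h)) h
  simp only [mul_div_cancel_left₀ _ hh.ne'] at h3
  rw [h3, abs_of_pos (inv_pos.2 hh), smul_eq_mul, mul_inv_cancel_left₀ hh.ne']

theorem integrable_scaled (hD : IsDesign P f X x) {h : ℝ} (hh : 0 < h) {F : ℝ → ℝ}
    (hF : Measurable F) (i : ℕ) (hi : Integrable (fun s => f (x - h * s) * F s)) :
    Integrable (fun w => F (scaled X x h i w)) P := by
  have hF' : Measurable (fun y => F ((x - y) / h)) := by fun_prop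
  have h1 : Integrable (fun y => F ((x - y) / h)) (P.map (X i)) := by
    rw [hD.law_X i, integrable_withDensity_iff_integrable_smul'
      hD.measurable_f.ennreal_ofReal (ae_of_all _ fun _ => ENNReal.ofReal_lt_top)]
    have h3 := (integrable_comp_mul_left_iff (fun u => f (x - u) * F (u / h)) hh.ne').1
    simp only [mul_div_cancel_left₀ _ hh.ne'] at h3
    have h4 := (h3 hi).comp_sub_left x
    refine h4.congr (ae_of_all _ fun u => ?_)
    simp [ENNReal.toReal_ofReal (hD.f_nonneg _)]
  exact h1.comp_measurable (hD.measurable_X i)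

theorem integral_scaled_eq (hD : IsDesign P f X x) {h : ℝ} (hh : 0 < h) {F : ℝ → ℝ}
    (hF : Measurable F) (i j : ℕ) :
    ∫ w, F (scaled X x h i w) ∂P = ∫ w, F (scaled X x h j w) ∂P := by
  rw [hD.integral_scaled hh hF, hD.integral_scaled hh hF]

end IsDesign

/-- Measurable, integrable and of bounded support. -/
structure IsCell (φ : ℝ → ℝ) (B : ℝ) : Prop where
  measurable : Measurable φ
  integrable : Integrable φ
  support_le : ∀ s, φ s ≠ 0 → |s| ≤ B

/-- There is a scale below which `g (x - h s)` is close to `g x` for all `|s| ≤ B`. -/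
theorem eventually_forall_abs_le {g : ℝ → ℝ} (hg : ContinuousAt g x) {h : ℕ → ℝ}
    (hzero : Tendsto h atTop (𝓝 0)) (B : ℝ) {η : ℝ} (hη : 0 < η) :
    ∀ᶠ n in atTop, ∀ s, |s| ≤ B → |g (x - h n * s) - g x| < η := by
  obtain ⟨r, hr, hr'⟩ := Metric.continuousAt_iff.1 hg η hη
  have h1 : Tendsto (fun n => |h n| * (|B| + 1)) atTop (𝓝 0) := by
    simpa using (hzero.abs.mul_const (|B| + 1))
  filter_upwards [h1.eventually_lt_const hr] with n hn s hs
  refine hr' ?_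
  rw [Real.dist_eq]
  have : x - h n * s - x = -(h n * s) := by ring
  rw [this, abs_neg, abs_mul]
  refine lt_of_le_of_lt ?_ hn
  gcongr
  linarith [le_abs_self B]

namespace IsDesign

variable {h : ℕ → ℝ} {φ τ : ℝ → ℝ} {B : ℝ}

/-- For small `h`, continuity at `x` bounds `f * τ` on the window that carries `φ`, so a multiple of
`|φ|` dominates; nothing global is needed of `f` or `τ`. -/
theorem eventually_integrable (hD : IsDesign P f X x) (hpos : ∀ n, 0 < h n)
    (hzero : Tendsto h atTop (𝓝 0)) (hφ : IsCell φ B) (hτ : Measurable τ)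
    (hτx : ContinuousAt τ x) :
    ∀ᶠ n in atTop, ∀ i,
      Integrable (fun w => φ (scaled X x (h n) i w) * τ (X i w)) P := by
  have hg : ContinuousAt (fun y => f y * τ y) x := hD.continuousAt_f.mul hτx
  filter_upwards [eventually_forall_abs_le hg hzero B one_pos] with n hn i
  have h1 : Integrable (fun s => f (x - h n * s) * (φ s * τ (x - h n * s))) := by
    refine Integrable.mono' (hφ.integrable.abs.mul_const (|f x * τ x| + 1)) ?_
      (ae_of_all _ fun s => ?_)
    · have := hD.measurable_f
      have := hφ.measurable
      exact Measurable.aestronglyMeasurable (by fun_prop)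
    · by_cases hs : φ s = 0
      · simp [hs]
      have h2 := hn s (hφ.support_le s hs)
      have h3 : |f (x - h n * s) * τ (x - h n * s)| ≤ |f x * τ x| + 1 := by
        have := abs_sub_abs_le_abs_sub (f (x - h n * s) * τ (x - h n * s)) (f x * τ x)
        linarith
      calc ‖f (x - h n * s) * (φ s * τ (x - h n * s))‖
          = |φ s| * |f (x - h n * s) * τ (x - h n * s)| := by
            rw [Real.norm_eq_abs, ← abs_mul]; congr 1; ring
        _ ≤ _ := by gcongr
  have := hφ.measurable
  have h2 := hD.integrable_scaled (hpos n) (F := fun s => φ s * τ (x - h n * s))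
    (by fun_prop) i h1
  simpa only [sub_mul_scaled (hpos n)] using h2

theorem tendsto_integral (hD : IsDesign P f X x) (hpos : ∀ n, 0 < h n)
    (hzero : Tendsto h atTop (𝓝 0)) (hφ : IsCell φ B) (hτ : Measurable τ)
    (hτx : ContinuousAt τ x) (i : ℕ) :
    Tendsto (fun n => (h n)⁻¹ * ∫ w, φ (scaled X x (h n) i w) * τ (X i w) ∂P) atTop
      (𝓝 (f x * τ x * ∫ s, φ s)) := by
  have hg : ContinuousAt (fun y => f y * τ y) x := hD.continuousAt_f.mul hτx
  have hφm := hφ.measurable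
  have hfm := hD.measurable_f
  have h0 : ∀ n, (h n)⁻¹ * ∫ w, φ (scaled X x (h n) i w) * τ (X i w) ∂P =
      ∫ s, f (x - h n * s) * (φ s * τ (x - h n * s)) := by
    intro n
    have h2 := hD.integral_scaled (hpos n) (F := fun s => φ s * τ (x - h n * s))
      (by fun_prop) i
    simp only [sub_mul_scaled (hpos n)] at h2
    rw [h2, inv_mul_cancel_left₀ (hpos n).ne']
  simp only [h0]
  rw [← integral_const_mul]
  refine tendsto_integral_filter_of_dominated_convergence
    (fun s => |φ s| * (|f x * τ x| + 1)) ?_ ?_ (hφ.integrable.abs.mul_const _) ?_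
  · exact Eventually.of_forall fun n => Measurable.aestronglyMeasurable (by fun_prop)
  · filter_upwards [eventually_forall_abs_le hg hzero B one_pos] with n hn
    refine ae_of_all _ fun s => ?_
    by_cases hs : φ s = 0
    · simp [hs]
    have h2 := hn s (hφ.support_le s hs)
    have h3 : |f (x - h n * s) * τ (x - h n * s)| ≤ |f x * τ x| + 1 := by
      have := abs_sub_abs_le_abs_sub (f (x - h n * s) * τ (x - h n * s)) (f x * τ x)
      linarith
    calc ‖f (x - h n * s) * (φ s * τ (x - h n * s))‖
        = |φ s| * |f (x - h n * s) * τ (x - h n * s)| := by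
          rw [Real.norm_eq_abs, ← abs_mul]; congr 1; ring
      _ ≤ _ := by gcongr
  · refine ae_of_all _ fun s => ?_
    have h1 : Tendsto (fun n => x - h n * s) atTop (𝓝 x) := by
      simpa using tendsto_const_nhds.sub (hzero.mul_const s)
    have h2 := (hg.tendsto.comp h1).mul_const (φ s)
    refine h2.congr fun n => ?_
    simp only [Function.comp]
    ring

end IsDesign

end

/-! ### Weak law and lower tail for local sums of the design. -/

section

/-- Measurable, square integrable and of bounded support. -/
structure IsSqCell (φ : ℝ → ℝ) (B : ℝ) : Prop where
  measurable : Measurable φ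
  integrable_sq : Integrable (fun s => φ s ^ 2)
  support_le : ∀ s, φ s ≠ 0 → |s| ≤ B

theorem IsSqCell.sq {φ : ℝ → ℝ} {B : ℝ} (hφ : IsSqCell φ B) : IsCell (fun s => φ s ^ 2) B :=
  ⟨hφ.measurable.pow_const 2, hφ.integrable_sq, fun s hs => hφ.support_le s (by
    rintro h; simp [h] at hs)⟩

theorem IsSqCell.cell {φ : ℝ → ℝ} {B : ℝ} (hφ : IsSqCell φ B) : IsCell φ B := by
  refine ⟨hφ.measurable, ?_, hφ.support_le⟩
  -- On the window `|φ| ≤ φ ^ 2 + 1`, so the indicator supplies the missing part of an integrable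
  -- bound.
  have h1 : Integrable ((Set.Icc (-B) B).indicator (fun _ : ℝ => (1 : ℝ))) :=
    (integrable_indicator_iff measurableSet_Icc).2 (integrableOn_const (by simp))
  refine (hφ.integrable_sq.add h1).mono' hφ.measurable.aestronglyMeasurable
    (ae_of_all _ fun s => ?_)
  by_cases hs : φ s = 0
  · have : 0 ≤ (Set.Icc (-B) B).indicator (fun _ : ℝ => (1 : ℝ)) s :=
      Set.indicator_nonneg (fun _ _ => zero_le_one) s
    simpa [hs] using this
  · have : s ∈ Set.Icc (-B) B := abs_le.1 (hφ.support_le s hs)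
    simp only [Pi.add_apply, Set.indicator_of_mem this, Real.norm_eq_abs]
    nlinarith [sq_nonneg (|φ s| - 1), sq_abs (φ s), abs_nonneg (φ s)]

theorem integral_sub_const_sq {Ω : Type*} [MeasurableSpace Ω] {P : Measure Ω}
    [IsProbabilityMeasure P] {Z : Ω → ℝ} (hZ : MemLp Z 2 P) (c : ℝ) :
    ∫ w, (Z w - c) ^ 2 ∂P = Var[Z; P] + (P[Z] - c) ^ 2 := by
  have h1 := variance_eq_sub (hZ.sub (memLp_const c))
  rw [show Z - (fun _ => c) = fun w => Z w - c from rfl,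
    variance_sub_const hZ.aestronglyMeasurable, integral_sub (hZ.integrable one_le_two)
      (integrable_const c)] at h1
  simp only [integral_const, probReal_univ, one_smul] at h1
  rw [h1]
  simp only [Pi.pow_apply]
  ring

variable {Ω : Type*} [MeasurableSpace Ω] {P : Measure Ω} {f : ℝ → ℝ} {X : ℕ → Ω → ℝ} {x : ℝ}
variable {h : ℕ → ℝ} {φ : ℝ → ℝ} {B : ℝ}

namespace IsDesign

theorem tendsto_integral_one (hD : IsDesign P f X x) (hpos : ∀ n, 0 < h n)
    (hzero : Tendsto h atTop (𝓝 0)) (hφ : IsCell φ B) (i : ℕ) :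
    Tendsto (fun n => (h n)⁻¹ * ∫ w, φ (scaled X x (h n) i w) ∂P) atTop
      (𝓝 (f x * ∫ s, φ s)) := by
  simpa using hD.tendsto_integral hpos hzero hφ (τ := fun _ => 1) measurable_const
    continuousAt_const i

theorem eventually_integrable_one (hD : IsDesign P f X x) (hpos : ∀ n, 0 < h n)
    (hzero : Tendsto h atTop (𝓝 0)) (hφ : IsCell φ B) :
    ∀ᶠ n in atTop, ∀ i, Integrable (fun w => φ (scaled X x (h n) i w)) P := by
  simpa using hD.eventually_integrable hpos hzero hφ (τ := fun _ => 1) measurable_const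
    continuousAt_const

theorem eventually_memLp (hD : IsDesign P f X x) (hpos : ∀ n, 0 < h n)
    (hzero : Tendsto h atTop (𝓝 0)) (hφ : IsSqCell φ B) :
    ∀ᶠ n in atTop, ∀ i, MemLp (fun w => φ (scaled X x (h n) i w)) 2 P := by
  filter_upwards [hD.eventually_integrable_one hpos hzero hφ.sq] with n hn i
  exact (memLp_two_iff_integrable_sq (hφ.measurable.comp
    (hD.measurable_scaled _ i)).aestronglyMeasurable).2 (hn i)

theorem iIndepFun_scaled (hD : IsDesign P f X x) (h : ℝ) {φ : ℝ → ℝ} (hφ : Measurable φ) :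
    iIndepFun (fun i w => φ (scaled X x h i w)) P :=
  hD.independent.comp (fun _ y => φ ((x - y) / h)) fun _ => by fun_prop

/-- The normalised variance is at most `(nh)⁻¹ · h⁻¹ E φ²`, which vanishes, and the mean converges
by `tendsto_integral_one`. The statement is uniform over index sets with `n` or `n - 1` elements
because it is applied to samples with one point left out; the missing point changes the mean by a
relative `1 / n`. -/
theorem law_of_large_numbers [IsProbabilityMeasure P] (hD : IsDesign P f X x)
    (hpos : ∀ n, 0 < h n) (hzero : Tendsto h atTop (𝓝 0))
    (hnh : Tendsto (fun n : ℕ => (n : ℝ) * h n) atTop atTop) (hφ : IsSqCell φ B)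
    {η : ℝ} (hη : 0 < η) :
    ∀ᶠ n : ℕ in atTop, ∀ I : Finset ℕ, I.card ≤ n → n ≤ I.card + 1 →
      ∫ w, ((n * h n)⁻¹ * ∑ i ∈ I, φ (scaled X x (h n) i w) - f x * ∫ s, φ s) ^ 2 ∂P ≤ η := by
  set a := f x * ∫ s, φ s with ha
  have t1 := hD.tendsto_integral_one hpos hzero hφ.cell 0
  have t2 := hD.tendsto_integral_one hpos hzero hφ.sq 0
  have t3 : Tendsto (fun n : ℕ => ((n : ℝ) * h n)⁻¹ *
      ((h n)⁻¹ * ∫ w, φ (scaled X x (h n) 0 w) ^ 2 ∂P)) atTop (𝓝 0) := by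
    simpa using hnh.inv_tendsto_atTop.mul t2
  have t4 : Tendsto (fun n : ℕ => |(h n)⁻¹ * (∫ w, φ (scaled X x (h n) 0 w) ∂P) - a| +
      (n : ℝ)⁻¹ * |(h n)⁻¹ * ∫ w, φ (scaled X x (h n) 0 w) ∂P|) atTop (𝓝 0) := by
    have := (t1.sub_const a).abs.add
      (tendsto_inv_atTop_nhds_zero_nat (𝕜 := ℝ) |>.mul t1.abs)
    simpa [ha] using this
  have t5 := t3.add (t4.pow 2)
  simp only [ne_eq, OfNat.ofNat_ne_zero, not_false_eq_true, zero_pow, add_zero] at t5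
  filter_upwards [t5.eventually_le_const hη, eventually_gt_atTop 0,
    hD.eventually_memLp hpos hzero hφ] with n hn hn0 hL I hI1 hI2
  refine le_trans ?_ hn
  have hn0' : (0 : ℝ) < n := by exact_mod_cast hn0
  have hh := hpos n
  set Φ : ℕ → Ω → ℝ := fun i w => φ (scaled X x (h n) i w) with hΦ
  have hS : MemLp (∑ i ∈ I, Φ i) 2 P := memLp_finsetSum' _ fun i _ => hL i
  have hind := hD.iIndepFun_scaled (h n) hφ.measurable
  have hvar : Var[∑ i ∈ I, Φ i; P] ≤ n * ∫ w, Φ 0 w ^ 2 ∂P := by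
    rw [IndepFun.variance_sum (fun i _ => hL i) fun i _ j _ hij => hind.indepFun hij]
    calc ∑ i ∈ I, Var[Φ i; P] ≤ ∑ i ∈ I, ∫ w, Φ 0 w ^ 2 ∂P := by
          refine Finset.sum_le_sum fun i _ => ?_
          refine (variance_le_expectation_sq (hL i).aestronglyMeasurable).trans_eq ?_
          exact hD.integral_scaled_eq hh hφ.sq.measurable i 0
      _ = I.card * ∫ w, Φ 0 w ^ 2 ∂P := by simp
      _ ≤ _ := by
          have : 0 ≤ ∫ w, Φ 0 w ^ 2 ∂P := integral_nonneg fun _ => sq_nonneg _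
          gcongr
  have hmean : P[∑ i ∈ I, Φ i] = I.card * ∫ w, Φ 0 w ∂P := by
    simp only [Finset.sum_apply]
    rw [integral_finsetSum _ fun i _ => (hL i).integrable one_le_two]
    simp [hΦ, hD.integral_scaled_eq hh hφ.measurable _ 0]
  have hrw : ∀ w, (n * h n)⁻¹ * ∑ i ∈ I, φ (scaled X x (h n) i w) - a =
      ((n * h n)⁻¹ • ∑ i ∈ I, Φ i) w - a := fun w => by simp [hΦ]
  simp only [hrw]
  rw [integral_sub_const_sq (hS.const_smul _), variance_smul]
  have hm' : P[(n * h n)⁻¹ • ∑ i ∈ I, Φ i] = (n * h n)⁻¹ * (I.card * ∫ w, Φ 0 w ∂P) := by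
    rw [← hmean, ← integral_const_mul]; rfl
  rw [hm']
  refine add_le_add ?_ ?_
  · calc ((n * h n)⁻¹) ^ 2 * Var[∑ i ∈ I, Φ i; P]
        ≤ ((n * h n)⁻¹) ^ 2 * (n * ∫ w, Φ 0 w ^ 2 ∂P) := by gcongr
      _ = _ := by field_simp; rfl
  · rw [← sq_abs]
    refine pow_le_pow_left₀ (abs_nonneg _) ?_ 2
    set e := (h n)⁻¹ * ∫ w, Φ 0 w ∂P with he
    have h1 : (n * h n)⁻¹ * (I.card * ∫ w, Φ 0 w ∂P) - a =
        (e - a) + (I.card / n - 1) * e := by rw [he]; field_simp; ring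
    rw [h1]
    refine (abs_add_le _ _).trans (add_le_add le_rfl ?_)
    rw [abs_mul]
    refine mul_le_mul_of_nonneg_right ?_ (abs_nonneg _)
    have h2 : (I.card : ℝ) ≤ n := by exact_mod_cast hI1
    have h3 : (n : ℝ) ≤ I.card + 1 := by exact_mod_cast hI2
    have h4 : (I.card : ℝ) / n - 1 = -((n - I.card) / n) := by field_simp; ring
    rw [h4, abs_neg, abs_of_nonneg (by apply div_nonneg <;> linarith), div_eq_mul_inv]
    exact mul_le_of_le_one_left (by positivity) (by linarith)

/-- Chernoff's bound for a sum of independent indicators with success probability about `p h`. -/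
theorem tail_bound [IsProbabilityMeasure P] (hD : IsDesign P f X x)
    (hpos : ∀ n, 0 < h n) (hzero : Tendsto h atTop (𝓝 0)) {A : Set ℝ} (hA : MeasurableSet A)
    (hAB : ∀ s ∈ A, |s| ≤ B) {p : ℝ} (hp : 0 < p) (hpA : p ≤ f x * volume.real A) :
    ∀ᶠ n : ℕ in atTop, ∀ I : Finset ℕ, n ≤ I.card + 1 →
      P.real {w | ∑ i ∈ I, A.indicator (fun _ => (1 : ℝ)) (scaled X x (h n) i w)
        ≤ p / 4 * (n * h n)} ≤ Real.exp (-(p / 8 * (n * h n))) := by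
  set φ : ℝ → ℝ := A.indicator (fun _ => (1 : ℝ)) with hφ
  have hφm : Measurable φ := measurable_const.indicator hA
  have hvol : volume A ≠ ⊤ := by
    refine ne_top_of_le_ne_top ?_ (measure_mono (t := Set.Icc (-B) B) fun s hs =>
      abs_le.1 (hAB s hs))
    simp
  have hcell : IsCell φ B := by
    refine ⟨hφm, (integrable_indicator_iff hA).2 (integrableOn_const hvol), fun s hs => ?_⟩
    exact hAB s (Set.mem_of_indicator_ne_zero hs)
  have hint : ∫ s, φ s = volume.real A := by
    rw [integral_indicator hA]; simp
  have t1 := hD.tendsto_integral_one hpos hzero hcell 0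
  rw [hint] at t1
  -- One factor `7/8` is lost here and another in `I.card ≥ n - 1 ≥ 7n/8`. The constants close
  -- because `(7/8)² / 2 = 49/128` exceeds `1/4 + 1/8 = 48/128`.
  have hlt : 7 / 8 * p < f x * volume.real A := by linarith
  filter_upwards [t1.eventually_const_le hlt, eventually_ge_atTop 8] with n hn hn8 I hI
  have hh := hpos n
  set Φ : ℕ → Ω → ℝ := fun i w => φ (scaled X x (h n) i w) with hΦ
  have hΦm : ∀ i, Measurable (Φ i) := fun i => hφm.comp (hD.measurable_scaled _ i)
  have h01 : ∀ i w, Φ i w = 0 ∨ Φ i w = 1 := fun i w => by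
    by_cases hs : scaled X x (h n) i w ∈ A <;> simp [hΦ, hφ, hs]
  have hΦi : ∀ i, Integrable (Φ i) P := fun i =>
    Integrable.of_bound (hΦm i).aestronglyMeasurable 1 (ae_of_all _ fun w => by
      rcases h01 i w with h | h <;> simp [h])
  set q := ∫ w, Φ 0 w ∂P with hq
  -- On the values 0 and 1 the exponential is affine, and `1 - e⁻¹ ≥ 1/2`.
  have hmgf : ∀ i, mgf (Φ i) P (-1) ≤ Real.exp (-(q / 2)) := by
    intro i
    have hexp : ∀ w, Real.exp (-1 * Φ i w) = 1 - (1 - Real.exp (-1)) * Φ i w := fun w => by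
      rcases h01 i w with h | h <;> simp [h]
    rw [mgf]
    simp only [hexp]
    rw [integral_sub (integrable_const _) ((hΦi i).const_mul _), integral_const_mul,
      hD.integral_scaled_eq hh hφm i 0]
    have hq0 : 0 ≤ q := integral_nonneg fun w => by
      rcases h01 0 w with h | h <;> simp [h]
    have he : Real.exp (-1) ≤ 1 / 2 := by
      rw [Real.exp_neg, one_div]
      exact inv_anti₀ two_pos (by have := Real.add_one_le_exp (1 : ℝ); linarith)
    have := Real.add_one_le_exp (-(q / 2))
    simp only [integral_const, probReal_univ, one_smul]
    change 1 - (1 - Real.exp (-1)) * q ≤ _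
    nlinarith
  have hind := hD.iIndepFun_scaled (h n) hφm
  have hmgfS : mgf (∑ i ∈ I, Φ i) P (-1) ≤ Real.exp (-(q / 2)) ^ I.card := by
    rw [hind.mgf_sum hΦm]
    exact (Finset.prod_le_prod (fun i _ => mgf_nonneg) fun i _ => hmgf i).trans_eq (by simp)
  have hch := measure_le_le_exp_mul_mgf (μ := P) (X := ∑ i ∈ I, Φ i) (t := -1)
    (p / 4 * (n * h n)) (by norm_num) (by
      refine Integrable.of_bound (C := 1) ?_ (ae_of_all _ fun w => ?_)
      · simp only [Finset.sum_apply]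
        exact (((Finset.measurable_sum I fun i _ => hΦm i).const_mul
          (-1)).exp).aestronglyMeasurable
      · rw [Real.norm_eq_abs, Real.abs_exp, Real.exp_le_one_iff, Finset.sum_apply]
        have : 0 ≤ ∑ i ∈ I, Φ i w := Finset.sum_nonneg fun i _ => by
          rcases h01 i w with h | h <;> simp [h]
        linarith)
  simp only [Finset.sum_apply] at hch
  refine hch.trans ?_
  calc Real.exp (-(-1) * (p / 4 * (n * h n))) * mgf (∑ i ∈ I, Φ i) P (-1)
      ≤ Real.exp (-(-1) * (p / 4 * (n * h n))) * Real.exp (-(q / 2)) ^ I.card := by gcongr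
    _ = Real.exp (p / 4 * (n * h n) - I.card * q / 2) := by
        rw [← Real.exp_nat_mul, ← Real.exp_add]; congr 1; ring
    _ ≤ _ := by
        refine Real.exp_le_exp.2 ?_
        have hqh : 7 / 8 * p * h n ≤ q := by
          rwa [inv_mul_eq_div, le_div_iff₀ hh] at hn
        have hn8' : (8 : ℝ) ≤ n := by exact_mod_cast hn8
        have hc : 7 / 8 * (n : ℝ) ≤ I.card := by
          have : (n : ℝ) ≤ I.card + 1 := by exact_mod_cast hI
          linarith
        have h3 : 7 / 8 * (n : ℝ) * (7 / 8 * p * h n) ≤ I.card * q := by gcongr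
        have h4 : 0 ≤ p * (n * h n) := by positivity
        nlinarith

end IsDesign

end

/-! ### Kernel moments, and a lower bound for the Gram determinant off a rare event. -/

section

namespace IsKernel

variable {K : ℝ → ℝ}

theorem exists_bound (hK : IsKernel K) : ∃ B, 0 < B ∧ ∀ s, K s ≠ 0 → |s| ≤ B := by
  obtain ⟨B, hB⟩ := hK.compactSupport.isCompact.isBounded.subset_closedBall 0
  refine ⟨max B 1, by positivity, fun s hs => ?_⟩
  have := hB (subset_tsupport _ hs)
  simp only [Metric.mem_closedBall, dist_zero_right, Real.norm_eq_abs] at this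
  exact this.trans (le_max_left _ _)

theorem isSqCell (hK : IsKernel K) {B : ℝ} (hB : ∀ s, K s ≠ 0 → |s| ≤ B) (l : ℕ) (b : ℝ) :
    IsSqCell (fun s => (s - b) ^ l * K (s - b)) (B + |b|) := by
  have hKm := hK.measurable
  refine ⟨by fun_prop, ?_, fun s hs => ?_⟩
  · have h1 : Integrable (fun s => (s ^ l * K s) ^ 2) := by
      refine (hK.sq_integrable.const_mul ((B ^ l) ^ 2)).mono'
        (Measurable.aestronglyMeasurable (by fun_prop)) (ae_of_all _ fun s => ?_)
      by_cases hs : K s = 0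
      · simp [hs]
      rw [Real.norm_of_nonneg (sq_nonneg _), mul_pow]
      have h2 : |s| ^ l ≤ B ^ l := pow_le_pow_left₀ (abs_nonneg _) (hB s hs) l
      have h3 : (s ^ l) ^ 2 ≤ (B ^ l) ^ 2 := by
        rw [← sq_abs (s ^ l), abs_pow]
        exact pow_le_pow_left₀ (by positivity) h2 2
      gcongr
    exact h1.comp_sub_right b
  · have h1 := hB _ (right_ne_zero_of_mul hs)
    have h2 := abs_add_le (s - b) b
    rw [sub_add_cancel] at h2
    linarith

theorem integral_shift (l : ℕ) (b : ℝ) :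
    ∫ s, (s - b) ^ l * K (s - b) = ∫ s, s ^ l * K s :=
  integral_sub_right_eq_self (fun s => s ^ l * K s) b

theorem integral_odd (hK : IsKernel K) {l : ℕ} (hl : Odd l) : ∫ s, s ^ l * K s = 0 := by
  have h := integral_neg_eq_self (fun s => s ^ l * K s) volume
  simp only [hK.symmetric, hl.neg_pow, neg_mul, integral_neg] at h
  linarith

/-- Otherwise `K` vanishes almost everywhere on the positive axis, as a countable union of level
sets shows, and by symmetry on the negative axis, contradicting total mass one. -/
theorem exists_pos_measure (hK : IsKernel K) :
    ∃ a : ℝ, 0 < a ∧ 0 < volume {s | a ≤ s ∧ a ≤ K s} := by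
  by_contra! hcon
  have h0 : ∀ m : ℕ, volume {s | 1 / ((m : ℝ) + 1) ≤ s ∧ 1 / ((m : ℝ) + 1) ≤ K s} = 0 :=
    fun m => le_antisymm (hcon _ (by positivity)) zero_le
  have h1 : volume {s | 0 < s ∧ 0 < K s} = 0 := by
    refine measure_mono_null (fun s hs => ?_) (measure_iUnion_null h0)
    obtain ⟨m, hm⟩ := exists_nat_one_div_lt (lt_min hs.1 hs.2)
    exact Set.mem_iUnion.2 ⟨m, hm.le.trans (min_le_left _ _), hm.le.trans (min_le_right _ _)⟩
  have h2 : volume {s | s < 0 ∧ 0 < K s} = 0 := by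
    rw [← Measure.measure_preimage_neg volume] at h1
    refine measure_mono_null (fun s hs => ?_) h1
    have := hs.1
    have := hs.2
    simp only [Set.mem_preimage, Set.mem_ofPred_eq, hK.symmetric]
    constructor <;> linarith
  have h3 : K =ᵐ[volume] 0 := by
    have h4 : ∀ᵐ s, s ∉ {s | 0 < s ∧ 0 < K s} := measure_eq_zero_iff_ae_notMem.1 h1
    have h5 : ∀ᵐ s, s ∉ {s | s < 0 ∧ 0 < K s} := measure_eq_zero_iff_ae_notMem.1 h2
    have h6 : ∀ᵐ s : ℝ, s ∉ ({0} : Set ℝ) := measure_eq_zero_iff_ae_notMem.1 (by simp)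
    filter_upwards [h4, h5, h6] with s h4 h5 h6
    refine le_antisymm ?_ (hK.nonneg s)
    by_contra! hlt
    rcases lt_trichotomy s 0 with h | h | h
    · exact h5 ⟨h, hlt⟩
    · exact h6 h
    · exact h4 ⟨h, hlt⟩
  have := hK.integral_eq_one
  rw [integral_congr_ae h3] at this
  simp at this

end IsKernel

theorem measure_preimage_sub_const (b : ℝ) (A : Set ℝ) :
    volume ((fun s => s - b) ⁻¹' A) = volume A := by
  simpa only [sub_eq_add_neg] using measure_preimage_add_right volume (-b) A

/-- Sequences with few entries in `A` or few entries in `A'` among those indexed by `I`. -/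
def sparse (A A' : Set ℝ) (c : ℝ) (I : Finset ℕ) : Set (ℕ → ℝ) :=
  {v | ∑ i ∈ I, A.indicator (fun _ => (1 : ℝ)) (v i) ≤ c} ∪
    {v | ∑ i ∈ I, A'.indicator (fun _ => (1 : ℝ)) (v i) ≤ c}

theorem measurableSet_sparse {A A' : Set ℝ} (hA : MeasurableSet A) (hA' : MeasurableSet A')
    (c : ℝ) (I : Finset ℕ) : MeasurableSet (sparse A A' c I) := by
  refine (measurableSet_le (Finset.measurable_sum I fun i _ => ?_) measurable_const).union
    (measurableSet_le (Finset.measurable_sum I fun i _ => ?_) measurable_const)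
  · exact (measurable_const.indicator hA).comp (measurable_pi_apply i)
  · exact (measurable_const.indicator hA').comp (measurable_pi_apply i)

theorem mem_sparse_congr {A A' : Set ℝ} {c : ℝ} {I : Finset ℕ} {v v' : ℕ → ℝ}
    (h : ∀ i ∈ I, v i = v' i) : v ∈ sparse A A' c I ↔ v' ∈ sparse A A' c I := by
  simp only [sparse, Set.mem_union, Set.mem_ofPred_eq]
  rw [Finset.sum_congr rfl fun i hi => by rw [h i hi],
    Finset.sum_congr (f := fun i => A'.indicator (fun _ => (1 : ℝ)) (v i)) rfl
      fun i hi => by rw [h i hi]]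

theorem sparse_anti {A A' : Set ℝ} {c : ℝ} {I J : Finset ℕ} (hIJ : I ⊆ J) :
    sparse A A' c J ⊆ sparse A A' c I := by
  rintro v (hv | hv)
  · refine Or.inl (le_trans ?_ (Set.mem_ofPred_eq ▸ hv))
    exact Finset.sum_le_sum_of_subset_of_nonneg hIJ fun i _ _ =>
      Set.indicator_nonneg (fun _ _ => zero_le_one) _
  · refine Or.inr (le_trans ?_ (Set.mem_ofPred_eq ▸ hv))
    exact Finset.sum_le_sum_of_subset_of_nonneg hIJ fun i _ _ =>
      Set.indicator_nonneg (fun _ _ => zero_le_one) _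

/-- A point of the first set and one of the second are at least `2a` apart and have kernel weights
at least `a`, so the pair contributes `a² (2a)² = 4a⁴`. There are more than `c²` such pairs. -/
theorem le_gram_of_notMem_sparse {K : ℝ → ℝ} (hK : ∀ s, 0 ≤ K s) {a b c : ℝ} (ha : 0 < a)
    (hc : 0 ≤ c) {I : Finset ℕ} {v : ℕ → ℝ}
    (hv : v ∉ sparse {s | a ≤ s - b ∧ a ≤ K (s - b)} {s | s - b ≤ -a ∧ a ≤ K (s - b)} c I) :
    4 * a ^ 4 * c ^ 2 ≤ gram (fun i => K (v i - b)) (fun i => v i - b) I := by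
  simp only [sparse, Set.mem_union, Set.mem_ofPred_eq, not_or, not_le] at hv
  obtain ⟨h1, h2⟩ := hv
  refine le_trans ?_ (mul_sum_mul_sum_le_gram (c := 4 * a ^ 4) (I := I)
    (p := fun i => Set.indicator {s | a ≤ s - b ∧ a ≤ K (s - b)} (fun _ => (1 : ℝ)) (v i))
    (q := fun i => Set.indicator {s | s - b ≤ -a ∧ a ≤ K (s - b)} (fun _ => (1 : ℝ)) (v i)) ?_)
  · rw [sq c]
    have := hc.trans h1.le
    gcongr
  · have key : ∀ s u : ℝ, a ≤ s → a ≤ K s → u ≤ -a → a ≤ K u →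
        4 * a ^ 4 ≤ K s * K u * (s - u) ^ 2 := by
      intro s u hs hKs hu hKu
      have h0 := hK s
      have h0' := hK u
      have e1 : a * a ≤ K s * K u := by gcongr
      have e2 : (2 * a) ^ 2 ≤ (s - u) ^ 2 := pow_le_pow_left₀ (by positivity) (by linarith) 2
      calc 4 * a ^ 4 = a * a * (2 * a) ^ 2 := by ring
        _ ≤ _ := by gcongr
    intro i _ j _
    simp only [Set.indicator_apply, Set.mem_ofPred_eq]
    have hnn : 0 ≤ K (v i - b) * K (v j - b) * ((v i - b) - (v j - b)) ^ 2 :=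
      mul_nonneg (mul_nonneg (hK _) (hK _)) (sq_nonneg _)
    by_cases hi : a ≤ v i - b ∧ a ≤ K (v i - b)
    · have hi' : ¬ (v i - b ≤ -a ∧ a ≤ K (v i - b)) := fun h => by linarith [hi.1, h.1]
      by_cases hj : v j - b ≤ -a ∧ a ≤ K (v j - b)
      · have := key _ _ hi.1 hi.2 hj.1 hj.2
        simpa only [if_pos hi, if_neg hi', if_pos hj, one_mul, zero_mul, add_zero, mul_one]
          using this
      · simpa only [if_pos hi, if_neg hi', if_neg hj, zero_mul, add_zero, mul_zero] using hnn
    · by_cases hi' : v i - b ≤ -a ∧ a ≤ K (v i - b)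
      · by_cases hj : a ≤ v j - b ∧ a ≤ K (v j - b)
        · have := key _ _ hj.1 hj.2 hi'.1 hi'.2
          have e : K (v i - b) * K (v j - b) * ((v i - b) - (v j - b)) ^ 2 =
            K (v j - b) * K (v i - b) * ((v j - b) - (v i - b)) ^ 2 := by ring
          rw [e]
          simpa only [if_neg hi, if_pos hi', if_pos hj, one_mul, zero_mul, zero_add, mul_one]
            using this
        · simpa only [if_neg hi, if_pos hi', if_neg hj, zero_mul, add_zero, mul_zero] using hnn
      · simpa only [if_neg hi, if_neg hi', zero_mul, add_zero, mul_zero] using hnn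

variable {Ω : Type*} [MeasurableSpace Ω] {P : Measure Ω} {f : ℝ → ℝ} {X : ℕ → Ω → ℝ} {x : ℝ}
variable {h : ℕ → ℝ}

/-- The sequence of scaled design points. -/
def scaledSeq {Ω : Type*} (X : ℕ → Ω → ℝ) (x h : ℝ) (w : Ω) : ℕ → ℝ := fun i => scaled X x h i w

/-- Except on an event of exponentially small probability, which is determined by the design
points with index in `I`, the Gram determinant is of the order of its expectation. -/
theorem IsDesign.exists_sparse [IsProbabilityMeasure P] (hD : IsDesign P f X x) (hfx : 0 < f x)
    (hpos : ∀ n, 0 < h n) (hzero : Tendsto h atTop (𝓝 0)) {K : ℝ → ℝ} (hK : IsKernel K)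
    (b : ℝ) :
    ∃ (A A' : Set ℝ) (c c' : ℝ), MeasurableSet A ∧ MeasurableSet A' ∧ 0 < c ∧ 0 < c' ∧
      (∀ (t : ℝ) (I : Finset ℕ) (v : ℕ → ℝ), 0 ≤ t → v ∉ sparse A A' (c * t) I →
        c' * t ^ 2 ≤ gram (fun i => K (v i - b)) (fun i => v i - b) I) ∧
      ∀ᶠ n : ℕ in atTop, ∀ I : Finset ℕ, n ≤ I.card + 1 →
        P.real {w | scaledSeq X x (h n) w ∈ sparse A A' (c * (n * h n)) I} ≤
          2 * Real.exp (-(c / 2 * (n * h n))) := by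
  obtain ⟨a, ha, hvol⟩ := hK.exists_pos_measure
  obtain ⟨B, -, hB⟩ := hK.exists_bound
  have hKm := hK.measurable
  set A : Set ℝ := {s | a ≤ s - b ∧ a ≤ K (s - b)} with hA
  set A' : Set ℝ := {s | s - b ≤ -a ∧ a ≤ K (s - b)} with hA'
  have hAm : MeasurableSet A :=
    (measurableSet_le (f := fun _ => a) (g := fun s => s - b) (by fun_prop) (by fun_prop)).inter
      (measurableSet_le (f := fun _ => a) (g := fun s => K (s - b)) (by fun_prop) (by fun_prop))
  have hAm' : MeasurableSet A' :=
    (measurableSet_le (f := fun s => s - b) (g := fun _ => -a) (by fun_prop) (by fun_prop)).inter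
      (measurableSet_le (f := fun _ => a) (g := fun s => K (s - b)) (by fun_prop) (by fun_prop))
  have hbd : ∀ s, a ≤ K (s - b) → |s| ≤ B + |b| := fun s hs => by
    have h1 := hB (s - b) (by linarith)
    have h2 := abs_add_le (s - b) b
    rw [sub_add_cancel] at h2
    linarith
  have hvA : volume A = volume {s | a ≤ s ∧ a ≤ K s} :=
    measure_preimage_sub_const b {s | a ≤ s ∧ a ≤ K s}
  have hvA' : volume A' = volume {s | a ≤ s ∧ a ≤ K s} := by
    have h1 : volume A' = volume {s | s ≤ -a ∧ a ≤ K s} :=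
      measure_preimage_sub_const b {s | s ≤ -a ∧ a ≤ K s}
    rw [h1, ← Measure.measure_preimage_neg volume]
    congr 1
    ext s
    simp only [Set.mem_preimage, Set.mem_ofPred_eq, hK.symmetric, neg_le_neg_iff]
  have hfin : volume {s | a ≤ s ∧ a ≤ K s} ≠ ⊤ := by
    rw [← hvA]
    refine ne_top_of_le_ne_top ?_ (measure_mono (t := Set.Icc (-(B + |b|)) (B + |b|))
      fun s hs => abs_le.1 (hbd s hs.2))
    simp
  set p := f x * volume.real {s | a ≤ s ∧ a ≤ K s} with hp
  have hp0 : 0 < p := mul_pos hfx (ENNReal.toReal_pos hvol.ne' hfin)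
  refine ⟨A, A', p / 4, 4 * a ^ 4 * (p / 4) ^ 2, hAm, hAm', by positivity, by positivity,
    fun t I v ht hv => ?_, ?_⟩
  · have := le_gram_of_notMem_sparse hK.nonneg ha (by positivity) hv
    calc _ = 4 * a ^ 4 * (p / 4 * t) ^ 2 := by ring
      _ ≤ _ := this
  · filter_upwards [hD.tail_bound hpos hzero hAm (fun s hs => hbd s hs.2) hp0
        (by rw [hp, Measure.real, Measure.real, hvA]),
      hD.tail_bound hpos hzero hAm' (fun s hs => hbd s hs.2) hp0
        (by rw [hp, Measure.real, Measure.real, hvA'])] with n h1 h2 I hI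
    have e : -(p / 4 / 2 * (n * h n)) = -(p / 8 * (n * h n)) := by ring
    rw [e, two_mul]
    exact (measureReal_union_le _ _).trans (add_le_add (h1 I hI) (h2 I hI))

/-- A function of one design point is independent of a function of the others. -/
theorem IsDesign.indepFun_of_notMem (hD : IsDesign P f X x) {S : Finset ℕ} {i : ℕ} (hi : i ∉ S)
    {F : ℝ → ℝ} (hF : Measurable F) {G : (ℕ → ℝ) → ℝ} (hG : Measurable G)
    (hGS : ∀ v v' : ℕ → ℝ, (∀ j ∈ S, v j = v' j) → G v = G v') :
    IndepFun (fun w => F (X i w)) (fun w => G (fun j => X j w)) P := by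
  have h1 := hD.independent.indepFun_finset {i} S (by simpa using hi) hD.measurable_X
  -- Extension by zero makes `G` a function of the coordinates in `S`; `hGS` says that the padding
  -- does not matter.
  let E : (S → ℝ) → ℕ → ℝ := fun u j => if hj : j ∈ S then u ⟨j, hj⟩ else 0
  have hE : Measurable E := by
    refine measurable_pi_iff.2 fun j => ?_
    by_cases hj : j ∈ S
    · simpa [E, hj] using measurable_pi_apply _
    · simp [E, hj]
  have h2 := h1.comp (φ := fun u : ({i} : Finset ℕ) → ℝ => F (u ⟨i, by simp⟩))
    (ψ := fun u => G (E u))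
    (hF.comp (measurable_pi_apply _)) (hG.comp hE)
  have h3 : (fun u => G (E u)) ∘ (fun w (j : S) => X j w) = fun w => G (fun j => X j w) := by
    ext w
    exact hGS _ _ fun j hj => by simp [E, hj]
  rwa [h3] at h2

end

/-! ### Independence of the errors and the mean–variance decomposition. -/

section

variable {Ω : Type*} [MeasurableSpace Ω] {P : Measure Ω}

theorem iIndepFun_bool [IsProbabilityMeasure P] {Z : Bool → Ω → ℝ}
    (h : IndepFun (Z true) (Z false) P) : iIndepFun Z P := by
  rw [iIndepFun_iff_measure_inter_preimage_eq_mul]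
  intro S sets hsets
  have h1 := h.measure_inter_preimage_eq_mul (if true ∈ S then sets true else Set.univ)
    (if false ∈ S then sets false else Set.univ)
    (by split_ifs with h; exacts [hsets _ h, MeasurableSet.univ])
    (by split_ifs with h; exacts [hsets _ h, MeasurableSet.univ])
  have h2 : (⋂ i ∈ S, Z i ⁻¹' sets i) =
      Z true ⁻¹' (if true ∈ S then sets true else Set.univ) ∩
        Z false ⁻¹' (if false ∈ S then sets false else Set.univ) := by
    ext w
    simp only [Set.mem_iInter, Bool.forall_bool, Set.mem_inter_iff, Set.mem_preimage]
    by_cases ht : true ∈ S <;> by_cases hf : false ∈ S <;> simp [ht, hf, and_comm]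
  rw [h2, h1]
  have h3 : ∀ b, P (Z b ⁻¹' (if b ∈ S then sets b else Set.univ)) =
      if b ∈ S then P (Z b ⁻¹' sets b) else 1 := fun b => by split_ifs <;> simp
  rw [h3, h3, ← Fintype.prod_bool (fun b => if b ∈ S then P (Z b ⁻¹' sets b) else 1),
    Finset.prod_ite_mem, Finset.univ_inter]

variable {m f σ : ℝ → ℝ} {X ε Y : ℕ → Ω → ℝ}

namespace IsRegressionSample

/-- Independence of the pairs, together with independence inside each pair, makes the family of all
`X j` and `ε j`, indexed by `ℕ × Bool`, independent. Splitting off the single index `(i, false)`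
gives the claim. -/
theorem indepFun_error [IsProbabilityMeasure P] (hs : IsRegressionSample P m f σ X ε Y) (i : ℕ) :
    IndepFun (ε i) (fun w => ((fun j => X j w), fun k : {k // k ≠ i} => ε k w)) P := by
  let Z : ℕ → Bool → Ω → ℝ := fun j b => if b then X j else ε j
  have hZm : ∀ j b, Measurable (Z j b) := fun j b => by
    cases b
    · exact hs.measurable_eps j
    · exact hs.measurable_X j
  have h1 : iIndepFun (fun j w => (Z j · w)) P := by
    have := hs.independent.comp (fun _ (p : ℝ × ℝ) (b : Bool) => if b then p.1 else p.2)
      fun _ => measurable_pi_iff.2 fun b => by cases b <;> simp <;> fun_prop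
    convert this using 2 with j
    ext w b
    cases b <;> rfl
  have h2 := iIndepFun_uncurry' hZm h1 fun j => iIndepFun_bool (hs.indep_error j)
  have h3 := indep_iSup_of_disjoint (S := {(i, false)}) (T := {p | p ≠ (i, false)})
    (fun p => (hZm p.1 p.2).comap_le) h2.iIndep (by simp)
  rw [IndepFun_iff_Indep]
  refine indep_of_indep_of_le_left (indep_of_indep_of_le_right h3 ?_) ?_
  · refine measurable_iff_comap_le.1 ?_
    set mT : MeasurableSpace Ω :=
      ⨆ p ∈ {p : ℕ × Bool | p ≠ (i, false)}, MeasurableSpace.comap (Z p.1 p.2) inferInstance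
    refine @Measurable.prodMk _ mT _ _ _ _ _ _
      ((@measurable_pi_iff Ω ℕ (fun _ => ℝ) mT _ _).2 fun j => ?_)
      ((@measurable_pi_iff Ω {k // k ≠ i} (fun _ => ℝ) mT _ _).2 fun k => ?_)
    · exact measurable_iff_comap_le.2 (le_iSup₂_of_le (j, true) (by simp) le_rfl)
    · exact measurable_iff_comap_le.2 (le_iSup₂_of_le (k.1, false) (by simp [k.2]) le_rfl)
  · exact le_iSup₂_of_le (i, false) rfl le_rfl

theorem integral_error_sq (hs : IsRegressionSample P m f σ X ε Y) (i : ℕ) :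
    ∫ w, ε i w ^ 2 ∂P = 1 := by
  rw [← hs.error_variance i, variance_of_integral_eq_zero (hs.measurable_eps i).aemeasurable
    (hs.error_mean i)]

variable [IsProbabilityMeasure P] {G : (ℕ → ℝ) → ℝ}

theorem indepFun_design (hs : IsRegressionSample P m f σ X ε Y) (i : ℕ) (hG : Measurable G) :
    IndepFun (fun w => G fun j => X j w) (ε i) P :=
  ((hs.indepFun_error i).comp measurable_id (hG.comp measurable_fst)).symm

theorem memLp_mul_error (hs : IsRegressionSample P m f σ X ε Y) (i : ℕ) (hG : Measurable G)
    (hL : MemLp (fun w => G fun j => X j w) 2 P) :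
    MemLp (fun w => G (fun j => X j w) * ε i w) 2 P := by
  have hXm := hs.measurable_X
  have := hs.measurable_eps i
  rw [memLp_two_iff_integrable_sq (Measurable.aestronglyMeasurable (by fun_prop))]
  have h1 := ((hs.indepFun_design i hG).comp (φ := fun s : ℝ => s ^ 2) (ψ := fun s : ℝ => s ^ 2)
    (by fun_prop) (by fun_prop)).integrable_mul hL.integrable_sq (hs.error_memLp i).integrable_sq
  refine h1.congr (ae_of_all _ fun w => ?_)
  simp [mul_pow]

theorem integral_sq_mul_error (hs : IsRegressionSample P m f σ X ε Y) (i : ℕ)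
    (hG : Measurable G) :
    ∫ w, (G (fun j => X j w) * ε i w) ^ 2 ∂P = ∫ w, G (fun j => X j w) ^ 2 ∂P := by
  have hXm := hs.measurable_X
  have := hs.measurable_eps i
  have h1 := ((hs.indepFun_design i hG).comp (φ := fun s : ℝ => s ^ 2) (ψ := fun s : ℝ => s ^ 2)
    (by fun_prop) (by fun_prop)).integral_fun_mul_eq_mul_integral
    (Measurable.aestronglyMeasurable (by fun_prop)) (Measurable.aestronglyMeasurable (by fun_prop))
  simp only [Function.comp, hs.integral_error_sq, mul_one] at h1
  simp only [mul_pow, h1]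

theorem integral_mul_error (hs : IsRegressionSample P m f σ X ε Y) (i : ℕ)
    (hG : Measurable G) : ∫ w, G (fun j => X j w) * ε i w ∂P = 0 := by
  have hXm := hs.measurable_X
  have h1 := (hs.indepFun_design i hG).integral_fun_mul_eq_mul_integral
    (Measurable.aestronglyMeasurable (by fun_prop)) (hs.measurable_eps i).aestronglyMeasurable
  rw [h1, hs.error_mean i, mul_zero]

theorem integral_mul_error_mul_error (hs : IsRegressionSample P m f σ X ε Y) {i k : ℕ}
    (hik : k ≠ i) (hG : Measurable G) :
    ∫ w, G (fun j => X j w) * ε k w * ε i w ∂P = 0 := by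
  have hXm := hs.measurable_X
  have := hs.measurable_eps k
  have h0 := ((hs.indepFun_error i).comp (φ := id)
    (ψ := fun p : (ℕ → ℝ) × ({k // k ≠ i} → ℝ) => G p.1 * p.2 ⟨k, hik⟩)
    measurable_id (by fun_prop)).symm
  have h1 := h0.integral_fun_mul_eq_mul_integral
    (Measurable.aestronglyMeasurable (by simp only [Function.comp_def]; fun_prop))
    (hs.measurable_eps i).aestronglyMeasurable
  simp only [Function.comp, id] at h1
  rw [h1, hs.error_mean i, mul_zero]

/-- Mean and variance of a design statistic plus a noise term that is linear in the errors. -/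
theorem mean_variance_add_noise (hs : IsRegressionSample P m f σ X ε Y) {H : (ℕ → ℝ) → ℝ}
    {F : ℕ → (ℕ → ℝ) → ℝ} {I : Finset ℕ} (hH : Measurable H)
    (hHL : MemLp (fun w => H fun j => X j w) 2 P) (hF : ∀ i, Measurable (F i))
    (hFL : ∀ i ∈ I, MemLp (fun w => F i fun j => X j w) 2 P) :
    MemLp (fun w => H (fun j => X j w) + ∑ i ∈ I, F i (fun j => X j w) * ε i w) 2 P ∧
    ∫ w, (H (fun j => X j w) + ∑ i ∈ I, F i (fun j => X j w) * ε i w) ∂P =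
      ∫ w, H (fun j => X j w) ∂P ∧
    Var[fun w => H (fun j => X j w) + ∑ i ∈ I, F i (fun j => X j w) * ε i w; P] =
      Var[fun w => H (fun j => X j w); P] + ∑ i ∈ I, ∫ w, F i (fun j => X j w) ^ 2 ∂P := by
  have hL : ∀ i ∈ I, MemLp (fun w => F i (fun j => X j w) * ε i w) 2 P :=
    fun i hi => hs.memLp_mul_error i (hF i) (hFL i hi)
  have hV : MemLp (fun w => ∑ i ∈ I, F i (fun j => X j w) * ε i w) 2 P := memLp_finsetSum _ hL
  have hVmean : ∫ w, ∑ i ∈ I, F i (fun j => X j w) * ε i w ∂P = 0 := by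
    rw [integral_finsetSum _ fun i hi => (hL i hi).integrable one_le_two]
    exact Finset.sum_eq_zero fun i _ => hs.integral_mul_error i (hF i)
  refine ⟨hHL.add hV, ?_, ?_⟩
  · rw [integral_add (hHL.integrable one_le_two) (hV.integrable one_le_two), hVmean, add_zero]
  rw [variance_fun_add hHL hV]
  have hcov : cov[fun w => H (fun j => X j w),
      fun w => ∑ i ∈ I, F i (fun j => X j w) * ε i w; P] = 0 := by
    rw [covariance_eq_sub hHL hV, hVmean, mul_zero, sub_zero]
    simp only [Pi.mul_apply, Finset.mul_sum]
    have hi' : ∀ i ∈ I, Integrable (fun w => H (fun j => X j w) *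
        (F i (fun j => X j w) * ε i w)) P := fun i hi => hHL.integrable_mul (hL i hi)
    rw [integral_finsetSum _ hi']
    refine Finset.sum_eq_zero fun i _ => ?_
    -- The product of `H` and `F i` is again a design statistic, so it is orthogonal to `ε i`.
    rw [← hs.integral_mul_error i (hH.mul (hF i))]
    exact integral_congr_ae (ae_of_all _ fun w => by simp [mul_assoc])
  rw [hcov, mul_zero, add_zero]
  congr 1
  rw [variance_fun_sum' hL]
  refine Finset.sum_congr rfl fun i hi => ?_
  rw [Finset.sum_eq_single_of_mem i hi]
  · rw [covariance_self (hL i hi).aestronglyMeasurable.aemeasurable,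
      variance_of_integral_eq_zero (hL i hi).aestronglyMeasurable.aemeasurable
        (hs.integral_mul_error i (hF i)), hs.integral_sq_mul_error i (hF i)]
  · intro k hk hki
    rw [covariance_eq_sub (hL i hi) (hL k hk), hs.integral_mul_error i (hF i), zero_mul, sub_zero,
      ← hs.integral_mul_error_mul_error hki ((hF i).mul (hF k))]
    exact integral_congr_ae (ae_of_all _ fun w => by simp; ring)

end IsRegressionSample

end

/-! ### Taylor expansion of the fit, and convergence of products in mean. -/

section

/-- Offsets of the scaled design points from the shift `b`. -/
def offAt (b : ℝ) (v : ℕ → ℝ) (i : ℕ) : ℝ := v i - b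

/-- Kernel weights of the scaled design points at the shift `b`. -/
def kerAt (K : ℝ → ℝ) (b : ℝ) (v : ℕ → ℝ) (i : ℕ) : ℝ := K (v i - b)

theorem measurable_mom {K : ℝ → ℝ} (hK : Measurable K) (b : ℝ) (l : ℕ) (I : Finset ℕ) :
    Measurable fun v => mom (kerAt K b v) (offAt b v) l I := by
  simp only [mom, kerAt, offAt]
  fun_prop

theorem measurable_gram {K : ℝ → ℝ} (hK : Measurable K) (b : ℝ) (I : Finset ℕ) :
    Measurable fun v => gram (kerAt K b v) (offAt b v) I := by
  have := fun l => measurable_mom hK b l I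
  simp only [gram]
  fun_prop

theorem measurable_llWeight {K : ℝ → ℝ} (hK : Measurable K) (b ρ : ℝ) (I : Finset ℕ) (i : ℕ) :
    Measurable fun v => llWeight (kerAt K b v) (offAt b v) ρ I i := by
  have h1 := fun l => measurable_mom hK b l I
  have h2 := measurable_gram hK b I
  have h3 : Measurable fun v => kerAt K b v i := by simp only [kerAt]; fun_prop
  have h4 : Measurable fun v => offAt b v i := by simp only [offAt]; fun_prop
  simp only [llWeight]
  fun_prop

theorem measurable_scaledSeq {Ω : Type*} [MeasurableSpace Ω] {P : Measure Ω} {f : ℝ → ℝ}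
    {X : ℕ → Ω → ℝ} {x : ℝ} (hD : IsDesign P f X x) (h : ℝ) : Measurable (scaledSeq X x h) :=
  measurable_pi_iff.2 fun i => hD.measurable_scaled h i

/-- Remainder of the second order Taylor polynomial of `m` at `x`. -/
def taylorRem (m : ℝ → ℝ) (x y : ℝ) : ℝ :=
  m y - m x - deriv m x * (y - x) - 1 / 2 * deriv (deriv m) x * (y - x) ^ 2

/-- The derivative of the remainder is `m'(z) - m'(x) - m''(x)(z - x) = o(|z - x|)`; the mean value
inequality on a ball does the rest. A Lipschitz bound, rather than a bound on values alone, is what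
the two-point intercepts require. -/
theorem RegularAt.taylorRem_lipschitz {m f σ : ℝ → ℝ} {x : ℝ} (hr : RegularAt m f σ x)
    {η : ℝ} (hη : 0 < η) :
    ∃ r > 0, ∀ s < r, ∀ y y', |y - x| ≤ s → |y' - x| ≤ s →
      |taylorRem m x y - taylorRem m x y'| ≤ η * s * |y - y'| := by
  have h1 : HasDerivAt (deriv m) (deriv (deriv m) x) x :=
    (hr.twice_differentiable.self_of_nhds).2.hasDerivAt
  have h2 := (hasDerivAt_iff_isLittleO.1 h1).def hη
  obtain ⟨r, hr0, hrb⟩ := Metric.eventually_nhds_iff.1 (h2.and hr.twice_differentiable)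
  refine ⟨r, hr0, fun s hs y y' hy hy' => ?_⟩
  have h3 : ∀ z ∈ Metric.closedBall x s, HasDerivWithinAt (taylorRem m x)
      (deriv m z - deriv m x - deriv (deriv m) x * (z - x)) (Metric.closedBall x s) z := by
    intro z hz
    have hz' : dist z x < r := lt_of_le_of_lt hz hs
    have hd := (hrb hz').2.1.hasDerivAt
    have h4 : HasDerivAt (fun y => y - x) 1 z := (hasDerivAt_id z).sub_const x
    have h5 := ((hd.sub_const (m x)).sub (h4.const_mul (deriv m x))).sub
      ((h4.pow 2).const_mul (1 / 2 * deriv (deriv m) x))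
    refine (h5.congr_deriv ?_).hasDerivWithinAt
    simp
    ring
  have h6 := (convex_closedBall x s).norm_image_sub_le_of_norm_hasDerivWithin_le
    (C := η * s) h3 (fun z hz => ?_) (x := y') (y := y)
    (by simpa [Real.dist_eq] using hy') (by simpa [Real.dist_eq] using hy)
  · simpa [Real.norm_eq_abs] using h6
  · have hz' : dist z x < r := lt_of_le_of_lt hz hs
    have h7 := (hrb hz').1
    have h8 : ‖z - x‖ ≤ s := by simpa [dist_eq_norm] using hz
    rw [smul_eq_mul, mul_comm (z - x)] at h7
    exact h7.trans (by gcongr)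

theorem taylorRem_self (m : ℝ → ℝ) (x : ℝ) : taylorRem m x x = 0 := by simp [taylorRem]

/-- The two-point intercepts of the remainder are `o(h²)`, so `abs_sum_llWeight_le` applies
simultaneously to all designs and ridges, with no probability involved. -/
theorem RegularAt.eventually_sum_taylorRem_le {m f σ : ℝ → ℝ} {x : ℝ} (hr : RegularAt m f σ x)
    {K : ℝ → ℝ} (hK : IsKernel K) {h : ℕ → ℝ} (hpos : ∀ n, 0 < h n)
    (hzero : Tendsto h atTop (𝓝 0)) (b : ℝ) {η : ℝ} (hη : 0 < η) :
    ∀ᶠ n in atTop, ∀ (ρ : ℝ) (I : Finset ℕ) (v : ℕ → ℝ), 0 < ρ →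
      |∑ i ∈ I, llWeight (kerAt K b v) (offAt b v) ρ I i * taylorRem m x (x - h n * v i)| ≤
        η * h n ^ 2 := by
  obtain ⟨B, hB0, hB⟩ := hK.exists_bound
  set B' := B + |b| with hB'
  have hB'0 : 0 < B' := by positivity
  -- Lipschitz constant chosen so that the two terms of the intercept, with factors `B * B'` and `B'
  -- * B'`, add up to `η * h n ^ 2`.
  have hη' : 0 < η / (B' * (B + B')) := by positivity
  obtain ⟨r, hr0, hrl⟩ := hr.taylorRem_lipschitz hη'
  have h1 : Tendsto (fun n => h n * B') atTop (𝓝 0) := by simpa using hzero.mul_const B'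
  filter_upwards [h1.eventually_lt_const hr0] with n hn ρ I v hρ
  have hh := hpos n
  refine abs_sum_llWeight_le (fun i => hK.nonneg _) hρ (by positivity) fun i _ j _ hi hj => ?_
  have hv : ∀ i, kerAt K b v i ≠ 0 → |x - h n * v i - x| ≤ h n * B' := fun i hi => by
    have e1 : |v i - b| ≤ B := hB _ hi
    have e2 := abs_add_le (v i - b) b
    rw [sub_add_cancel] at e2
    have e3 : x - h n * v i - x = -(h n * v i) := by ring
    rw [e3, abs_neg, abs_mul, abs_of_pos hh]
    gcongr
    linarith
  have h2 := hrl _ hn _ _ (hv i hi) (hv j hj)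
  have h3 := hrl _ hn _ x (hv j hj) (by simp; positivity)
  rw [taylorRem_self, sub_zero] at h3
  have h4 : x - h n * v i - (x - h n * v j) = -(h n * (offAt b v i - offAt b v j)) := by
    simp only [offAt]; ring
  rw [h4, abs_neg, abs_mul, abs_of_pos hh] at h2
  have h5 : |offAt b v j| ≤ B := hB _ hj
  have h6 := hv j hj
  generalize taylorRem m x (x - h n * v i) = gi at *
  generalize taylorRem m x (x - h n * v j) = gj at *
  have h7 : offAt b v j * gi - offAt b v i * gj =
    offAt b v j * (gi - gj) + -((offAt b v i - offAt b v j) * gj) := by ring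
  rw [h7]
  refine (abs_add_le _ _).trans ?_
  rw [abs_mul, abs_neg, abs_mul]
  calc |offAt b v j| * |gi - gj| + |offAt b v i - offAt b v j| * |gj|
      ≤ B * (η / (B' * (B + B')) * (h n * B') * (h n * |offAt b v i - offAt b v j|)) +
        |offAt b v i - offAt b v j| * (η / (B' * (B + B')) * (h n * B') * (h n * B')) := by
        gcongr
        exact h3.trans (by gcongr)
    _ = η * h n ^ 2 * |offAt b v i - offAt b v j| := by field_simp

/-- The ridged local linear fit of a quadratic polynomial plus remainder. -/
theorem sum_llWeight_taylor (m : ℝ → ℝ) (x h b : ℝ) {k : ℕ → ℝ} (hk : ∀ i, 0 ≤ k i) {ρ : ℝ}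
    (hρ : 0 < ρ) (I : Finset ℕ) (v : ℕ → ℝ) :
    ∑ i ∈ I, llWeight k (offAt b v) ρ I i * m (x - h * v i) -
        (m x - deriv m x * h * b + 1 / 2 * deriv (deriv m) x * h ^ 2 * b ^ 2) =
      -(m x - deriv m x * h * b + 1 / 2 * deriv (deriv m) x * h ^ 2 * b ^ 2) *
          (ρ / (gram k (offAt b v) I + ρ)) +
        1 / 2 * deriv (deriv m) x * h ^ 2 *
          ∑ i ∈ I, llWeight k (offAt b v) ρ I i * offAt b v i ^ 2 +
        ∑ i ∈ I, llWeight k (offAt b v) ρ I i * taylorRem m x (x - h * v i) := by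
  set t := offAt b v with ht
  have hd : gram k t I + ρ ≠ 0 := by
    have := gram_nonneg (t := t) hk I
    positivity
  have e1 : ∑ i ∈ I, llWeight k t ρ I i * 1 = gram k t I / (gram k t I + ρ) := by
    rw [sum_llWeight_mul]
    simp only [mul_one, sum_weight_one]
  have e2 : ∑ i ∈ I, llWeight k t ρ I i * t i = 0 := by
    rw [sum_llWeight_mul, sum_weight_linear, zero_div]
  -- Re-expand the Taylor polynomial in powers of `t = v - b`; its constant term is the polynomial
  -- at `x - h b`.
  have e3 : ∀ i ∈ I, llWeight k t ρ I i * m (x - h * v i) =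
      (m x - deriv m x * h * b + 1 / 2 * deriv (deriv m) x * h ^ 2 * b ^ 2) *
        (llWeight k t ρ I i * 1) +
      (-(deriv m x * h) + deriv (deriv m) x * h ^ 2 * b) * (llWeight k t ρ I i * t i) +
      1 / 2 * deriv (deriv m) x * h ^ 2 * (llWeight k t ρ I i * t i ^ 2) +
      llWeight k t ρ I i * taylorRem m x (x - h * v i) := by
    intro i _
    simp only [taylorRem, ht, offAt]
    ring
  rw [Finset.sum_congr rfl e3]
  simp only [Finset.sum_add_distrib, ← Finset.mul_sum]
  rw [e1, e2]
  field_simp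
  ring

theorem tendsto_pow_mul_exp_neg {lam : ℕ → ℝ} (hlam : Tendsto lam atTop atTop) (k : ℕ) {c : ℝ}
    (hc : 0 < c) : Tendsto (fun n => lam n ^ k * Real.exp (-(c * lam n))) atTop (𝓝 0) := by
  have h1 := (Real.tendsto_pow_mul_exp_neg_atTop_nhds_zero k).comp (hlam.const_mul_atTop hc)
  have h2 := h1.const_mul ((c ^ k)⁻¹)
  rw [mul_zero] at h2
  refine h2.congr fun n => ?_
  simp only [Function.comp, mul_pow]
  field_simp

variable {Ω : Type*} [MeasurableSpace Ω] {P : Measure Ω} {f : ℝ → ℝ} {X : ℕ → Ω → ℝ} {x : ℝ}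
variable {h : ℕ → ℝ} {K : ℝ → ℝ}

theorem integral_abs_le_sqrt [IsProbabilityMeasure P] {Z : Ω → ℝ} (hZ : MemLp Z 2 P) :
    ∫ w, |Z w| ∂P ≤ √(∫ w, Z w ^ 2 ∂P) := by
  refine Real.le_sqrt_of_sq_le ?_
  have h1 := variance_eq_sub hZ.abs
  have h2 := variance_nonneg (|Z|) P
  have h3 : ∫ w, (|Z| ^ 2) w ∂P = ∫ w, Z w ^ 2 ∂P := integral_congr_ae (ae_of_all _ fun w => by simp)
  have h4 : ∫ w, |Z| w ∂P = ∫ w, |Z w| ∂P := rfl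
  rw [h3, h4] at h1
  linarith

/-- Write `ab - αβ = (a - α)(b - β) + α(b - β) + β(a - α)`. Mean convergence of products is the most
that second moments of the kernel sums provide. -/
theorem tendsto_integral_abs_mul_sub [IsProbabilityMeasure P] {a b : ℕ → Ω → ℝ} {α β : ℝ}
    (ha : ∀ᶠ n in atTop, MemLp (a n) 2 P) (hb : ∀ᶠ n in atTop, MemLp (b n) 2 P)
    (ta : Tendsto (fun n => ∫ w, (a n w - α) ^ 2 ∂P) atTop (𝓝 0))
    (tb : Tendsto (fun n => ∫ w, (b n w - β) ^ 2 ∂P) atTop (𝓝 0)) :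
    Tendsto (fun n => ∫ w, |a n w * b n w - α * β| ∂P) atTop (𝓝 0) := by
  have hlim : Tendsto (fun n => ∫ w, (a n w - α) ^ 2 ∂P + ∫ w, (b n w - β) ^ 2 ∂P +
      |α| * √(∫ w, (b n w - β) ^ 2 ∂P) + |β| * √(∫ w, (a n w - α) ^ 2 ∂P)) atTop (𝓝 0) := by
    have := ((ta.add tb).add (tb.sqrt.const_mul |α|)).add (ta.sqrt.const_mul |β|)
    simpa using this
  refine squeeze_zero' (Eventually.of_forall fun n => integral_nonneg fun w => abs_nonneg _)
    ?_ hlim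
  filter_upwards [ha, hb] with n ha hb
  have ha' : MemLp (fun w => a n w - α) 2 P := ha.sub (memLp_const α)
  have hb' : MemLp (fun w => b n w - β) 2 P := hb.sub (memLp_const β)
  have i1 := ha'.integrable_sq
  have i2 := hb'.integrable_sq
  have i3 := (hb'.integrable one_le_two).abs.const_mul |α|
  have i4 := (ha'.integrable one_le_two).abs.const_mul |β|
  calc ∫ w, |a n w * b n w - α * β| ∂P
      ≤ ∫ w, ((a n w - α) ^ 2 + (b n w - β) ^ 2 + |α| * |b n w - β| + |β| * |a n w - α|) ∂P := by
        refine integral_mono_of_nonneg (ae_of_all _ fun w => abs_nonneg _)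
          (((i1.add i2).add i3).add i4) (ae_of_all _ fun w => ?_)
        have e : a n w * b n w - α * β =
          (a n w - α) * (b n w - β) + α * (b n w - β) + β * (a n w - α) := by ring
        have := abs_add_three ((a n w - α) * (b n w - β)) (α * (b n w - β)) (β * (a n w - α))
        rw [← e, abs_mul, abs_mul, abs_mul] at this
        simp only
        nlinarith [sq_nonneg (|a n w - α| - |b n w - β|), sq_abs (a n w - α), sq_abs (b n w - β),
          sq_nonneg (a n w - α), sq_nonneg (b n w - β)]
    _ = ∫ w, (a n w - α) ^ 2 ∂P + ∫ w, (b n w - β) ^ 2 ∂P + |α| * ∫ w, |b n w - β| ∂P +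
        |β| * ∫ w, |a n w - α| ∂P := by
        have i12 : Integrable (fun w => (a n w - α) ^ 2 + (b n w - β) ^ 2) P := i1.add i2
        have i123 : Integrable (fun w => (a n w - α) ^ 2 + (b n w - β) ^ 2 +
          |α| * |b n w - β|) P := i12.add i3
        rw [integral_add i123 i4, integral_add i12 i3, integral_add i1 i2, integral_const_mul,
          integral_const_mul]
    _ ≤ _ := by
        have := integral_abs_le_sqrt hb'
        have := integral_abs_le_sqrt ha'
        gcongr

end

/-! ### Limits of the Gram determinant, of the ridge fraction and of the fit of `t²`. -/

section

/-- Kernel moment sums of the design points, seen from `x` in the scale `h` at the shift `b`. -/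
def momX {Ω : Type*} (K : ℝ → ℝ) (X : ℕ → Ω → ℝ) (x h b : ℝ) (l : ℕ) (I : Finset ℕ) (w : Ω) : ℝ :=
  mom (kerAt K b (scaledSeq X x h w)) (offAt b (scaledSeq X x h w)) l I

/-- Gram determinant of the design points. -/
def gramX {Ω : Type*} (K : ℝ → ℝ) (X : ℕ → Ω → ℝ) (x h b : ℝ) (I : Finset ℕ) (w : Ω) : ℝ :=
  gram (kerAt K b (scaledSeq X x h w)) (offAt b (scaledSeq X x h w)) I

theorem gramX_nonneg {Ω : Type*} {K : ℝ → ℝ} {X : ℕ → Ω → ℝ} {x : ℝ} (hK : IsKernel K)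
    (h b : ℝ) (I : Finset ℕ) (w : Ω) : 0 ≤ gramX K X x h b I w :=
  gram_nonneg (fun _ => hK.nonneg _) I

variable {Ω : Type*} [MeasurableSpace Ω] {P : Measure Ω} {f : ℝ → ℝ} {X : ℕ → Ω → ℝ} {x : ℝ}
variable {h : ℕ → ℝ} {K : ℝ → ℝ}

namespace IsDesign

theorem measurable_gramX (hD : IsDesign P f X x) (hK : IsKernel K) (h b : ℝ)
    (I : Finset ℕ) : Measurable (gramX K X x h b I) :=
  (measurable_gram hK.measurable b I).comp (measurable_scaledSeq hD h)

theorem eventually_memLp_momX (hD : IsDesign P f X x) (hK : IsKernel K) (hpos : ∀ n, 0 < h n)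
    (hzero : Tendsto h atTop (𝓝 0)) (b : ℝ) (l : ℕ) :
    ∀ᶠ n in atTop, ∀ I, MemLp (momX K X x (h n) b l I) 2 P := by
  obtain ⟨B, -, hB⟩ := hK.exists_bound
  filter_upwards [hD.eventually_memLp hpos hzero (hK.isSqCell hB l b)] with n hn I
  exact memLp_finsetSum I fun i _ => hn i

variable [IsProbabilityMeasure P]

theorem law_of_large_numbers_momX (hD : IsDesign P f X x) (hK : IsKernel K)
    (hpos : ∀ n, 0 < h n) (hzero : Tendsto h atTop (𝓝 0))
    (hnh : Tendsto (fun n : ℕ => (n : ℝ) * h n) atTop atTop) (b : ℝ) (l : ℕ) {η : ℝ}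
    (hη : 0 < η) :
    ∀ᶠ n : ℕ in atTop, ∀ I : Finset ℕ, I.card ≤ n → n ≤ I.card + 1 →
      ∫ w, ((n * h n)⁻¹ * momX K X x (h n) b l I w - f x * ∫ s, s ^ l * K s) ^ 2 ∂P ≤ η := by
  obtain ⟨B, -, hB⟩ := hK.exists_bound
  have := hD.law_of_large_numbers hpos hzero hnh (hK.isSqCell hB l b) hη
  rwa [IsKernel.integral_shift] at this

theorem tendsto_momX (hD : IsDesign P f X x) (hK : IsKernel K)
    (hpos : ∀ n, 0 < h n) (hzero : Tendsto h atTop (𝓝 0))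
    (hnh : Tendsto (fun n : ℕ => (n : ℝ) * h n) atTop atTop) (b : ℝ) (l : ℕ) :
    Tendsto (fun n : ℕ => ∫ w, ((n * h n)⁻¹ * momX K X x (h n) b l (Finset.range n) w -
      f x * ∫ s, s ^ l * K s) ^ 2 ∂P) atTop (𝓝 0) := by
  rw [Metric.tendsto_nhds]
  intro η hη
  filter_upwards [hD.law_of_large_numbers_momX hK hpos hzero hnh b l (half_pos hη)] with n hn
  have h1 := hn (Finset.range n) (by simp) (by simp)
  rw [Real.dist_eq, sub_zero, abs_of_nonneg (integral_nonneg fun _ => sq_nonneg _)]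
  linarith

theorem tendsto_momX_mul (hD : IsDesign P f X x) (hK : IsKernel K)
    (hpos : ∀ n, 0 < h n) (hzero : Tendsto h atTop (𝓝 0))
    (hnh : Tendsto (fun n : ℕ => (n : ℝ) * h n) atTop atTop) (b : ℝ) (l l' : ℕ) :
    Tendsto (fun n : ℕ => ∫ w, |(n * h n)⁻¹ * momX K X x (h n) b l (Finset.range n) w *
      ((n * h n)⁻¹ * momX K X x (h n) b l' (Finset.range n) w) -
      f x * (∫ s, s ^ l * K s) * (f x * ∫ s, s ^ l' * K s)| ∂P) atTop (𝓝 0) := by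
  refine tendsto_integral_abs_mul_sub ?_ ?_ (hD.tendsto_momX hK hpos hzero hnh b l)
    (hD.tendsto_momX hK hpos hzero hnh b l')
  · filter_upwards [hD.eventually_memLp_momX hK hpos hzero b l] with n hn
    exact (hn _).const_mul _
  · filter_upwards [hD.eventually_memLp_momX hK hpos hzero b l'] with n hn
    exact (hn _).const_mul _

/-- Convergence in mean of normalised quadratic forms in the kernel moment sums. -/
theorem tendsto_momX_quadratic (hD : IsDesign P f X x) (hK : IsKernel K)
    (hpos : ∀ n, 0 < h n) (hzero : Tendsto h atTop (𝓝 0))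
    (hnh : Tendsto (fun n : ℕ => (n : ℝ) * h n) atTop atTop) (b : ℝ) (p q r s : ℕ) :
    (∀ᶠ n : ℕ in atTop, Integrable (fun w =>
      momX K X x (h n) b p (Finset.range n) w * momX K X x (h n) b q (Finset.range n) w -
      momX K X x (h n) b r (Finset.range n) w * momX K X x (h n) b s (Finset.range n) w) P) ∧
    Tendsto (fun n : ℕ => ∫ w, |(((n : ℝ) * h n) ^ 2)⁻¹ *
      (momX K X x (h n) b p (Finset.range n) w * momX K X x (h n) b q (Finset.range n) w -
        momX K X x (h n) b r (Finset.range n) w * momX K X x (h n) b s (Finset.range n) w) -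
      f x ^ 2 * ((∫ u, u ^ p * K u) * (∫ u, u ^ q * K u) -
        (∫ u, u ^ r * K u) * ∫ u, u ^ s * K u)| ∂P) atTop (𝓝 0) := by
  have hi : ∀ l l', ∀ᶠ n : ℕ in atTop, Integrable (fun w =>
      momX K X x (h n) b l (Finset.range n) w * momX K X x (h n) b l' (Finset.range n) w) P := by
    intro l l'
    filter_upwards [hD.eventually_memLp_momX hK hpos hzero b l,
      hD.eventually_memLp_momX hK hpos hzero b l'] with n h1 h2
    exact (h1 _).integrable_mul (h2 _)
  refine ⟨?_, ?_⟩
  · filter_upwards [hi p q, hi r s] with n h1 h2 using h1.sub h2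
  have h0 := (hD.tendsto_momX_mul hK hpos hzero hnh b p q).add
    (hD.tendsto_momX_mul hK hpos hzero hnh b r s)
  rw [add_zero] at h0
  refine squeeze_zero' (Eventually.of_forall fun n => integral_nonneg fun w => abs_nonneg _)
    ?_ h0
  filter_upwards [hi p q, hi r s] with n h1 h2
  have e : ∀ l l' w, (n * h n)⁻¹ * momX K X x (h n) b l (Finset.range n) w *
      ((n * h n)⁻¹ * momX K X x (h n) b l' (Finset.range n) w) -
      f x * (∫ s, s ^ l * K s) * (f x * ∫ s, s ^ l' * K s) = (((n : ℝ) * h n) ^ 2)⁻¹ *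
      (momX K X x (h n) b l (Finset.range n) w * momX K X x (h n) b l' (Finset.range n) w) -
      f x ^ 2 * ((∫ u, u ^ l * K u) * ∫ u, u ^ l' * K u) := fun l l' w => by
    rw [sq, mul_inv]; ring
  simp only [e]
  have i1 := ((h1.const_mul (((n : ℝ) * h n) ^ 2)⁻¹).sub (integrable_const
    (f x ^ 2 * ((∫ u, u ^ p * K u) * ∫ u, u ^ q * K u)))).abs
  have i2 := ((h2.const_mul (((n : ℝ) * h n) ^ 2)⁻¹).sub (integrable_const
    (f x ^ 2 * ((∫ u, u ^ r * K u) * ∫ u, u ^ s * K u)))).abs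
  simp only [Pi.sub_apply] at i1 i2
  rw [← integral_add i1 i2]
  refine integral_mono_of_nonneg (ae_of_all _ fun w => abs_nonneg _) (i1.add i2)
    (ae_of_all _ fun w => ?_)
  simp only
  refine le_trans (le_of_eq ?_) (abs_sub _ _)
  congr 1
  ring

/-- The limit has no subtracted term because the first moment of a symmetric kernel vanishes; the
same happens in `tendsto_quadX`. -/
theorem tendsto_gramX (hD : IsDesign P f X x) (hK : IsKernel K)
    (hpos : ∀ n, 0 < h n) (hzero : Tendsto h atTop (𝓝 0))
    (hnh : Tendsto (fun n : ℕ => (n : ℝ) * h n) atTop atTop) (b : ℝ) :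
    (∀ᶠ n : ℕ in atTop, Integrable (gramX K X x (h n) b (Finset.range n)) P) ∧
    Tendsto (fun n : ℕ => ∫ w, |(((n : ℝ) * h n) ^ 2)⁻¹ *
      gramX K X x (h n) b (Finset.range n) w - f x ^ 2 * nu20 K| ∂P) atTop (𝓝 0) := by
  have h1 := hD.tendsto_momX_quadratic hK hpos hzero hnh b 0 2 1 1
  simp only [hK.integral_odd odd_one, pow_zero, one_mul, hK.integral_eq_one, mul_zero,
    sub_zero] at h1
  exact h1

theorem tendsto_quadX (hD : IsDesign P f X x) (hK : IsKernel K)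
    (hpos : ∀ n, 0 < h n) (hzero : Tendsto h atTop (𝓝 0))
    (hnh : Tendsto (fun n : ℕ => (n : ℝ) * h n) atTop atTop) (b : ℝ) :
    (∀ᶠ n : ℕ in atTop, Integrable (fun w =>
      momX K X x (h n) b 2 (Finset.range n) w * momX K X x (h n) b 2 (Finset.range n) w -
      momX K X x (h n) b 1 (Finset.range n) w * momX K X x (h n) b 3 (Finset.range n) w) P) ∧
    Tendsto (fun n : ℕ => ∫ w, |(((n : ℝ) * h n) ^ 2)⁻¹ *
      (momX K X x (h n) b 2 (Finset.range n) w * momX K X x (h n) b 2 (Finset.range n) w -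
        momX K X x (h n) b 1 (Finset.range n) w * momX K X x (h n) b 3 (Finset.range n) w) -
      f x ^ 2 * (nu20 K * nu20 K)| ∂P) atTop (𝓝 0) := by
  have h1 := hD.tendsto_momX_quadratic hK hpos hzero hnh b 2 2 1 3
  simp only [hK.integral_odd odd_one, zero_mul, sub_zero] at h1
  exact h1

/-- An event of negligible probability off which the Gram determinant has the right order. -/
theorem exists_bad (hD : IsDesign P f X x) (hfx : 0 < f x) (hK : IsKernel K)
    (hpos : ∀ n, 0 < h n) (hzero : Tendsto h atTop (𝓝 0))
    (hnh : Tendsto (fun n : ℕ => (n : ℝ) * h n) atTop atTop) (b : ℝ) :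
    ∃ (c : ℝ) (bad : ℕ → Set Ω), 0 < c ∧ (∀ n, MeasurableSet (bad n)) ∧
      (∀ n, ∀ w ∉ bad n, c * (n * h n) ^ 2 ≤ gramX K X x (h n) b (Finset.range n) w) ∧
      ∀ k, Tendsto (fun n : ℕ => (n * h n) ^ k * P.real (bad n)) atTop (𝓝 0) := by
  obtain ⟨A, A', c, c', hA, hA', hc, hc', hgram, hprob⟩ :=
    hD.exists_sparse hfx hpos hzero hK b
  refine ⟨c', fun n => scaledSeq X x (h n) ⁻¹' sparse A A' (c * (n * h n)) (Finset.range n), hc',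
    fun n => measurable_scaledSeq hD _ (measurableSet_sparse hA hA' _ _), fun n w hw =>
    hgram _ _ _ (mul_nonneg n.cast_nonneg (hpos n).le) hw, fun k => ?_⟩
  have h1 := (tendsto_pow_mul_exp_neg hnh k (half_pos hc)).const_mul 2
  rw [mul_zero] at h1
  refine squeeze_zero' (Eventually.of_forall fun n => ?_) ?_ h1
  · have := (hpos n).le
    positivity
  · filter_upwards [hprob] with n hn
    have := (hpos n).le
    calc _ ≤ (n * h n) ^ k * (2 * Real.exp (-(c / 2 * (n * h n)))) := by
          gcongr
          exact hn _ (by simp)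
      _ = _ := by ring

/-- The fraction is at most 1 on the exceptional event, whose probability beats any power of `nh`,
and at most `c⁻¹ (nh)⁻⁴` off it. -/
theorem tendsto_ridge (hD : IsDesign P f X x) (hfx : 0 < f x) (hK : IsKernel K)
    (hpos : ∀ n, 0 < h n) (hzero : Tendsto h atTop (𝓝 0))
    (hnh : Tendsto (fun n : ℕ => (n : ℝ) * h n) atTop atTop) (b : ℝ) :
    Tendsto (fun n : ℕ => n * h n * ∫ w, ((((n : ℝ) * h n) ^ 2)⁻¹ /
      (gramX K X x (h n) b (Finset.range n) w + (((n : ℝ) * h n) ^ 2)⁻¹)) ^ 2 ∂P)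
      atTop (𝓝 0) := by
  obtain ⟨c, bad, hc, hbm, hgram, hprob⟩ := hD.exists_bad hfx hK hpos hzero hnh b
  have h1 : Tendsto (fun n : ℕ => (n * h n) ^ 1 * P.real (bad n) +
      (c ^ 2)⁻¹ * (((n : ℝ) * h n)⁻¹) ^ 7) atTop (𝓝 0) := by
    have := (hprob 1).add ((hnh.inv_tendsto_atTop.pow 7).const_mul (c ^ 2)⁻¹)
    simpa using this
  refine squeeze_zero' (Eventually.of_forall fun n => ?_) ?_ h1
  · have := (hpos n).le
    exact mul_nonneg (by positivity) (integral_nonneg fun _ => sq_nonneg _)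
  filter_upwards [hnh.eventually_gt_atTop 0] with n hn
  set lam := (n : ℝ) * h n
  have i1 : Integrable ((bad n).indicator (fun _ => (1 : ℝ))) P :=
    (integrable_const 1).indicator (hbm n)
  have h2 : ∫ w, ((lam ^ 2)⁻¹ / (gramX K X x (h n) b (Finset.range n) w + (lam ^ 2)⁻¹)) ^ 2 ∂P
      ≤ ∫ w, ((bad n).indicator (fun _ => (1 : ℝ)) w + (c ^ 2)⁻¹ * (lam⁻¹) ^ 8) ∂P := by
    refine integral_mono_of_nonneg (ae_of_all _ fun w => sq_nonneg _)
      (i1.add (integrable_const _)) (ae_of_all _ fun w => ?_)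
    have hg := gramX_nonneg hK (X := X) (x := x) (h n) b (Finset.range n) w
    by_cases hw : w ∈ bad n
    · simp only [Set.indicator_of_mem hw]
      have : (lam ^ 2)⁻¹ / (gramX K X x (h n) b (Finset.range n) w + (lam ^ 2)⁻¹) ≤ 1 := by
        rw [div_le_one (by positivity)]
        linarith
      have h3 := pow_le_one₀ (n := 2) (by positivity) this
      have : 0 ≤ (c ^ 2)⁻¹ * lam⁻¹ ^ 8 := by positivity
      linarith
    · simp only [Set.indicator_of_notMem hw, zero_add]
      have h3 := hgram n w hw
      calc ((lam ^ 2)⁻¹ / (gramX K X x (h n) b (Finset.range n) w + (lam ^ 2)⁻¹)) ^ 2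
          ≤ ((lam ^ 2)⁻¹ / (c * lam ^ 2)) ^ 2 := by
            have : 0 < (lam ^ 2)⁻¹ := by positivity
            gcongr
            linarith
        _ = _ := by field_simp
  rw [integral_add i1 (integrable_const _), integral_indicator_const _ (hbm n)] at h2
  simp only [smul_eq_mul, mul_one, integral_const, probReal_univ, one_mul] at h2
  calc _ ≤ lam * (P.real (bad n) + (c ^ 2)⁻¹ * lam⁻¹ ^ 8) := by gcongr
    _ = _ := by field_simp

/-- The two-point intercept of `t²` is `-(t i * t j)`, and kernel weights vanish beyond `B`. -/
theorem abs_sum_llWeight_sq_le (hK : IsKernel K) {B : ℝ} (hB0 : 0 < B)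
    (hB : ∀ s, K s ≠ 0 → |s| ≤ B) (b : ℝ) {ρ : ℝ} (hρ : 0 < ρ) (I : Finset ℕ) (v : ℕ → ℝ) :
    |∑ i ∈ I, llWeight (kerAt K b v) (offAt b v) ρ I i * offAt b v i ^ 2| ≤ B ^ 2 := by
  refine abs_sum_llWeight_le (fun _ => hK.nonneg _) hρ (by positivity) fun i _ j _ hi hj => ?_
  have h1 : |offAt b v i| ≤ B := hB _ hi
  have h2 : |offAt b v j| ≤ B := hB _ hj
  have e : offAt b v j * offAt b v i ^ 2 - offAt b v i * offAt b v j ^ 2 =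
    offAt b v i * offAt b v j * (offAt b v i - offAt b v j) := by ring
  rw [e, abs_mul, abs_mul, sq B]
  gcongr

/-- After division by `(nh)²` the numerator tends to `f² ν²` and the Gram determinant to `f² ν`, so
the ratio tends to `ν`. -/
theorem tendsto_quad (hD : IsDesign P f X x) (hfx : 0 < f x) (hK : IsKernel K)
    (hpos : ∀ n, 0 < h n) (hzero : Tendsto h atTop (𝓝 0))
    (hnh : Tendsto (fun n : ℕ => (n : ℝ) * h n) atTop atTop) (b : ℝ) :
    Tendsto (fun n : ℕ => ∫ w, (∑ i ∈ Finset.range n,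
      llWeight (kerAt K b (scaledSeq X x (h n) w)) (offAt b (scaledSeq X x (h n) w))
        (((n : ℝ) * h n) ^ 2)⁻¹ (Finset.range n) i * offAt b (scaledSeq X x (h n) w) i ^ 2 -
      nu20 K) ^ 2 ∂P) atTop (𝓝 0) := by
  obtain ⟨c, bad, hc, hbm, hgram, hprob⟩ := hD.exists_bad hfx hK hpos hzero hnh b
  obtain ⟨B, hB0, hB⟩ := hK.exists_bound
  obtain ⟨ig, tg⟩ := hD.tendsto_gramX hK hpos hzero hnh b
  obtain ⟨iq, tq⟩ := hD.tendsto_quadX hK hpos hzero hnh b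
  set ν := nu20 K with hν
  set C := B ^ 2 + |ν| with hC
  have hC0 : 0 < C := by positivity
  have h1 := ((hprob 0).const_mul (C ^ 2)).add (((tq.add (tg.const_mul |ν|)).add
    ((hnh.inv_tendsto_atTop.pow 4).const_mul |ν|)).const_mul (C / c))
  simp only [mul_zero, add_zero, ne_eq, OfNat.ofNat_ne_zero, not_false_eq_true, zero_pow] at h1
  refine squeeze_zero' (Eventually.of_forall fun n => integral_nonneg fun _ => sq_nonneg _) ?_ h1
  filter_upwards [hnh.eventually_gt_atTop 0, ig, iq] with n hn ig iq
  set lam := (n : ℝ) * h n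
  set G := gramX K X x (h n) b (Finset.range n) with hG
  set Q : Ω → ℝ := fun w =>
      momX K X x (h n) b 2 (Finset.range n) w * momX K X x (h n) b 2 (Finset.range n) w -
      momX K X x (h n) b 1 (Finset.range n) w * momX K X x (h n) b 3 (Finset.range n) w with hQ
  have i1 : Integrable ((bad n).indicator (fun _ => C ^ 2)) P :=
    (integrable_const (C ^ 2)).indicator (hbm n)
  have i2 : Integrable (fun w => |(lam ^ 2)⁻¹ * Q w - f x ^ 2 * (ν * ν)|) P :=
    ((iq.const_mul _).sub (integrable_const _)).abs
  have i3 : Integrable (fun w => |ν| * |(lam ^ 2)⁻¹ * G w - f x ^ 2 * ν|) P :=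
    ((ig.const_mul _).sub (integrable_const _)).abs.const_mul _
  have i23 : Integrable (fun w => |(lam ^ 2)⁻¹ * Q w - f x ^ 2 * (ν * ν)| +
    |ν| * |(lam ^ 2)⁻¹ * G w - f x ^ 2 * ν|) P := i2.add i3
  have i4 : Integrable (fun w => C / c * (|(lam ^ 2)⁻¹ * Q w - f x ^ 2 * (ν * ν)| +
    |ν| * |(lam ^ 2)⁻¹ * G w - f x ^ 2 * ν| + |ν| * (lam⁻¹) ^ 4)) P :=
    (i23.add (integrable_const _)).const_mul _
  calc _ ≤ ∫ w, ((bad n).indicator (fun _ => C ^ 2) w +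
        C / c * (|(lam ^ 2)⁻¹ * Q w - f x ^ 2 * (ν * ν)| +
          |ν| * |(lam ^ 2)⁻¹ * G w - f x ^ 2 * ν| + |ν| * (lam⁻¹) ^ 4)) ∂P := by
        refine integral_mono_of_nonneg (ae_of_all _ fun w => sq_nonneg _) (i1.add i4)
          (ae_of_all _ fun w => ?_)
        have hg : 0 ≤ G w := gramX_nonneg hK (h n) b (Finset.range n) w
        simp only
        have hb1 := abs_sum_llWeight_sq_le hK hB0 hB b (ρ := (lam ^ 2)⁻¹) (by positivity)
          (Finset.range n) (scaledSeq X x (h n) w)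
        have hq : ∑ i ∈ Finset.range n, llWeight (kerAt K b (scaledSeq X x (h n) w))
            (offAt b (scaledSeq X x (h n) w)) (lam ^ 2)⁻¹ (Finset.range n) i *
            offAt b (scaledSeq X x (h n) w) i ^ 2 = Q w / (G w + (lam ^ 2)⁻¹) := by
          rw [sum_llWeight_mul, sum_weight_sq]; rfl
        rw [hq] at hb1 ⊢
        have hb2 : |Q w / (G w + (lam ^ 2)⁻¹) - ν| ≤ C :=
          (abs_sub _ _).trans (add_le_add hb1 le_rfl)
        by_cases hw : w ∈ bad n
        · rw [Set.indicator_of_mem hw, ← sq_abs]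
          have h2 := pow_le_pow_left₀ (abs_nonneg _) hb2 2
          have : 0 ≤ C / c * (|(lam ^ 2)⁻¹ * Q w - f x ^ 2 * (ν * ν)| +
            |ν| * |(lam ^ 2)⁻¹ * G w - f x ^ 2 * ν| + |ν| * (lam⁻¹) ^ 4) := by positivity
          linarith
        -- One factor of the square is bounded by the constant `C`; only the other is expanded, so
        -- convergence in mean of the quadratic forms is enough.
        · rw [Set.indicator_of_notMem hw, zero_add, ← sq_abs, sq, div_mul_eq_mul_div, mul_div_assoc]
          refine mul_le_mul hb2 ?_ (abs_nonneg _) hC0.le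
          have h3 := hgram n w hw
          have hpos' : 0 < G w + (lam ^ 2)⁻¹ := by positivity
          have e : Q w / (G w + (lam ^ 2)⁻¹) - ν = ((lam ^ 2)⁻¹ * Q w - f x ^ 2 * (ν * ν) +
              -(ν * ((lam ^ 2)⁻¹ * G w - f x ^ 2 * ν)) + -(ν * (lam⁻¹) ^ 4)) /
              ((lam ^ 2)⁻¹ * (G w + (lam ^ 2)⁻¹)) := by
            field_simp
            ring
          rw [e, abs_div, abs_of_pos (by positivity : 0 < (lam ^ 2)⁻¹ * (G w + (lam ^ 2)⁻¹))]
          refine div_le_div₀ (by positivity) ?_ hc ?_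
          · refine (abs_add_three _ _ _).trans_eq ?_
            rw [abs_neg, abs_neg, abs_mul, abs_mul, abs_of_pos (by positivity : 0 < lam⁻¹ ^ 4)]
          · rw [inv_mul_eq_div, le_div_iff₀ (by positivity)]
            have : 0 < (lam ^ 2)⁻¹ := by positivity
            linarith
    _ = _ := by
        have i5 : Integrable (fun w => |(lam ^ 2)⁻¹ * Q w - f x ^ 2 * (ν * ν)| +
          |ν| * |(lam ^ 2)⁻¹ * G w - f x ^ 2 * ν| + |ν| * (lam⁻¹) ^ 4) P :=
          i23.add (integrable_const _)
        rw [integral_add i1 i4, integral_indicator_const _ (hbm n), integral_const_mul,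
          integral_add i23 (integrable_const _), integral_add i2 i3, integral_const_mul,
          integral_const]
        simp only [smul_eq_mul, probReal_univ, one_mul, pow_zero, Pi.inv_apply]
        ring

end IsDesign

end

/-! ### Quadratic interpolation and the design part of the estimator. -/

section

/-- Shifts of the three evaluation points of the interpolated estimator, in the scale `h`. -/
def node (r δ : ℝ) (j : Fin 3) : ℝ := (r + 1 - (j : ℕ)) * δ

/-- For `δ ≠ 0` the coefficients are the Lagrange weights at 0 for the nodes `(r + 1)δ`, `rδ`, `(r -
1)δ`. This and the next two identities say that interpolation is exact on `1`, `b` and `b²`. -/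
theorem sum_interpCoeff (r : ℝ) : ∑ j, interpCoeff r j = 1 := by
  simp [Fin.sum_univ_three, interpCoeff]; ring

theorem sum_interpCoeff_mul_node (r δ : ℝ) : ∑ j, interpCoeff r j * node r δ j = 0 := by
  simp [Fin.sum_univ_three, interpCoeff, node]; ring

theorem sum_interpCoeff_mul_node_sq (r δ : ℝ) : ∑ j, interpCoeff r j * node r δ j ^ 2 = 0 := by
  simp [Fin.sum_univ_three, interpCoeff, node]; ring

/-- The weight of the `i`-th response in the interpolated estimator. -/
def tildeWeight (K : ℝ → ℝ) (δ r ρ : ℝ) (I : Finset ℕ) (v : ℕ → ℝ) (i : ℕ) : ℝ :=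
  ∑ j, interpCoeff r j * llWeight (kerAt K (node r δ j) v) (offAt (node r δ j) v) ρ I i

theorem measurable_tildeWeight {K : ℝ → ℝ} (hK : Measurable K) (δ r ρ : ℝ) (I : Finset ℕ)
    (i : ℕ) : Measurable fun v => tildeWeight K δ r ρ I v i := by
  have := fun b => measurable_llWeight hK b ρ I i
  simp only [tildeWeight]
  fun_prop

theorem mTilde_eq {Ω : Type*} (K : ℝ → ℝ) (δ r : ℝ) {h : ℝ} (hh : 0 < h) (n : ℕ)
    (X Y : ℕ → Ω → ℝ) (x : ℝ) (w : Ω) :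
    mTilde K δ r h n (fun i => X i w) (fun i => Y i w) x =
      ∑ i ∈ Finset.range n, tildeWeight K δ r ((n * h) ^ 2)⁻¹ (Finset.range n)
        (scaledSeq X x h w) i * Y i w := by
  have e : ∀ j : Fin 3, x - (r + 1 - (j : ℕ)) * (δ * h) = x - node r δ j * h := fun j => by
    rw [node]; ring
  simp only [mTilde, e, mHat_eq K hh, tildeWeight, Finset.mul_sum, Finset.sum_mul]
  rw [Finset.sum_comm]
  exact Finset.sum_congr rfl fun i _ => Finset.sum_congr rfl fun j _ => by rw [← mul_assoc]; rfl

variable {Ω : Type*} [MeasurableSpace Ω] {P : Measure Ω} [IsProbabilityMeasure P]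
variable {m f σ : ℝ → ℝ} {X : ℕ → Ω → ℝ} {x : ℝ} {h : ℕ → ℝ} {K : ℝ → ℝ}

namespace IsDesign

/-- By `sum_llWeight_taylor` the error is a ridge term, a deviation of the fit of `t²`, and a Taylor
remainder. Their mean squares are `o(1/(nh))`, `o(h⁴)` and `o(h⁴)`. -/
theorem bias_at_shift (hD : IsDesign P f X x) (hr : RegularAt m f σ x) (hm : Measurable m)
    (hK : IsKernel K) (hpos : ∀ n, 0 < h n) (hzero : Tendsto h atTop (𝓝 0))
    (hnh : Tendsto (fun n : ℕ => (n : ℝ) * h n) atTop atTop) (b : ℝ) {Z : ℕ → Ω → ℝ}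
    (hZ : ∀ n w, Z n w = ∑ i ∈ Finset.range n, llWeight (kerAt K b (scaledSeq X x (h n) w))
        (offAt b (scaledSeq X x (h n) w)) (((n : ℝ) * h n) ^ 2)⁻¹ (Finset.range n) i *
          m (X i w) -
        (m x - deriv m x * h n * b + 1 / 2 * deriv (deriv m) x * h n ^ 2 * b ^ 2) -
        1 / 2 * deriv (deriv m) x * nu20 K * h n ^ 2) :
    (∀ᶠ n in atTop, MemLp (Z n) 2 P) ∧
      (fun n => ∫ w, Z n w ^ 2 ∂P) =o[atTop] fun n : ℕ => h n ^ 4 + ((n : ℝ) * h n)⁻¹ := by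
  obtain ⟨B, hB0, hB⟩ := hK.exists_bound
  set m2 := 1 / 2 * deriv (deriv m) x with hm2
  set q0 : ℕ → ℝ := fun n => m x - deriv m x * h n * b + m2 * h n ^ 2 * b ^ 2 with hq0
  set ridge : ℕ → Ω → ℝ := fun n w => (((n : ℝ) * h n) ^ 2)⁻¹ /
      (gramX K X x (h n) b (Finset.range n) w + (((n : ℝ) * h n) ^ 2)⁻¹) with hridge
  set quad : ℕ → Ω → ℝ := fun n w => ∑ i ∈ Finset.range n,
      llWeight (kerAt K b (scaledSeq X x (h n) w)) (offAt b (scaledSeq X x (h n) w))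
        (((n : ℝ) * h n) ^ 2)⁻¹ (Finset.range n) i * offAt b (scaledSeq X x (h n) w) i ^ 2
    with hquad
  set rem : ℕ → Ω → ℝ := fun n w => ∑ i ∈ Finset.range n,
      llWeight (kerAt K b (scaledSeq X x (h n) w)) (offAt b (scaledSeq X x (h n) w))
        (((n : ℝ) * h n) ^ 2)⁻¹ (Finset.range n) i *
          taylorRem m x (x - h n * scaledSeq X x (h n) w i) with hrem
  have hlam := hnh.eventually_gt_atTop 0
  have hZ' : ∀ᶠ n in atTop, ∀ w, Z n w = -q0 n * ridge n w +
      m2 * h n ^ 2 * (quad n w - nu20 K) + rem n w := by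
    filter_upwards [hlam] with n hn w
    have e := sum_llWeight_taylor m x (h n) b (k := kerAt K b (scaledSeq X x (h n) w))
      (fun i => hK.nonneg _) (ρ := (((n : ℝ) * h n) ^ 2)⁻¹) (by positivity) (Finset.range n)
      (scaledSeq X x (h n) w)
    have e2 : ∀ i, x - h n * scaledSeq X x (h n) w i = X i w :=
      fun i => sub_mul_scaled (hpos n) i w
    simp only [e2] at e
    rw [hZ, e]
    simp only [hrem, e2, hridge, hquad, gramX, hq0]
    ring
  have hwm : ∀ n i, Measurable fun w => llWeight (kerAt K b (scaledSeq X x (h n) w))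
      (offAt b (scaledSeq X x (h n) w)) (((n : ℝ) * h n) ^ 2)⁻¹ (Finset.range n) i := fun n i =>
    (measurable_llWeight hK.measurable b _ _ i).comp (measurable_scaledSeq hD (h n))
  have hsm : ∀ n i, Measurable fun w => scaledSeq X x (h n) w i := fun n i =>
    hD.measurable_scaled (h n) i
  have hridgem : ∀ n, Measurable (ridge n) := fun n => by
    have := hD.measurable_gramX hK (h n) b (Finset.range n)
    simp only [hridge]
    fun_prop
  have hquadm : ∀ n, Measurable (quad n) := fun n => by
    have := hwm n
    have := hsm n
    simp only [hquad, offAt]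
    exact Finset.measurable_sum _ fun i _ => (hwm n i).mul (((hsm n i).sub_const b).pow_const 2)
  have hremm : ∀ n, Measurable (rem n) := fun n => by
    have ht : Measurable (taylorRem m x) := by
      unfold taylorRem
      fun_prop
    simp only [hrem]
    exact Finset.measurable_sum _ fun i _ =>
      (hwm n i).mul (ht.comp (((hsm n i).const_mul (h n)).const_sub x))
  have hridge1 : ∀ᶠ n in atTop, ∀ w, |ridge n w| ≤ 1 := by
    filter_upwards [hlam] with n hn w
    have hg := gramX_nonneg hK (X := X) (x := x) (h n) b (Finset.range n) w
    rw [abs_of_nonneg (by simp only [hridge]; positivity)]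
    simp only [hridge]
    rw [div_le_one (by positivity)]
    linarith
  have hquad1 : ∀ᶠ n in atTop, ∀ w, |quad n w - nu20 K| ≤ B ^ 2 + |nu20 K| := by
    filter_upwards [hlam] with n hn w
    exact (abs_sub _ _).trans (add_le_add
      (abs_sum_llWeight_sq_le hK hB0 hB b (by positivity) _ _) le_rfl)
  have hrem1 : ∀ η > 0, ∀ᶠ n in atTop, ∀ w, |rem n w| ≤ η * h n ^ 2 := by
    intro η hη
    filter_upwards [hr.eventually_sum_taylorRem_le hK hpos hzero b hη, hlam] with n hn hn' w
    exact hn _ _ _ (by positivity)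
  have hridgeL : ∀ᶠ n in atTop, MemLp (ridge n) 2 P := by
    filter_upwards [hridge1] with n h1
    exact MemLp.of_bound (hridgem n).aestronglyMeasurable _ (ae_of_all _ h1)
  have hquadL : ∀ᶠ n in atTop, MemLp (fun w => quad n w - nu20 K) 2 P := by
    filter_upwards [hquad1] with n h1
    exact MemLp.of_bound ((hquadm n).sub_const _).aestronglyMeasurable _ (ae_of_all _ h1)
  have hremL : ∀ᶠ n in atTop, MemLp (rem n) 2 P := by
    filter_upwards [hrem1 1 one_pos] with n h1
    exact MemLp.of_bound (hremm n).aestronglyMeasurable _ (ae_of_all _ h1)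
  refine ⟨?_, ?_⟩
  · filter_upwards [hZ', hridgeL, hquadL, hremL] with n h1 h2 h3 h4
    rw [funext h1]
    exact ((h2.const_mul _).add (h3.const_mul _)).add h4
  have tridge := hD.tendsto_ridge hr.density_pos hK hpos hzero hnh b
  have tquad := hD.tendsto_quad hr.density_pos hK hpos hzero hnh b
  have tq0 : Tendsto q0 atTop (𝓝 (m x)) := by
    have := ((hzero.const_mul (deriv m x)).mul_const b).const_sub (m x) |>.add
      (((hzero.pow 2).const_mul m2).mul_const (b ^ 2))
    simpa [hq0, mul_assoc] using this
  have t1 := ((tq0.pow 2).mul tridge).const_mul 3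
  have t2 := tquad.const_mul (3 * m2 ^ 2)
  simp only [mul_zero] at t1 t2
  rw [isLittleO_iff]
  intro e he
  -- The square of a sum of three terms is at most three times the sum of squares, so `√(e / 6)`
  -- makes the remainder cost `e / 2 * h n ^ 4`; the fit of `t²` takes the other half.
  filter_upwards [hZ', hridgeL, hquadL, hremL, hlam, t1.eventually_le_const he,
    t2.eventually_le_const (half_pos he), hrem1 (√(e / 6)) (by positivity)]
    with n hZn h2 h3 h4 hn b1 b2 b3
  have hh := hpos n
  rw [Real.norm_of_nonneg (integral_nonneg fun _ => sq_nonneg _),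
    Real.norm_of_nonneg (by positivity)]
  have i1 : Integrable (fun w => 3 * q0 n ^ 2 * ridge n w ^ 2) P := h2.integrable_sq.const_mul _
  have i2 : Integrable (fun w => 3 * m2 ^ 2 * h n ^ 4 * (quad n w - nu20 K) ^ 2) P :=
    h3.integrable_sq.const_mul _
  have i12 : Integrable (fun w => 3 * q0 n ^ 2 * ridge n w ^ 2 +
    3 * m2 ^ 2 * h n ^ 4 * (quad n w - nu20 K) ^ 2) P := i1.add i2
  calc ∫ w, Z n w ^ 2 ∂P ≤ ∫ w, (3 * q0 n ^ 2 * ridge n w ^ 2 +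
        3 * m2 ^ 2 * h n ^ 4 * (quad n w - nu20 K) ^ 2 + e / 2 * h n ^ 4) ∂P := by
        refine integral_mono_of_nonneg (ae_of_all _ fun w => sq_nonneg _)
          (i12.add (integrable_const _)) (ae_of_all _ fun w => ?_)
        simp only
        rw [hZn w]
        have h5 : rem n w ^ 2 ≤ e / 6 * h n ^ 4 := by
          rw [← sq_abs]
          refine (pow_le_pow_left₀ (abs_nonneg _) (b3 w) 2).trans_eq ?_
          rw [mul_pow, Real.sq_sqrt (by positivity)]
          ring
        generalize ridge n w = a1 at *
        generalize quad n w - nu20 K = a2 at *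
        generalize rem n w = a3 at *
        nlinarith [sq_nonneg (-q0 n * a1 - m2 * h n ^ 2 * a2), sq_nonneg (-q0 n * a1 - a3),
          sq_nonneg (m2 * h n ^ 2 * a2 - a3)]
    _ = 3 * q0 n ^ 2 * (∫ w, ridge n w ^ 2 ∂P) +
        3 * m2 ^ 2 * h n ^ 4 * (∫ w, (quad n w - nu20 K) ^ 2 ∂P) + e / 2 * h n ^ 4 := by
        rw [integral_add i12 (integrable_const _), integral_add i1 i2, integral_const_mul,
          integral_const_mul, integral_const]
        simp
    _ ≤ e * (n * h n)⁻¹ + e / 2 * h n ^ 4 + e / 2 * h n ^ 4 := by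
        refine add_le_add (add_le_add ?_ ?_) le_rfl
        · rw [← div_eq_mul_inv, le_div_iff₀ hn]
          calc _ = 3 * (q0 n ^ 2 * (n * h n * ∫ w, ridge n w ^ 2 ∂P)) := by ring
            _ ≤ e := b1
        · calc _ = 3 * m2 ^ 2 * (∫ w, (quad n w - nu20 K) ^ 2 ∂P) * h n ^ 4 := by ring
            _ ≤ _ := by gcongr
    _ = _ := by ring

/-- The polynomial in the shift is interpolated exactly to `m x`, while the curvature bias is the
same at all three shifts and the coefficients sum to one. -/
theorem bias_tilde (hD : IsDesign P f X x) (hr : RegularAt m f σ x) (hm : Measurable m)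
    (hK : IsKernel K) (hpos : ∀ n, 0 < h n) (hzero : Tendsto h atTop (𝓝 0))
    (hnh : Tendsto (fun n : ℕ => (n : ℝ) * h n) atTop atTop) (δ r : ℝ) {H : ℕ → Ω → ℝ}
    (hH : ∀ n w, H n w = ∑ i ∈ Finset.range n, tildeWeight K δ r (((n : ℝ) * h n) ^ 2)⁻¹
      (Finset.range n) (scaledSeq X x (h n) w) i * m (X i w)) :
    (∀ᶠ n in atTop, MemLp (H n) 2 P) ∧
      (fun n => ∫ w, (H n w - (m x + 1 / 2 * deriv (deriv m) x * nu20 K * h n ^ 2)) ^ 2 ∂P)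
        =o[atTop] fun n : ℕ => h n ^ 4 + ((n : ℝ) * h n)⁻¹ := by
  set Z : Fin 3 → ℕ → Ω → ℝ := fun j n w => ∑ i ∈ Finset.range n,
      llWeight (kerAt K (node r δ j) (scaledSeq X x (h n) w))
        (offAt (node r δ j) (scaledSeq X x (h n) w)) (((n : ℝ) * h n) ^ 2)⁻¹ (Finset.range n) i *
          m (X i w) -
        (m x - deriv m x * h n * node r δ j +
          1 / 2 * deriv (deriv m) x * h n ^ 2 * node r δ j ^ 2) -
        1 / 2 * deriv (deriv m) x * nu20 K * h n ^ 2 with hZ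
  have hb := fun j => hD.bias_at_shift hr hm hK hpos hzero hnh (node r δ j) (Z := Z j)
    fun _ _ => rfl
  have hsum : ∀ n w, H n w - (m x + 1 / 2 * deriv (deriv m) x * nu20 K * h n ^ 2) =
      ∑ j, interpCoeff r j * Z j n w := by
    intro n w
    have e0 := sum_interpCoeff r
    have e1 := sum_interpCoeff_mul_node r δ
    have e2 := sum_interpCoeff_mul_node_sq r δ
    have e3 : H n w = ∑ j, interpCoeff r j * ∑ i ∈ Finset.range n,
      llWeight (kerAt K (node r δ j) (scaledSeq X x (h n) w))
        (offAt (node r δ j) (scaledSeq X x (h n) w)) (((n : ℝ) * h n) ^ 2)⁻¹ (Finset.range n) i *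
          m (X i w) := by
      rw [hH]
      simp only [tildeWeight, Finset.mul_sum, Finset.sum_mul]
      rw [Finset.sum_comm]
      exact Finset.sum_congr rfl fun i _ => Finset.sum_congr rfl fun j _ => by ring
    rw [e3]
    simp only [hZ]
    simp only [Fin.sum_univ_three] at e0 e1 e2 ⊢
    linear_combination (m x + 1 / 2 * deriv (deriv m) x * nu20 K * h n ^ 2) * e0 -
      deriv m x * h n * e1 + 1 / 2 * deriv (deriv m) x * h n ^ 2 * e2
  have hL : ∀ᶠ n in atTop, ∀ j, MemLp (Z j n) 2 P := eventually_all.2 fun j => (hb j).1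
  refine ⟨?_, ?_⟩
  · filter_upwards [hL] with n hn
    have h1 : MemLp (fun w => ∑ j, interpCoeff r j * Z j n w) 2 P :=
      memLp_finsetSum _ fun j _ => (hn j).const_mul _
    have h2 := h1.add (memLp_const (m x + 1 / 2 * deriv (deriv m) x * nu20 K * h n ^ 2))
    refine h2.ae_eq (ae_of_all _ fun w => ?_)
    simp only [Pi.add_apply, ← hsum]
    ring
  · have ho : (fun n => ∑ j, 3 * interpCoeff r j ^ 2 * ∫ w, Z j n w ^ 2 ∂P) =o[atTop]
        fun n : ℕ => h n ^ 4 + ((n : ℝ) * h n)⁻¹ :=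
      (IsLittleO.sum (s := Finset.univ) fun j _ => (hb j).2.const_mul_left
        (3 * interpCoeff r j ^ 2)).congr_left fun n => Finset.sum_apply _ _ _
    refine IsBigO.trans_isLittleO (IsBigO.of_bound 1 ?_) ho
    filter_upwards [hL] with n hn
    have hnn : 0 ≤ ∑ j, 3 * interpCoeff r j ^ 2 * ∫ w, Z j n w ^ 2 ∂P :=
      Finset.sum_nonneg fun j _ => mul_nonneg (by positivity) (integral_nonneg fun _ => sq_nonneg _)
    rw [Real.norm_of_nonneg (integral_nonneg fun _ => sq_nonneg _), Real.norm_of_nonneg hnn,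
      one_mul]
    simp only [← integral_const_mul]
    rw [← integral_finsetSum _ fun j _ => (hn j).integrable_sq.const_mul _]
    refine integral_mono_of_nonneg (ae_of_all _ fun w => sq_nonneg _)
      (integrable_finsetSum _ fun j _ => (hn j).integrable_sq.const_mul _)
      (ae_of_all _ fun w => ?_)
    simp only [hsum]
    refine sq_sum_le_card_mul_sum_sq.trans_eq ?_
    simp only [Finset.card_univ, Fintype.card_fin, Finset.mul_sum]
    exact Finset.sum_congr rfl fun j _ => by push_cast; ring

end IsDesign

end

/-! ### Pointwise comparison of weights, and sums of squares against vanishing factors. -/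

section

/-- Distance of a local linear weight from a multiple of its kernel weight, when the Gram
determinant is not too small. -/
theorem sq_weight_error_le {k t : ℕ → ℝ} {lam F ν c B : ℝ} {I : Finset ℕ} {i : ℕ} (hi : i ∈ I)
    (hlam : 0 < lam) (hF : 0 < F) (hc : 0 < c) (hB : k i ≠ 0 → |t i| ≤ B)
    (hg : c * lam ^ 2 ≤ gram k t I) :
    (llWeight k t (lam ^ 2)⁻¹ I i - k i / (lam * F)) ^ 2 ≤
      4 * ((lam * c) ^ 2)⁻¹ * (k i ^ 2 * ((lam⁻¹ * mom k t 2 (I.erase i) - F * ν) ^ 2 +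
        B ^ 2 * (lam⁻¹ * mom k t 1 (I.erase i)) ^ 2)) +
      2 * (lam ^ 2)⁻¹ * ((|F ^ 2 * ν| / c + 1) ^ 2 + (c ^ 2)⁻¹) / F ^ 2 *
        (k i ^ 2 * min 1 |(lam ^ 2)⁻¹ * (gram k t I + (lam ^ 2)⁻¹) - F ^ 2 * ν|) := by
  set a2 := lam⁻¹ * mom k t 2 (I.erase i) with ha2
  set a1 := lam⁻¹ * mom k t 1 (I.erase i) with ha1
  set D := (lam ^ 2)⁻¹ * (gram k t I + (lam ^ 2)⁻¹) with hD
  have hDc : c ≤ D := by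
    rw [hD, inv_mul_eq_div, le_div_iff₀ (by positivity)]
    have : 0 < (lam ^ 2)⁻¹ := by positivity
    linarith
  have hD0 : 0 < D := hc.trans_le hDc
  -- `u` carries the deviation of the moments without point `i`, `z` that of the normalised Gram
  -- determinant, in which point `i` still takes part.
  set u := (a2 - t i * a1 - F * ν) / D with hu
  set z := (F ^ 2 * ν - D) / (F * D) with hz
  have key : llWeight k t (lam ^ 2)⁻¹ I i - k i / (lam * F) = k i / lam * (u + z) := by
    have h1 : gram k t I + (lam ^ 2)⁻¹ = lam ^ 2 * D := by rw [hD]; field_simp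
    rw [llWeight, weight_eq_erase k t hi, h1]
    have e2 : mom k t 2 (I.erase i) = lam * a2 := by rw [ha2]; field_simp
    have e1 : mom k t 1 (I.erase i) = lam * a1 := by rw [ha1]; field_simp
    rw [e1, e2, hu, hz]
    field_simp
    ring
  -- Since `D ≥ c`, `z` is bounded for bounded relative deviation and small with it. Truncating at 1
  -- keeps `y` bounded, as required when it multiplies `k i ^ 2` without independence.
  set y := min 1 |D - F ^ 2 * ν| with hy
  have hy0 : 0 ≤ y := le_min zero_le_one (abs_nonneg _)
  have hz2 : z ^ 2 ≤ ((|F ^ 2 * ν| / c + 1) ^ 2 + (c ^ 2)⁻¹) / F ^ 2 * y := by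
    have e : z ^ 2 = ((D - F ^ 2 * ν) / D) ^ 2 / F ^ 2 := by
      rw [hz]; field_simp; ring
    rw [e, div_mul_eq_mul_div]
    refine div_le_div_of_nonneg_right ?_ (by positivity)
    rcases le_total 1 |D - F ^ 2 * ν| with h1 | h1
    · rw [hy, min_eq_left h1, mul_one]
      have h2 : |(D - F ^ 2 * ν) / D| ≤ |F ^ 2 * ν| / c + 1 := by
        rw [abs_div, abs_of_pos hD0, div_le_iff₀ hD0]
        have h3 := abs_sub D (F ^ 2 * ν)
        rw [abs_of_pos hD0] at h3
        have h4 : |F ^ 2 * ν| ≤ |F ^ 2 * ν| / c * D := by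
          rw [div_mul_eq_mul_div, le_div_iff₀ hc]
          gcongr
        linarith
      rw [← sq_abs]
      have := pow_le_pow_left₀ (abs_nonneg _) h2 2
      have : 0 ≤ (c ^ 2)⁻¹ := by positivity
      linarith
    · rw [hy, min_eq_right h1, div_pow, div_le_iff₀ (by positivity), ← sq_abs]
      have h2 : |D - F ^ 2 * ν| ^ 2 ≤ |D - F ^ 2 * ν| := by
        rw [sq]; exact mul_le_of_le_one_left (abs_nonneg _) h1
      have h3 : 1 ≤ (c ^ 2)⁻¹ * D ^ 2 := by
        rw [inv_mul_eq_div, one_le_div (by positivity)]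
        gcongr
      have h4 : 0 ≤ (|F ^ 2 * ν| / c + 1) ^ 2 * D ^ 2 := by positivity
      have h5 := abs_nonneg (D - F ^ 2 * ν)
      nlinarith [mul_nonneg h4 h5, mul_le_mul_of_nonneg_right h3 h5]
  have hu2 : k i ^ 2 * u ^ 2 ≤
      2 * (c ^ 2)⁻¹ * (k i ^ 2 * ((a2 - F * ν) ^ 2 + B ^ 2 * a1 ^ 2)) := by
    by_cases hk0 : k i = 0
    · simp [hk0]
    have ht : t i ^ 2 ≤ B ^ 2 := by
      rw [← sq_abs]; exact pow_le_pow_left₀ (abs_nonneg _) (hB hk0) 2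
    have h1 : u ^ 2 ≤ (c ^ 2)⁻¹ * (a2 - t i * a1 - F * ν) ^ 2 := by
      rw [hu, div_pow, div_eq_inv_mul]
      gcongr
    have h2 : (a2 - t i * a1 - F * ν) ^ 2 ≤ 2 * ((a2 - F * ν) ^ 2 + B ^ 2 * a1 ^ 2) := by
      nlinarith [sq_nonneg (a2 - F * ν + t i * a1), mul_le_mul_of_nonneg_right ht (sq_nonneg a1)]
    calc k i ^ 2 * u ^ 2 ≤ k i ^ 2 * ((c ^ 2)⁻¹ * (2 * ((a2 - F * ν) ^ 2 + B ^ 2 * a1 ^ 2))) := by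
          gcongr
          exact h1.trans (by gcongr)
      _ = _ := by ring
  rw [key]
  calc (k i / lam * (u + z)) ^ 2 ≤ 2 * (lam ^ 2)⁻¹ * (k i ^ 2 * u ^ 2 + k i ^ 2 * z ^ 2) := by
        have e : 2 * (lam ^ 2)⁻¹ * (k i ^ 2 * u ^ 2 + k i ^ 2 * z ^ 2) =
          (k i / lam) ^ 2 * (2 * (u ^ 2 + z ^ 2)) := by field_simp
        rw [e, mul_pow]
        gcongr
        nlinarith [sq_nonneg (u - z)]
    _ ≤ 2 * (lam ^ 2)⁻¹ * (2 * (c ^ 2)⁻¹ * (k i ^ 2 * ((a2 - F * ν) ^ 2 + B ^ 2 * a1 ^ 2)) +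
        k i ^ 2 * (((|F ^ 2 * ν| / c + 1) ^ 2 + (c ^ 2)⁻¹) / F ^ 2 * y)) := by gcongr
    _ = _ := by rw [mul_pow lam c, mul_inv]; ring

theorem integral_mul_le_sqrt_mul_sqrt {Ω : Type*} [MeasurableSpace Ω] {P : Measure Ω}
    {a b : Ω → ℝ} (ha : MemLp a 2 P) (hb : MemLp b 2 P) (ha0 : ∀ w, 0 ≤ a w)
    (hb0 : ∀ w, 0 ≤ b w) :
    ∫ w, a w * b w ∂P ≤ √(∫ w, a w ^ 2 ∂P) * √(∫ w, b w ^ 2 ∂P) := by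
  have h := integral_mul_le_Lp_mul_Lq_of_nonneg (p := 2) (q := 2) Real.HolderConjugate.two_two
    (ae_of_all P ha0) (ae_of_all P hb0) (by simpa using ha) (by simpa using hb)
  simpa [Real.sqrt_eq_rpow] using h

theorem integral_sq_le_of_integral_sub_sq_le {Ω : Type*} [MeasurableSpace Ω] {P : Measure Ω}
    [IsProbabilityMeasure P] {Z : Ω → ℝ} (hZ : MemLp Z 2 P) {a : ℝ}
    (h : ∫ w, (Z w - a) ^ 2 ∂P ≤ 1) : ∫ w, Z w ^ 2 ∂P ≤ 2 + 2 * a ^ 2 := by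
  have hL : MemLp (fun w => Z w - a) 2 P := hZ.sub (memLp_const a)
  calc _ ≤ ∫ w, (2 * (Z w - a) ^ 2 + 2 * a ^ 2) ∂P := by
        refine integral_mono_of_nonneg (ae_of_all _ fun w => sq_nonneg _)
          ((hL.integrable_sq.const_mul 2).add (integrable_const _)) (ae_of_all _ fun w => ?_)
        simp only
        nlinarith [sq_nonneg (Z w - 2 * a)]
    _ = 2 * ∫ w, (Z w - a) ^ 2 ∂P + 2 * a ^ 2 := by
        rw [integral_add (hL.integrable_sq.const_mul 2) (integrable_const _),
          integral_const_mul, integral_const]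
        simp
    _ ≤ _ := by linarith

theorem mom_congr {K : ℝ → ℝ} {b : ℝ} {l : ℕ} {I : Finset ℕ} {v v' : ℕ → ℝ}
    (h : ∀ j ∈ I, v j = v' j) :
    mom (kerAt K b v) (offAt b v) l I = mom (kerAt K b v') (offAt b v') l I :=
  Finset.sum_congr rfl fun j hj => by simp only [kerAt, offAt, h j hj]

variable {Ω : Type*} [MeasurableSpace Ω] {P : Measure Ω}
variable {m f σ : ℝ → ℝ} {X : ℕ → Ω → ℝ} {x : ℝ} {h : ℕ → ℝ} {K : ℝ → ℝ}

namespace IsDesign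

theorem indepFun_scaled (hD : IsDesign P f X x) (h : ℝ) {S : Finset ℕ} {i : ℕ} (hi : i ∉ S)
    {F : ℝ → ℝ} (hF : Measurable F) {G : (ℕ → ℝ) → ℝ} (hG : Measurable G)
    (hGS : ∀ v v' : ℕ → ℝ, (∀ j ∈ S, v j = v' j) → G v = G v') :
    IndepFun (fun w => F (scaled X x h i w)) (fun w => G (scaledSeq X x h w)) P :=
  hD.indepFun_of_notMem hi (F := fun y => F ((x - y) / h)) (G := fun u => G fun j => (x - u j) / h)
    (by fun_prop) (hG.comp (by fun_prop)) fun v v' hv => hGS _ _ fun j hj => by rw [hv j hj]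

variable [IsProbabilityMeasure P]

/-- Products of local squares with bounded variables that vanish in the limit. -/
theorem tendsto_sum_sq_mul (hD : IsDesign P f X x) (hpos : ∀ n, 0 < h n)
    (hzero : Tendsto h atTop (𝓝 0))
    (hnh : Tendsto (fun n : ℕ => (n : ℝ) * h n) atTop atTop) {φ : ℝ → ℝ} {B : ℝ}
    (hφ : IsSqCell φ B) {y : ℕ → Ω → ℝ} (hym : ∀ n, Measurable (y n)) (hy0 : ∀ n w, 0 ≤ y n w)
    (hy1 : ∀ n w, y n w ≤ 1) (ty : Tendsto (fun n => ∫ w, y n w ∂P) atTop (𝓝 0)) :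
    Tendsto (fun n : ℕ => ((n : ℝ) * h n)⁻¹ *
      ∑ i ∈ Finset.range n, ∫ w, φ (scaled X x (h n) i w) ^ 2 * y n w ∂P) atTop (𝓝 0) := by
  have hφm := hφ.measurable
  -- With no fourth moment of `φ`, Cauchy–Schwarz cannot be applied to `φ ^ 2 * y`. Where `|φ| > M`
  -- use `y ≤ 1` and the small tail integral; elsewhere replace `φ ^ 2` by `M ^ 2 * ψ` and apply
  -- Cauchy–Schwarz to the point count and `y`.
  set φM : ℕ → ℝ → ℝ := fun M => {s | (M : ℝ) < |φ s|}.indicator (fun s => φ s ^ 2) with hφM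
  have hset : ∀ M : ℕ, MeasurableSet {s | (M : ℝ) < |φ s|} := fun M =>
    measurableSet_lt measurable_const (continuous_abs.measurable.comp hφm)
  have hcell : ∀ M, IsCell (φM M) B := fun M =>
    ⟨hφ.sq.measurable.indicator (hset M), hφ.integrable_sq.indicator (hset M), fun s hs =>
      hφ.sq.support_le s fun h0 => hs (by simp [hφM, Set.indicator_apply, h0])⟩
  set ψ : ℝ → ℝ := (Set.Icc (-B) B).indicator (fun _ => 1) with hψ
  have hψ01 : ∀ s, ψ s = 0 ∨ ψ s = 1 := fun s => by
    by_cases hs : s ∈ Set.Icc (-B) B <;> simp only [hψ, Set.indicator_of_mem,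
      Set.indicator_of_notMem, hs, not_false_eq_true, or_true, true_or]
  have hψi : Integrable ψ := (integrable_indicator_iff measurableSet_Icc).2
    (integrableOn_const (by simp))
  have hψc : IsSqCell ψ B := by
    refine ⟨measurable_const.indicator measurableSet_Icc, ?_, fun s hs =>
      abs_le.2 (show s ∈ Set.Icc (-B) B from Set.mem_of_indicator_ne_zero hs)⟩
    refine hψi.congr (ae_of_all _ fun s => ?_)
    rcases hψ01 s with hs | hs <;> simp [hs]
  set a := f x * ∫ s, ψ s with ha
  have tM : Tendsto (fun M => f x * ∫ s, φM M s) atTop (𝓝 0) := by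
    have h1 : Tendsto (fun M => ∫ s, φM M s) atTop (𝓝 (∫ _ : ℝ, (0 : ℝ))) := by
      refine tendsto_integral_of_dominated_convergence (fun s => φ s ^ 2)
        (fun M => (hcell M).measurable.aestronglyMeasurable) hφ.integrable_sq
        (fun M => ae_of_all _ fun s => ?_) (ae_of_all _ fun s => ?_)
      · simp only [hφM, Set.indicator_apply]
        split_ifs <;> simp [sq_nonneg]
      · obtain ⟨M0, hM0⟩ := exists_nat_ge |φ s|
        refine tendsto_const_nhds.congr' ?_
        filter_upwards [eventually_ge_atTop M0] with M hM
        have : |φ s| ≤ M := hM0.trans (by exact_mod_cast hM)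
        simp [hφM, this]
    simpa using h1.const_mul (f x)
  rw [Metric.tendsto_nhds]
  intro e he
  -- The level is fixed before `n`, so the factor `M ^ 2` is harmless afterwards.
  obtain ⟨M, hM⟩ := (tM.eventually_lt_const (half_pos he)).exists
  have t1 := (hD.tendsto_integral_one hpos hzero (hcell M) 0).eventually_lt_const hM
  have t2 : Tendsto (fun n => (M : ℝ) ^ 2 * (√(2 + 2 * a ^ 2) * √(∫ w, y n w ∂P))) atTop
      (𝓝 0) := by
    simpa using (ty.sqrt.const_mul (√(2 + 2 * a ^ 2))).const_mul ((M : ℝ) ^ 2)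
  filter_upwards [t1, t2.eventually_lt_const (half_pos he), hnh.eventually_gt_atTop 0,
    hD.eventually_memLp hpos hzero hψc, hD.eventually_integrable_one hpos hzero (hcell M),
    hD.law_of_large_numbers hpos hzero hnh hψc one_pos] with n b1 b2 hn hL hI hlln
  have hh := hpos n
  have hn0 : (0 : ℝ) < n := pos_of_mul_pos_left hn hh.le
  have hyL : MemLp (y n) 2 P := MemLp.of_bound (hym n).aestronglyMeasurable 1
    (ae_of_all _ fun w => by rw [Real.norm_of_nonneg (hy0 n w)]; exact hy1 n w)
  rw [Real.dist_eq, sub_zero, abs_of_nonneg (mul_nonneg (by positivity)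
    (Finset.sum_nonneg fun i _ => integral_nonneg fun w => mul_nonneg (sq_nonneg _) (hy0 n w)))]
  set N : Ω → ℝ := fun w => ∑ i ∈ Finset.range n, ψ (scaled X x (h n) i w) with hN
  have hNL : MemLp N 2 P := memLp_finsetSum _ fun i _ => hL i
  have hψ0 : ∀ s, 0 ≤ ψ s := fun s => by rcases hψ01 s with hs | hs <;> simp [hs]
  have hN0 : ∀ w, 0 ≤ N w := fun w => Finset.sum_nonneg fun i _ => hψ0 _
  have hNsq : ∫ w, ((n * h n)⁻¹ * N w) ^ 2 ∂P ≤ 2 + 2 * a ^ 2 :=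
    integral_sq_le_of_integral_sub_sq_le (hNL.const_mul _)
      (hlln (Finset.range n) (by simp) (by simp))
  have hpt : ∀ i w, φ (scaled X x (h n) i w) ^ 2 * y n w ≤
      φM M (scaled X x (h n) i w) + (M : ℝ) ^ 2 * (ψ (scaled X x (h n) i w) * y n w) := by
    intro i w
    generalize scaled X x (h n) i w = s
    by_cases hs : (M : ℝ) < |φ s|
    · have e1 : φM M s = φ s ^ 2 := Set.indicator_of_mem (s := {s | (M : ℝ) < |φ s|}) hs _
      rw [e1]
      have := mul_le_of_le_one_right (sq_nonneg (φ s)) (hy1 n w)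
      have : 0 ≤ (M : ℝ) ^ 2 * (ψ s * y n w) :=
        mul_nonneg (sq_nonneg _) (mul_nonneg (hψ0 s) (hy0 n w))
      linarith
    · have e1 : φM M s = 0 := Set.indicator_of_notMem (s := {s | (M : ℝ) < |φ s|}) hs _
      rw [e1, zero_add]
      by_cases h0 : φ s = 0
      · rw [h0]
        have : 0 ≤ (M : ℝ) ^ 2 * (ψ s * y n w) :=
          mul_nonneg (sq_nonneg _) (mul_nonneg (hψ0 s) (hy0 n w))
        simpa using this
      · have e2 : ψ s = 1 := Set.indicator_of_mem
          (show s ∈ Set.Icc (-B) B from abs_le.1 (hφ.support_le s h0)) _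
        rw [e2, one_mul]
        refine mul_le_mul_of_nonneg_right ?_ (hy0 n w)
        rw [← sq_abs]
        exact pow_le_pow_left₀ (abs_nonneg _) (not_lt.1 hs) 2
  have hψy : ∀ i, Integrable (fun w => ψ (scaled X x (h n) i w) * y n w) P := fun i =>
    (hL i).integrable_mul hyL
  calc (n * h n)⁻¹ * ∑ i ∈ Finset.range n, ∫ w, φ (scaled X x (h n) i w) ^ 2 * y n w ∂P
      ≤ (n * h n)⁻¹ * ∑ i ∈ Finset.range n, (∫ w, φM M (scaled X x (h n) 0 w) ∂P +
          (M : ℝ) ^ 2 * ∫ w, ψ (scaled X x (h n) i w) * y n w ∂P) := by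
        refine mul_le_mul_of_nonneg_left (Finset.sum_le_sum fun i _ => ?_) (by positivity)
        rw [← hD.integral_scaled_eq hh (hcell M).measurable i 0, ← integral_const_mul,
          ← integral_add (hI i) ((hψy i).const_mul _)]
        exact integral_mono_of_nonneg (ae_of_all _ fun w =>
          mul_nonneg (sq_nonneg _) (hy0 n w)) ((hI i).add ((hψy i).const_mul _))
          (ae_of_all _ fun w => hpt i w)
    _ = (h n)⁻¹ * (∫ w, φM M (scaled X x (h n) 0 w) ∂P) +
          (M : ℝ) ^ 2 * ∫ w, (n * h n)⁻¹ * N w * y n w ∂P := by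
        rw [Finset.sum_add_distrib, ← Finset.mul_sum, ← integral_finsetSum _ fun i _ => hψy i]
        simp only [hN, mul_assoc, integral_const_mul, Finset.sum_mul]
        simp only [Finset.sum_const, Finset.card_range, nsmul_eq_mul]
        field_simp
    _ ≤ (h n)⁻¹ * (∫ w, φM M (scaled X x (h n) 0 w) ∂P) +
          (M : ℝ) ^ 2 * (√(2 + 2 * a ^ 2) * √(∫ w, y n w ∂P)) := by
        have h1 := integral_mul_le_sqrt_mul_sqrt (hNL.const_mul (n * h n)⁻¹) hyL
          (fun w => mul_nonneg (by positivity) (hN0 w)) (hy0 n)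
        have h2 : ∫ w, y n w ^ 2 ∂P ≤ ∫ w, y n w ∂P :=
          integral_mono hyL.integrable_sq (hyL.integrable one_le_two) fun w => by
            simp only [sq]
            exact mul_le_of_le_one_left (hy0 n w) (hy1 n w)
        refine add_le_add le_rfl (mul_le_mul_of_nonneg_left (h1.trans ?_) (sq_nonneg _))
        exact mul_le_mul (Real.sqrt_le_sqrt hNsq) (Real.sqrt_le_sqrt h2) (Real.sqrt_nonneg _)
          (Real.sqrt_nonneg _)
    _ < e := by linarith

end IsDesign

end

/-! ### Mean-square approximation of local linear weights by kernel weights. -/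

section

variable {Ω : Type*} [MeasurableSpace Ω] {P : Measure Ω} [IsProbabilityMeasure P]
variable {m f σ : ℝ → ℝ} {X : ℕ → Ω → ℝ} {x : ℝ} {h : ℕ → ℝ} {K : ℝ → ℝ}

namespace IsDesign

/-- The local linear weights are close to multiples of the kernel weights. -/
theorem tendsto_weight_error (hD : IsDesign P f X x) (hfx : 0 < f x) (hK : IsKernel K)
    (hpos : ∀ n, 0 < h n) (hzero : Tendsto h atTop (𝓝 0))
    (hnh : Tendsto (fun n : ℕ => (n : ℝ) * h n) atTop atTop) (b : ℝ) {err : ℕ → ℕ → Ω → ℝ}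
    (herr : ∀ n i w, err n i w = llWeight (kerAt K b (scaledSeq X x (h n) w))
      (offAt b (scaledSeq X x (h n) w)) (((n : ℝ) * h n) ^ 2)⁻¹ (Finset.range n) i -
      kerAt K b (scaledSeq X x (h n) w) i / (n * h n * f x)) :
    (∀ᶠ n in atTop, ∀ i ∈ Finset.range n, Integrable (fun w => err n i w ^ 2) P) ∧
      Tendsto (fun n : ℕ => n * h n * ∑ i ∈ Finset.range n, ∫ w, err n i w ^ 2 ∂P)
        atTop (𝓝 0) := by
  obtain ⟨B, hB0, hB⟩ := hK.exists_bound
  obtain ⟨A, A', c, c', hA, hA', hc, hc', hgram, hprob⟩ :=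
    hD.exists_sparse hfx hpos hzero hK b
  have hKm := hK.measurable
  have hφ : IsSqCell (fun s => K (s - b)) (B + |b|) := by
    simpa using hK.isSqCell hB 0 b
  set ν := nu20 K with hν
  set J : ℕ → ℕ → Finset ℕ := fun n i => (Finset.range n).erase i with hJ
  have hJc : ∀ n, ∀ i ∈ Finset.range n, (J n i).card ≤ n ∧ n ≤ (J n i).card + 1 := by
    intro n i hi
    have : (J n i).card + 1 = n := by
      rw [hJ]; simpa using Finset.card_erase_add_one hi
    omega
  -- The exceptional event is formed without point `i`, so that it is independent of the kernel
  -- weight at `i`.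
  set S : ℕ → ℕ → Set (ℕ → ℝ) := fun n i => sparse A A' (c * (n * h n)) (J n i) with hS
  have hSm : ∀ n i, MeasurableSet (S n i) := fun n i => measurableSet_sparse hA hA' _ _
  set k : ℕ → ℕ → Ω → ℝ := fun n i w => K (scaled X x (h n) i w - b) with hk
  set s : ℕ → ℕ → ℕ → Ω → ℝ := fun l n i => momX K X x (h n) b l (J n i) with hs
  set bad : ℕ → ℕ → Ω → ℝ := fun n i w =>
    (S n i).indicator (fun _ => 1) (scaledSeq X x (h n) w) with hbad
  set y : ℕ → Ω → ℝ := fun n w => min 1 |(((n : ℝ) * h n) ^ 2)⁻¹ *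
    (gramX K X x (h n) b (Finset.range n) w + (((n : ℝ) * h n) ^ 2)⁻¹) - f x ^ 2 * ν| with hy
  set C : ℝ := 2 * ((|f x ^ 2 * ν| / c' + 1) ^ 2 + (c' ^ 2)⁻¹) / f x ^ 2 with hC
  set R : ℕ → ℕ → Ω → ℝ := fun n i w => (((n : ℝ) * h n)⁻¹ * s 2 n i w - f x * ν) ^ 2 +
    B ^ 2 * (((n : ℝ) * h n)⁻¹ * s 1 n i w) ^ 2 with hR
  have hk0 : ∀ n i w, 0 ≤ k n i w := fun n i w => hK.nonneg _
  have hs0 : ∀ n i w, 0 ≤ s 2 n i w := fun n i w => mom_two_nonneg (fun _ => hK.nonneg _) _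
  have hbad01 : ∀ n i w, bad n i w = 0 ∨ bad n i w = 1 := fun n i w => by
    by_cases hw : scaledSeq X x (h n) w ∈ S n i
    · exact Or.inr (Set.indicator_of_mem hw _)
    · exact Or.inl (Set.indicator_of_notMem hw _)
  have hbad0 : ∀ n i w, 0 ≤ bad n i w := fun n i w => by
    rcases hbad01 n i w with h | h <;> simp [h]
  have hV : ∀ n, Measurable (scaledSeq X x (h n)) := fun n => measurable_scaledSeq hD (h n)
  have hbadm : ∀ n i, Measurable (bad n i) := fun n i =>
    (measurable_const.indicator (hSm n i)).comp (hV n)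
  have hbadL : ∀ n i, MemLp (bad n i) 2 P := fun n i =>
    MemLp.of_bound (hbadm n i).aestronglyMeasurable 1 (ae_of_all _ fun w => by
      rcases hbad01 n i w with h | h <;> simp [h])
  have hbadint : ∀ n i, ∫ w, bad n i w ∂P = P.real {w | scaledSeq X x (h n) w ∈ S n i} := by
    intro n i
    rw [show bad n i = (scaledSeq X x (h n) ⁻¹' S n i).indicator 1 from rfl,
      integral_indicator_one ((hV n) (hSm n i))]
    rfl
  have hym : ∀ n, Measurable (y n) := fun n => by
    have := hD.measurable_gramX hK (h n) b (Finset.range n)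
    exact measurable_const.min (continuous_abs.measurable.comp
      (((this.add_const _).const_mul _).sub_const _))
  have hy0 : ∀ n w, 0 ≤ y n w := fun n w => le_min zero_le_one (abs_nonneg _)
  have hy1 : ∀ n w, y n w ≤ 1 := fun n w => min_le_left _ _
  -- The first two terms bound the weight and its approximation separately on the exceptional event.
  -- The last two come from `sq_weight_error_le` off it. In the first three, the factor at `i` is
  -- independent of the other.
  have hpt : ∀ n : ℕ, 0 < (n : ℝ) * h n → ∀ i ∈ Finset.range n, ∀ w, err n i w ^ 2 ≤
      2 * ((n : ℝ) * h n) ^ 2 * (k n i w * (s 2 n i w * bad n i w)) +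
      2 * (((n : ℝ) * h n * f x) ^ 2)⁻¹ * (k n i w ^ 2 * bad n i w) +
      4 * (((n : ℝ) * h n * c') ^ 2)⁻¹ * (k n i w ^ 2 * R n i w) +
      (((n : ℝ) * h n) ^ 2)⁻¹ * C * (k n i w ^ 2 * y n w) := by
    intro n hn i hi w
    have hC0 : 0 ≤ C := by positivity
    have hy0' := hy0 n w
    have hs0' := hs0 n i w
    have hk0' := hk0 n i w
    have hR0 : 0 ≤ R n i w := by simp only [hR]; positivity
    by_cases hw : scaledSeq X x (h n) w ∈ S n i
    · have e1 : bad n i w = 1 := Set.indicator_of_mem hw _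
      rw [e1, mul_one, mul_one]
      have h1 := sq_llWeight_le (k := kerAt K b (scaledSeq X x (h n) w))
        (t := offAt b (scaledSeq X x (h n) w)) (fun _ => hK.nonneg _)
        (ρ := (((n : ℝ) * h n) ^ 2)⁻¹) (by positivity) hi
      rw [div_inv_eq_mul] at h1
      have h1' : llWeight (kerAt K b (scaledSeq X x (h n) w)) (offAt b (scaledSeq X x (h n) w))
        (((n : ℝ) * h n) ^ 2)⁻¹ (Finset.range n) i ^ 2 ≤
          k n i w * s 2 n i w * ((n : ℝ) * h n) ^ 2 := h1
      have h2 : (kerAt K b (scaledSeq X x (h n) w) i / (n * h n * f x)) ^ 2 =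
        (((n : ℝ) * h n * f x) ^ 2)⁻¹ * k n i w ^ 2 := by
          rw [div_pow, div_eq_inv_mul]; rfl
      have h3 : 0 ≤ 4 * (((n : ℝ) * h n * c') ^ 2)⁻¹ * (k n i w ^ 2 * R n i w) := by positivity
      have h4 : 0 ≤ (((n : ℝ) * h n) ^ 2)⁻¹ * C * (k n i w ^ 2 * y n w) := by positivity
      rw [herr]
      nlinarith [add_sq_le (a := llWeight (kerAt K b (scaledSeq X x (h n) w))
        (offAt b (scaledSeq X x (h n) w)) (((n : ℝ) * h n) ^ 2)⁻¹ (Finset.range n) i)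
        (b := -(kerAt K b (scaledSeq X x (h n) w) i / (n * h n * f x)))]
    · have e1 : bad n i w = 0 := Set.indicator_of_notMem hw _
      rw [e1]
      -- Restoring point `i` can only raise the two counts, so the full sample is not sparse either.
      have hw' : scaledSeq X x (h n) w ∉ sparse A A' (c * (n * h n)) (Finset.range n) :=
        fun h' => hw (sparse_anti (Finset.erase_subset _ _) h')
      have h1 := sq_weight_error_le (k := kerAt K b (scaledSeq X x (h n) w))
        (t := offAt b (scaledSeq X x (h n) w)) (ν := ν) (B := B) hi hn hfx hc'
        (fun h' => hB _ h') (hgram _ _ _ hn.le hw')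
      rw [← herr] at h1
      refine h1.trans (le_of_eq ?_)
      simp only [mul_zero, zero_add, hR, hC, hy, hs, hk, momX, gramX, hJ, kerAt, scaledSeq]
      ring
  have hev := (hD.eventually_memLp hpos hzero hφ).and ((hD.eventually_memLp_momX hK hpos hzero
    b 1).and ((hD.eventually_memLp_momX hK hpos hzero b 2).and (hnh.eventually_gt_atTop 0)))
  have hnotmem : ∀ n i, i ∉ J n i := fun n i => Finset.notMem_erase i _
  have hSc : ∀ n i, ∀ v v' : ℕ → ℝ, (∀ j ∈ J n i, v j = v' j) →
      (S n i).indicator (fun _ => (1 : ℝ)) v = (S n i).indicator (fun _ => (1 : ℝ)) v' := by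
    intro n i v v' hv
    have h1 : v ∈ S n i ↔ v' ∈ S n i := mem_sparse_congr hv
    by_cases hv' : v' ∈ S n i
    · rw [Set.indicator_of_mem hv', Set.indicator_of_mem (h1.2 hv')]
    · rw [Set.indicator_of_notMem hv', Set.indicator_of_notMem (mt h1.1 hv')]
  have hind1 : ∀ n i, IndepFun (k n i) (fun w => s 2 n i w * bad n i w) P := fun n i =>
    hD.indepFun_scaled (h n) (hnotmem n i) (F := fun s => K (s - b))
      (G := fun v => mom (kerAt K b v) (offAt b v) 2 (J n i) *
        (S n i).indicator (fun _ => 1) v) (by fun_prop)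
      ((measurable_mom hKm b 2 _).mul (measurable_const.indicator (hSm n i)))
      fun v v' hv => by
        rw [mom_congr hv]
        exact congrArg _ (hSc n i v v' hv)
  have hind2 : ∀ n i, IndepFun (fun w => k n i w ^ 2) (bad n i) P := fun n i =>
    hD.indepFun_scaled (h n) (hnotmem n i) (F := fun s => K (s - b) ^ 2)
      (G := fun v => (S n i).indicator (fun _ => 1) v) (by fun_prop)
      (measurable_const.indicator (hSm n i))
      fun v v' hv => by
        exact hSc n i v v' hv
  have hind3 : ∀ n i, IndepFun (fun w => k n i w ^ 2) (R n i) P := fun n i =>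
    hD.indepFun_scaled (h n) (hnotmem n i) (F := fun s => K (s - b) ^ 2)
      (G := fun v => (((n : ℝ) * h n)⁻¹ * mom (kerAt K b v) (offAt b v) 2 (J n i) -
          f x * ν) ^ 2 +
        B ^ 2 * (((n : ℝ) * h n)⁻¹ * mom (kerAt K b v) (offAt b v) 1 (J n i)) ^ 2) (by fun_prop)
      (by
        have := fun l => measurable_mom hKm b l (J n i)
        fun_prop)
      fun v v' hv => by simp only [mom_congr hv]
  have hint : ∀ᶠ n in atTop, ∀ i,
      (Integrable (k n i) P ∧ Integrable (fun w => k n i w ^ 2) P ∧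
        Integrable (fun w => s 2 n i w * bad n i w) P ∧ Integrable (R n i) P) ∧
      Integrable (fun w => k n i w * (s 2 n i w * bad n i w)) P ∧
      Integrable (fun w => k n i w ^ 2 * bad n i w) P ∧
      Integrable (fun w => k n i w ^ 2 * R n i w) P ∧
      Integrable (fun w => k n i w ^ 2 * y n w) P := by
    filter_upwards [hev] with n ⟨hkL, hs1, hs2, hn⟩ i
    have i1 : Integrable (k n i) P := (hkL i).integrable one_le_two
    have i2 : Integrable (fun w => k n i w ^ 2) P := (hkL i).integrable_sq
    have i3 : Integrable (fun w => s 2 n i w * bad n i w) P := (hs2 _).integrable_mul (hbadL n i)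
    have i4 : Integrable (R n i) P := by
      have h1 : MemLp (fun w => ((n : ℝ) * h n)⁻¹ * s 2 n i w - f x * ν) 2 P :=
        ((hs2 _).const_mul _).sub (memLp_const _)
      exact h1.integrable_sq.add (((hs1 _).const_mul _).integrable_sq.const_mul _)
    refine ⟨⟨i1, i2, i3, i4⟩, (hind1 n i).integrable_mul i1 i3,
      (hind2 n i).integrable_mul i2 ((hbadL n i).integrable one_le_two),
      (hind3 n i).integrable_mul i2 i4, ?_⟩
    exact i2.mul_bdd (c := 1) (hym n).aestronglyMeasurable (ae_of_all _ fun w => by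
      rw [Real.norm_of_nonneg (hy0 n w)]; exact hy1 n w)
  have herrm : ∀ n i, Measurable (err n i) := fun n i => by
    have h1 : err n i = fun w => (fun v => llWeight (kerAt K b v) (offAt b v)
      (((n : ℝ) * h n) ^ 2)⁻¹ (Finset.range n) i - K (v i - b) / (n * h n * f x))
        (scaledSeq X x (h n) w) := funext fun w => herr n i w
    rw [h1]
    have := measurable_llWeight hKm b (((n : ℝ) * h n) ^ 2)⁻¹ (Finset.range n) i
    have h2 : Measurable fun v : ℕ → ℝ => llWeight (kerAt K b v) (offAt b v)
      (((n : ℝ) * h n) ^ 2)⁻¹ (Finset.range n) i - K (v i - b) / (n * h n * f x) := by fun_prop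
    exact h2.comp (hV n)
  refine ⟨?_, ?_⟩
  · filter_upwards [hint, hnh.eventually_gt_atTop 0] with n h1 hn i hi
    obtain ⟨-, h1, h2, h3, h4⟩ := h1 i
    refine ((((h1.const_mul (2 * ((n : ℝ) * h n) ^ 2)).add
      (h2.const_mul (2 * (((n : ℝ) * h n * f x) ^ 2)⁻¹))).add
      (h3.const_mul (4 * (((n : ℝ) * h n * c') ^ 2)⁻¹))).add
      (h4.const_mul ((((n : ℝ) * h n) ^ 2)⁻¹ * C))).mono' ((herrm n i).pow_const 2).aestronglyMeasurable
      (ae_of_all _ fun w => ?_)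
    rw [Real.norm_of_nonneg (sq_nonneg _)]
    exact hpt n hn i hi w
  have ty : Tendsto (fun n => ∫ w, y n w ∂P) atTop (𝓝 0) := by
    obtain ⟨ig, tg⟩ := hD.tendsto_gramX hK hpos hzero hnh b
    have h1 := tg.add (hnh.inv_tendsto_atTop.pow 4)
    simp only [ne_eq, OfNat.ofNat_ne_zero, not_false_eq_true, zero_pow, add_zero] at h1
    refine squeeze_zero' (Eventually.of_forall fun n => integral_nonneg (hy0 n)) ?_ h1
    filter_upwards [ig, hnh.eventually_gt_atTop 0] with n ig hn
    have i1 : Integrable (fun w => |(((n : ℝ) * h n) ^ 2)⁻¹ *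
        gramX K X x (h n) b (Finset.range n) w - f x ^ 2 * ν|) P :=
      ((ig.const_mul _).sub (integrable_const _)).abs
    calc _ ≤ ∫ w, (|(((n : ℝ) * h n) ^ 2)⁻¹ * gramX K X x (h n) b (Finset.range n) w -
          f x ^ 2 * ν| + ((n : ℝ) * h n)⁻¹ ^ 4) ∂P := by
          refine integral_mono_of_nonneg (ae_of_all _ (hy0 n)) (i1.add (integrable_const _))
            (ae_of_all _ fun w => (min_le_right _ _).trans ?_)
          have e : (((n : ℝ) * h n) ^ 2)⁻¹ *
            (gramX K X x (h n) b (Finset.range n) w + (((n : ℝ) * h n) ^ 2)⁻¹) - f x ^ 2 * ν =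
            ((((n : ℝ) * h n) ^ 2)⁻¹ * gramX K X x (h n) b (Finset.range n) w - f x ^ 2 * ν) +
              ((n : ℝ) * h n)⁻¹ ^ 4 := by ring
          rw [e]
          refine (abs_add_le _ _).trans_eq ?_
          rw [abs_of_pos (by positivity : 0 < ((n : ℝ) * h n)⁻¹ ^ 4)]
      _ = _ := by
          rw [integral_add i1 (integrable_const _), integral_const]
          simp [hν]
  have t4 := (hD.tendsto_sum_sq_mul hpos hzero hnh hφ hym hy0 hy1 ty).const_mul C
  rw [mul_zero] at t4
  have te0 := hD.tendsto_integral_one hpos hzero hφ.cell 0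
  have te2 := hD.tendsto_integral_one hpos hzero hφ.sq 0
  set E2 := f x * ∫ s, K (s - b) ^ 2 with hE2
  set C2 := 2 + 2 * (f x * ν) ^ 2 with hC2
  -- The crude ridge bound costs `(nh)⁵`, which is the tenth power under the root; the exponential
  -- absorbs it.
  have t1 : Tendsto (fun n : ℕ => 2 * ((h n)⁻¹ * ∫ w, K (scaled X x (h n) 0 w - b) ∂P) * √C2 * √2 *
      √((n * h n) ^ 10 * Real.exp (-(c / 2 * (n * h n))))) atTop (𝓝 0) := by
    have := (((te0.const_mul 2).mul_const √C2).mul_const √2).mul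
      (tendsto_pow_mul_exp_neg hnh 10 (half_pos hc)).sqrt
    simpa using this
  have t2 : Tendsto (fun n : ℕ => 4 * (f x ^ 2)⁻¹ *
      ((h n)⁻¹ * ∫ w, K (scaled X x (h n) 0 w - b) ^ 2 ∂P) *
      Real.exp (-(c / 2 * (n * h n)))) atTop (𝓝 0) := by
    have := (te2.const_mul (4 * (f x ^ 2)⁻¹)).mul
      (tendsto_pow_mul_exp_neg hnh 0 (half_pos hc))
    simpa using this
  have hE20 : 0 ≤ E2 := mul_nonneg hfx.le (integral_nonneg fun _ => sq_nonneg _)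
  rw [Metric.tendsto_nhds]
  intro e he
  -- Chosen so that the term from the moments without point `i` is at most `e / 8`.
  set η := e / (8 * 4 * (c' ^ 2)⁻¹ * (E2 + 1) * (1 + B ^ 2)) with hη
  have hη0 : 0 < η := by positivity
  filter_upwards [hint, hev, hprob, t1.eventually_lt_const (show 0 < e / 4 by positivity),
    t2.eventually_lt_const (show 0 < e / 4 by positivity),
    t4.eventually_lt_const (show 0 < e / 4 by positivity),
    te2.eventually_lt_const (lt_add_one E2),
    hD.law_of_large_numbers_momX hK hpos hzero hnh b 2 hη0,
    hD.law_of_large_numbers_momX hK hpos hzero hnh b 2 one_pos,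
    hD.law_of_large_numbers_momX hK hpos hzero hnh b 1 hη0] with n hint hev hprob b1 b2 b4 b3
    l2 l2' l1
  obtain ⟨hkL, hs1, hs2, hn⟩ := hev
  have hh := hpos n
  set lam := (n : ℝ) * h n with hlam
  set e0 := (h n)⁻¹ * ∫ w, K (scaled X x (h n) 0 w - b) ∂P with he0
  set e2 := (h n)⁻¹ * ∫ w, K (scaled X x (h n) 0 w - b) ^ 2 ∂P with he2
  set E := Real.exp (-(c / 2 * lam)) with hE
  have hki : ∀ i, ∫ w, k n i w ∂P = h n * e0 := fun i => by
    rw [he0, mul_inv_cancel_left₀ hh.ne']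
    exact hD.integral_scaled_eq hh hφ.measurable i 0
  have hki2 : ∀ i, ∫ w, k n i w ^ 2 ∂P = h n * e2 := fun i => by
    rw [he2, mul_inv_cancel_left₀ hh.ne']
    exact hD.integral_scaled_eq hh hφ.sq.measurable i 0
  have he00 : 0 ≤ e0 := mul_nonneg (by positivity) (integral_nonneg fun _ => hK.nonneg _)
  have he20 : 0 ≤ e2 := mul_nonneg (by positivity) (integral_nonneg fun _ => sq_nonneg _)
  have hbadE : ∀ i ∈ Finset.range n, ∫ w, bad n i w ∂P ≤ 2 * E := fun i hi => by
    rw [hbadint]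
    exact hprob _ (hJc n i hi).2
  have B1 : ∀ i ∈ Finset.range n, ∫ w, k n i w * (s 2 n i w * bad n i w) ∂P ≤
      h n * e0 * (lam * (√C2 * √(2 * E))) := fun i hi => by
    rw [(hind1 n i).integral_fun_mul_eq_mul_integral (hint i).1.1.aestronglyMeasurable
      (hint i).1.2.2.1.aestronglyMeasurable, hki]
    refine mul_le_mul_of_nonneg_left ?_ (by positivity)
    have h1 := integral_mul_le_sqrt_mul_sqrt ((hs2 (J n i)).const_mul lam⁻¹) (hbadL n i)
      (fun w => mul_nonneg (by positivity) (hs0 n i w)) (hbad0 n i)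
    have h2 : ∫ w, s 2 n i w * bad n i w ∂P =
        lam * ∫ w, lam⁻¹ * momX K X x (h n) b 2 (J n i) w * bad n i w ∂P := by
      rw [← integral_const_mul]
      refine integral_congr_ae (ae_of_all _ fun w => ?_)
      simp only [hs]
      field_simp
    rw [h2]
    refine mul_le_mul_of_nonneg_left (h1.trans ?_) hn.le
    have h3 := integral_sq_le_of_integral_sub_sq_le ((hs2 (J n i)).const_mul lam⁻¹)
      (l2' (J n i) (hJc n i hi).1 (hJc n i hi).2)
    have h4 : ∫ w, bad n i w ^ 2 ∂P = ∫ w, bad n i w ∂P :=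
      integral_congr_ae (ae_of_all _ fun w => by
        rcases hbad01 n i w with h | h <;> simp [h])
    rw [h4]
    exact mul_le_mul (Real.sqrt_le_sqrt h3) (Real.sqrt_le_sqrt (hbadE i hi))
      (Real.sqrt_nonneg _) (Real.sqrt_nonneg _)
  have B2 : ∀ i ∈ Finset.range n, ∫ w, k n i w ^ 2 * bad n i w ∂P ≤ h n * e2 * (2 * E) :=
    fun i hi => by
    rw [(hind2 n i).integral_fun_mul_eq_mul_integral (hint i).1.2.1.aestronglyMeasurable
      (hbadm n i).aestronglyMeasurable, hki2]
    exact mul_le_mul_of_nonneg_left (hbadE i hi) (by positivity)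
  have B3 : ∀ i ∈ Finset.range n, ∫ w, k n i w ^ 2 * R n i w ∂P ≤ h n * e2 * ((1 + B ^ 2) * η) :=
    fun i hi => by
    rw [(hind3 n i).integral_fun_mul_eq_mul_integral (hint i).1.2.1.aestronglyMeasurable
      (hint i).1.2.2.2.aestronglyMeasurable, hki2]
    refine mul_le_mul_of_nonneg_left ?_ (by positivity)
    have h1 : MemLp (fun w => lam⁻¹ * s 2 n i w - f x * ν) 2 P :=
      ((hs2 _).const_mul _).sub (memLp_const _)
    have h2 : MemLp (fun w => lam⁻¹ * s 1 n i w) 2 P := (hs1 _).const_mul _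
    have l1' := l1 (J n i) (hJc n i hi).1 (hJc n i hi).2
    rw [hK.integral_odd odd_one] at l1'
    simp only [mul_zero, sub_zero] at l1'
    calc ∫ w, R n i w ∂P = ∫ w, (lam⁻¹ * s 2 n i w - f x * ν) ^ 2 ∂P +
          B ^ 2 * ∫ w, (lam⁻¹ * s 1 n i w) ^ 2 ∂P := by
          rw [← integral_const_mul, ← integral_add h1.integrable_sq
            (h2.integrable_sq.const_mul _)]
      _ ≤ η + B ^ 2 * η := by
          refine add_le_add (l2 (J n i) (hJc n i hi).1 (hJc n i hi).2) ?_
          exact mul_le_mul_of_nonneg_left l1' (sq_nonneg _)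
      _ = _ := by ring
  have hsum : ∑ i ∈ Finset.range n, ∫ w, err n i w ^ 2 ∂P ≤
      ∑ i ∈ Finset.range n, (2 * lam ^ 2 * (h n * e0 * (lam * (√C2 * √(2 * E)))) +
        2 * ((lam * f x) ^ 2)⁻¹ * (h n * e2 * (2 * E)) +
        4 * ((lam * c') ^ 2)⁻¹ * (h n * e2 * ((1 + B ^ 2) * η)) +
        (lam ^ 2)⁻¹ * C * ∫ w, k n i w ^ 2 * y n w ∂P) := by
    refine Finset.sum_le_sum fun i hi => ?_
    obtain ⟨-, h1, h2, h3, h4⟩ := hint i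
    have j1 := h1.const_mul (2 * lam ^ 2)
    have j2 := h2.const_mul (2 * ((lam * f x) ^ 2)⁻¹)
    have j3 := h3.const_mul (4 * ((lam * c') ^ 2)⁻¹)
    have j4 := h4.const_mul ((lam ^ 2)⁻¹ * C)
    have j12 : Integrable (fun w => 2 * lam ^ 2 * (k n i w * (s 2 n i w * bad n i w)) +
      2 * ((lam * f x) ^ 2)⁻¹ * (k n i w ^ 2 * bad n i w)) P := j1.add j2
    have j123 : Integrable (fun w => 2 * lam ^ 2 * (k n i w * (s 2 n i w * bad n i w)) +
      2 * ((lam * f x) ^ 2)⁻¹ * (k n i w ^ 2 * bad n i w) +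
      4 * ((lam * c') ^ 2)⁻¹ * (k n i w ^ 2 * R n i w)) P := j12.add j3
    have j1234 : Integrable (fun w => 2 * lam ^ 2 * (k n i w * (s 2 n i w * bad n i w)) +
      2 * ((lam * f x) ^ 2)⁻¹ * (k n i w ^ 2 * bad n i w) +
      4 * ((lam * c') ^ 2)⁻¹ * (k n i w ^ 2 * R n i w) +
      (lam ^ 2)⁻¹ * C * (k n i w ^ 2 * y n w)) P := j123.add j4
    refine (integral_mono_of_nonneg (ae_of_all _ fun w => sq_nonneg _) j1234
      (ae_of_all _ fun w => hpt n hn i hi w)).trans ?_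
    rw [integral_add j123 j4, integral_add j12 j3, integral_add j1 j2]
    simp only [integral_const_mul]
    refine add_le_add (add_le_add (add_le_add ?_ ?_) ?_) le_rfl
    · exact mul_le_mul_of_nonneg_left (B1 i hi) (by positivity)
    · exact mul_le_mul_of_nonneg_left (B2 i hi) (by positivity)
    · exact mul_le_mul_of_nonneg_left (B3 i hi) (by positivity)
  rw [Real.dist_eq, sub_zero, abs_of_nonneg (mul_nonneg hn.le
    (Finset.sum_nonneg fun i _ => integral_nonneg fun w => sq_nonneg _))]
  have b3' : 4 * (c' ^ 2)⁻¹ * e2 * ((1 + B ^ 2) * η) < e / 4 := by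
    have h1 : 4 * (c' ^ 2)⁻¹ * e2 * ((1 + B ^ 2) * η) ≤
        4 * (c' ^ 2)⁻¹ * (E2 + 1) * ((1 + B ^ 2) * η) := by gcongr
    have h2 : 4 * (c' ^ 2)⁻¹ * (E2 + 1) * ((1 + B ^ 2) * η) = e / 8 := by
      rw [hη]; field_simp
    linarith
  have hsqrt : √(lam ^ 10 * E) * √2 = lam ^ 5 * √(2 * E) := by
    rw [show lam ^ 10 = (lam ^ 5) ^ 2 by ring, Real.sqrt_mul (by positivity),
      Real.sqrt_sq (by positivity), Real.sqrt_mul (by positivity)]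
    ring
  calc lam * ∑ i ∈ Finset.range n, ∫ w, err n i w ^ 2 ∂P
      ≤ lam * ∑ i ∈ Finset.range n, (2 * lam ^ 2 * (h n * e0 * (lam * (√C2 * √(2 * E)))) +
        2 * ((lam * f x) ^ 2)⁻¹ * (h n * e2 * (2 * E)) +
        4 * ((lam * c') ^ 2)⁻¹ * (h n * e2 * ((1 + B ^ 2) * η)) +
        (lam ^ 2)⁻¹ * C * ∫ w, k n i w ^ 2 * y n w ∂P) :=
        mul_le_mul_of_nonneg_left hsum hn.le
    _ = 2 * e0 * √C2 * (lam ^ 5 * √(2 * E)) + 4 * (f x ^ 2)⁻¹ * e2 * E +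
        4 * (c' ^ 2)⁻¹ * e2 * ((1 + B ^ 2) * η) +
        C * (lam⁻¹ * ∑ i ∈ Finset.range n, ∫ w, k n i w ^ 2 * y n w ∂P) := by
        rw [Finset.sum_add_distrib, ← Finset.mul_sum, Finset.sum_const, Finset.card_range,
          nsmul_eq_mul]
        have hnn : (n : ℝ) = lam / h n := by rw [hlam]; field_simp
        rw [hnn]
        field_simp
        ring
    _ < e := by
        rw [← hsqrt]
        have b1' : 2 * e0 * √C2 * (√(lam ^ 10 * E) * √2) < e / 4 := by
          refine lt_of_eq_of_lt ?_ b1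
          ring
        have b4' : C * (lam⁻¹ * ∑ i ∈ Finset.range n, ∫ w, k n i w ^ 2 * y n w ∂P) < e / 4 := b4
        linarith

end IsDesign

end

/-! ### The interpolated kernel and the variance of the noise. -/

section

/-- Interpolation of the shifted kernels. -/
def interpKernel (K : ℝ → ℝ) (δ r s : ℝ) : ℝ := ∑ j, interpCoeff r j * K (s - node r δ j)

theorem integral_mul_shift (K : ℝ → ℝ) {a δ b b' : ℝ} (h : b - b' = 2 * (a * δ)) :
    ∫ s, K (s - b) * K (s - b') = kernelCorr K a δ := by
  rw [← integral_add_right_eq_self (fun s => K (s - b) * K (s - b')) ((b + b') / 2), kernelCorr]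
  refine integral_congr_ae (ae_of_all _ fun s => ?_)
  have e1 : s + (b + b') / 2 - b = s - a * δ := by linear_combination -(1 / 2) * h
  have e2 : s + (b + b') / 2 - b' = s + a * δ := by linear_combination (1 / 2) * h
  simp only [e1, e2]

theorem kernelCorr_zero (K : ℝ → ℝ) (δ : ℝ) : kernelCorr K 0 δ = nu02 K := by
  simp [kernelCorr, nu02, sq]

namespace IsKernel

variable {K : ℝ → ℝ}

theorem memLp_shift (hK : IsKernel K) (b : ℝ) : MemLp (fun s => K (s - b)) 2 volume := by
  have hKm := hK.measurable
  refine (memLp_two_iff_integrable_sq (Measurable.aestronglyMeasurable (by fun_prop))).2 ?_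
  exact hK.sq_integrable.comp_sub_right b

theorem isSqCell_interp (hK : IsKernel K) {B : ℝ} (hB : ∀ s, K s ≠ 0 → |s| ≤ B) (δ r : ℝ) :
    IsSqCell (interpKernel K δ r) (B + ∑ j, |node r δ j|) := by
  have hKm := hK.measurable
  have hm : Measurable (interpKernel K δ r) := by unfold interpKernel; fun_prop
  refine ⟨hm, ?_, fun s hs => ?_⟩
  · have : MemLp (interpKernel K δ r) 2 volume :=
      memLp_finsetSum _ fun j _ => (hK.memLp_shift (node r δ j)).const_mul _
    exact this.integrable_sq
  · obtain ⟨j, -, hj⟩ := Finset.exists_ne_zero_of_sum_ne_zero hs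
    have h1 := hB _ (right_ne_zero_of_mul hj)
    have h2 := Finset.single_le_sum (f := fun j => |node r δ j|) (fun _ _ => abs_nonneg _)
      (Finset.mem_univ j)
    have h3 := abs_sub_abs_le_abs_sub s (node r δ j)
    linarith

/-- Expanding the square leaves correlations at node distances `0`, `δ` and `2δ`, whose coefficients
become polynomials in `r²` alone once the symmetric pairs are added. At `r² = 1/2` the coefficient
of `ν₀₂` is `5/8 = 1 - (3/2)/4`. -/
theorem integral_interp_sq (hK : IsKernel K) (δ : ℝ) {r : ℝ} (hr : r ^ 2 = 1 / 2) :
    ∫ s, interpKernel K δ r s ^ 2 = nu02 K - varReduction K δ / 4 := by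
  have hL : ∀ b b', Integrable fun s => K (s - b) * K (s - b') := fun b b' =>
    (hK.memLp_shift b).integrable_mul (hK.memLp_shift b')
  have h1 : ∀ s, interpKernel K δ r s ^ 2 = ∑ j, ∑ k, interpCoeff r j * interpCoeff r k *
      (K (s - node r δ j) * K (s - node r δ k)) := fun s => by
    rw [interpKernel, sq, Finset.sum_mul_sum]
    exact Finset.sum_congr rfl fun j _ => Finset.sum_congr rfl fun k _ => by ring
  simp only [h1]
  rw [integral_finsetSum _ fun j _ => integrable_finsetSum _ fun k _ => (hL _ _).const_mul _]
  have h2 : ∀ j, ∫ s, ∑ k, interpCoeff r j * interpCoeff r k *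
      (K (s - node r δ j) * K (s - node r δ k)) = ∑ k, interpCoeff r j * interpCoeff r k *
      ∫ s, K (s - node r δ j) * K (s - node r δ k) := fun j => by
    rw [integral_finsetSum _ fun k _ => (hL _ _).const_mul _]
    simp only [integral_const_mul]
  simp only [h2]
  have hc : ∀ j k, ∫ s, K (s - node r δ j) * K (s - node r δ k) =
      ∫ s, K (s - node r δ k) * K (s - node r δ j) := fun j k => by simp only [mul_comm]
  have d : ∀ j, ∫ s, K (s - node r δ j) * K (s - node r δ j) = nu02 K := fun j => by
    rw [integral_mul_shift K (a := 0) (δ := δ) (by ring), kernelCorr_zero]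
  have d1 : ∫ s, K (s - node r δ 0) * K (s - node r δ 1) = kernelCorr K (1 / 2) δ :=
    integral_mul_shift K (by simp [node]; ring)
  have d2 : ∫ s, K (s - node r δ 1) * K (s - node r δ 2) = kernelCorr K (1 / 2) δ :=
    integral_mul_shift K (by simp [node]; ring)
  have d3 : ∫ s, K (s - node r δ 0) * K (s - node r δ 2) = kernelCorr K 1 δ :=
    integral_mul_shift K (by simp [node]; ring)
  simp only [Fin.sum_univ_three, d, d1, d2, d3, hc 1 0, hc 2 1, hc 2 0, varReduction,
    kernelCorr_zero]
  simp only [interpCoeff, Matrix.cons_val]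
  have h4 : r ^ 4 = 1 / 4 := by
    rw [show r ^ 4 = (r ^ 2) ^ 2 by ring, hr]; norm_num
  ring_nf
  simp only [hr, h4]
  ring

end IsKernel

/-- For fixed `θ` the bound tends to `T * θ * M`, and `θ` is arbitrary. -/
theorem tendsto_sub_of_forall_le {a b c d : ℕ → ℝ} {T M : ℝ}
    (hc : Tendsto c atTop (𝓝 M)) (hd : Tendsto d atTop (𝓝 0))
    (h : ∀ θ : ℝ, 0 < θ → ∀ᶠ n in atTop, |a n - b n| ≤ T * (θ * c n + (1 + θ⁻¹) * d n)) :
    Tendsto (fun n => a n - b n) atTop (𝓝 0) := by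
  rw [Metric.tendsto_nhds]
  intro e he
  set θ := e / (2 * (|T * M| + 1)) with hθ
  have hθ0 : 0 < θ := by positivity
  have h1 := ((hc.const_mul θ).add (hd.const_mul (1 + θ⁻¹))).const_mul T
  have h2 : T * (θ * M + (1 + θ⁻¹) * 0) < e := by
    have h3 : T * (θ * M + (1 + θ⁻¹) * 0) = θ * (T * M) := by ring
    have h4 : θ * (|T * M| + 1) = e / 2 := by rw [hθ]; field_simp
    nlinarith [le_abs_self (T * M)]
  filter_upwards [h θ hθ0, h1.eventually_lt_const h2] with n h3 h4
  rw [Real.dist_eq, sub_zero]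
  exact h3.trans_lt h4

/-- Young's inequality for the cross term in `a ^ 2 = (b + (a - b)) ^ 2`. -/
theorem abs_sq_sub_sq_le (a b : ℝ) {θ : ℝ} (hθ : 0 < θ) :
    |a ^ 2 - b ^ 2| ≤ θ * b ^ 2 + (1 + θ⁻¹) * (a - b) ^ 2 := by
  have h1 : 0 ≤ (θ * b - (a - b)) ^ 2 * θ⁻¹ := by positivity
  have h2 : 0 ≤ (θ * b + (a - b)) ^ 2 * θ⁻¹ := by positivity
  have e1 : (θ * b - (a - b)) ^ 2 * θ⁻¹ = θ * b ^ 2 - 2 * b * (a - b) + θ⁻¹ * (a - b) ^ 2 := by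
    field_simp
    ring
  have e2 : (θ * b + (a - b)) ^ 2 * θ⁻¹ = θ * b ^ 2 + 2 * b * (a - b) + θ⁻¹ * (a - b) ^ 2 := by
    field_simp
    ring
  rw [e1] at h1
  rw [e2] at h2
  rw [abs_le]
  constructor <;> nlinarith [sq_nonneg (a - b)]

variable {Ω : Type*} [MeasurableSpace Ω] {P : Measure Ω}
variable {f σ : ℝ → ℝ} {X : ℕ → Ω → ℝ} {x : ℝ} {h : ℕ → ℝ} {K : ℝ → ℝ}

namespace IsDesign

/-- Replace the weights by `interpKernel / (n h f(x))`, at a cost that `tendsto_weight_error` makes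
negligible at each of the three nodes. The resulting sum is a local expectation, whose limit
`tendsto_integral` gives. -/
theorem tendsto_noise_variance [IsProbabilityMeasure P] (hD : IsDesign P f X x) (hfx : 0 < f x)
    (hK : IsKernel K) (hpos : ∀ n, 0 < h n) (hzero : Tendsto h atTop (𝓝 0))
    (hnh : Tendsto (fun n : ℕ => (n : ℝ) * h n) atTop atTop) (hσ : Measurable σ)
    (hσx : ContinuousAt (fun y => σ y ^ 2) x) (δ r : ℝ) {F : ℕ → ℕ → Ω → ℝ}
    (hF : ∀ n i w, F n i w = tildeWeight K δ r (((n : ℝ) * h n) ^ 2)⁻¹ (Finset.range n)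
      (scaledSeq X x (h n) w) i * σ (X i w)) :
    (∀ᶠ n in atTop, ∀ i ∈ Finset.range n, MemLp (F n i) 2 P) ∧
      Tendsto (fun n : ℕ => n * h n * ∑ i ∈ Finset.range n, ∫ w, F n i w ^ 2 ∂P) atTop
        (𝓝 (σ x ^ 2 / f x * ∫ s, interpKernel K δ r s ^ 2)) := by
  obtain ⟨B, hB0, hB⟩ := hK.exists_bound
  have hKm := hK.measurable
  set g := interpKernel K δ r with hg
  set B' := B + ∑ j, |node r δ j| with hB'
  have hgc : IsSqCell g B' := hK.isSqCell_interp hB δ r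
  set W : ℕ → ℕ → Ω → ℝ := fun n i w => tildeWeight K δ r (((n : ℝ) * h n) ^ 2)⁻¹
    (Finset.range n) (scaledSeq X x (h n) w) i with hW
  set G : ℕ → ℕ → Ω → ℝ := fun n i w => g (scaled X x (h n) i w) / (n * h n * f x) with hG
  set err : Fin 3 → ℕ → ℕ → Ω → ℝ := fun j n i w =>
    llWeight (kerAt K (node r δ j) (scaledSeq X x (h n) w))
      (offAt (node r δ j) (scaledSeq X x (h n) w)) (((n : ℝ) * h n) ^ 2)⁻¹ (Finset.range n) i -
    kerAt K (node r δ j) (scaledSeq X x (h n) w) i / (n * h n * f x) with herr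
  have hE := fun j => hD.tendsto_weight_error hfx hK hpos hzero hnh (node r δ j)
    (err := err j) fun _ _ _ => rfl
  set A := ∑ j, interpCoeff r j ^ 2 with hA
  set D : ℕ → ℕ → Ω → ℝ := fun n i w => A * ∑ j, err j n i w ^ 2 with hDdef
  have hWG : ∀ n i w, (W n i w - G n i w) ^ 2 ≤ D n i w := fun n i w => by
    have h1 : W n i w - G n i w = ∑ j, interpCoeff r j * err j n i w := by
      simp only [hW, hG, hg, tildeWeight, interpKernel, herr, mul_sub, Finset.sum_sub_distrib,
        Finset.sum_div, mul_div_assoc]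
      rfl
    rw [h1]
    exact Finset.sum_mul_sq_le_sq_mul_sq _ _ _
  have hDint : ∀ᶠ n in atTop, ∀ i ∈ Finset.range n, Integrable (D n i) P := by
    filter_upwards [eventually_all.2 fun j => (hE j).1] with n hn i hi
    exact (integrable_finsetSum _ fun j _ => hn j i hi).const_mul _
  have hDlim : Tendsto (fun n : ℕ => n * h n * ∑ i ∈ Finset.range n, ∫ w, D n i w ∂P) atTop
      (𝓝 0) := by
    have h1 := (tendsto_finsetSum Finset.univ fun j _ => (hE j).2).const_mul A
    simp only [Finset.sum_const_zero, mul_zero] at h1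
    refine h1.congr' ?_
    filter_upwards [eventually_all.2 fun j => (hE j).1] with n hn
    have h2 : ∀ i ∈ Finset.range n, ∫ w, D n i w ∂P = A * ∑ j, ∫ w, err j n i w ^ 2 ∂P :=
      fun i hi => by
        simp only [hDdef]
        rw [integral_const_mul, integral_finsetSum _ fun j _ => hn j i hi]
    rw [Finset.sum_congr rfl h2, ← Finset.mul_sum, Finset.sum_comm, ← Finset.mul_sum]
    ring
  set τ : ℝ → ℝ := fun y => σ y ^ 2 with hτ
  have hτm : Measurable τ := hσ.pow_const 2
  set T := τ x + 1 with hT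
  have hT0 : 0 < T := by positivity
  have hFsq : ∀ n i w, F n i w ^ 2 = W n i w ^ 2 * τ (X i w) := fun n i w => by
    rw [hF, mul_pow]
  have hGsq : ∀ n i w, G n i w ^ 2 =
      ((n * h n * f x) ^ 2)⁻¹ * g (scaled X x (h n) i w) ^ 2 := fun n i w => by
    simp only [hG]; rw [div_pow, div_eq_inv_mul]
  -- Off the window both the weight and its approximation vanish; on it `σ²` is near its value at
  -- `x`. So `σ²` may be treated as bounded.
  have hloc : ∀ᶠ n in atTop, ∀ i w, (W n i w = 0 ∧ G n i w = 0) ∨ τ (X i w) ≤ T := by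
    filter_upwards [eventually_forall_abs_le hσx hzero B' one_pos] with n hn i w
    by_cases hs : |scaled X x (h n) i w| ≤ B'
    · right
      have h1 := hn _ hs
      rw [sub_mul_scaled (hpos n)] at h1
      have := (abs_lt.1 h1).2
      simp only [hT, hτ]
      linarith
    · left
      have h1 : ∀ j, K (scaled X x (h n) i w - node r δ j) = 0 := fun j => by
        by_contra hne
        have h1 := hB _ hne
        have h2 := Finset.single_le_sum (f := fun j => |node r δ j|) (fun _ _ => abs_nonneg _)
          (Finset.mem_univ j)
        have h3 := abs_sub_abs_le_abs_sub (scaled X x (h n) i w) (node r δ j)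
        exact hs (by linarith)
      have h2 : ∀ j, kerAt K (node r δ j) (scaledSeq X x (h n) w) i = 0 := h1
      refine ⟨?_, ?_⟩
      · simp [hW, tildeWeight, llWeight, h2]
      · simp [hG, hg, interpKernel, h1]
  have hFm : ∀ n i, Measurable (F n i) := fun n i => by
    rw [show F n i = fun w => W n i w * σ (X i w) from funext fun w => hF n i w]
    exact ((measurable_tildeWeight hKm δ r _ _ i).comp (measurable_scaledSeq hD (h n))).mul
      (hσ.comp (hD.measurable_X i))
  have hG1 : ∀ᶠ n in atTop, ∀ i, Integrable (fun w => G n i w ^ 2) P := by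
    filter_upwards [hD.eventually_integrable_one hpos hzero hgc.sq] with n hn i
    simp only [hGsq]
    exact (hn i).const_mul _
  have hGτ : ∀ᶠ n in atTop, ∀ i, Integrable (fun w => G n i w ^ 2 * τ (X i w)) P := by
    filter_upwards [hD.eventually_integrable hpos hzero hgc.sq hτm hσx] with n hn i
    simp only [hGsq, mul_assoc]
    exact (hn i).const_mul _
  have hpt : ∀ θ : ℝ, 0 < θ → ∀ᶠ n in atTop, ∀ i w, |F n i w ^ 2 - G n i w ^ 2 * τ (X i w)| ≤
      T * (θ * G n i w ^ 2 + (1 + θ⁻¹) * D n i w) := by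
    intro θ hθ
    filter_upwards [hloc] with n hn i w
    have hτ0 : 0 ≤ τ (X i w) := sq_nonneg _
    have h1 := abs_sq_sub_sq_le (W n i w) (G n i w) hθ
    have h2 : (1 + θ⁻¹) * (W n i w - G n i w) ^ 2 ≤ (1 + θ⁻¹) * D n i w :=
      mul_le_mul_of_nonneg_left (hWG n i w) (by positivity)
    rw [hFsq, ← sub_mul, abs_mul, abs_of_nonneg hτ0, mul_comm]
    rcases hn i w with ⟨e1, e2⟩ | hle
    · have : 0 ≤ D n i w := (sq_nonneg _).trans (hWG n i w)
      rw [e1, e2]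
      simp only [sub_self, abs_zero, mul_zero]
      positivity
    · exact mul_le_mul hle (h1.trans (by linarith)) (abs_nonneg _) hT0.le
  have hFint : ∀ᶠ n in atTop, ∀ i ∈ Finset.range n, Integrable (fun w => F n i w ^ 2) P := by
    filter_upwards [hpt 1 one_pos, hG1, hGτ, hDint] with n h1 h2 h3 h4 i hi
    have h5 := (h3 i).add ((((h2 i).const_mul 1).add ((h4 i hi).const_mul (1 + 1⁻¹))).const_mul T)
    refine h5.mono' ((hFm n i).pow_const 2).aestronglyMeasurable (ae_of_all _ fun w => ?_)
    rw [Real.norm_of_nonneg (sq_nonneg _)]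
    have := (abs_le.1 (h1 i w)).2
    simp only [Pi.add_apply]
    linarith
  refine ⟨?_, ?_⟩
  · filter_upwards [hFint] with n hn i hi
    exact (memLp_two_iff_integrable_sq (hFm n i).aestronglyMeasurable).2 (hn i hi)
  have hscale : ∀ (ψ : ℝ → ℝ), Measurable ψ → ∀ n : ℕ, 0 < (n : ℝ) * h n →
      n * h n * ∑ i ∈ Finset.range n, ∫ w, G n i w ^ 2 * ψ (X i w) ∂P =
      (f x ^ 2)⁻¹ * ((h n)⁻¹ * ∫ w, g (scaled X x (h n) 0 w) ^ 2 * ψ (X 0 w) ∂P) := by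
    intro ψ hψ n hn
    have hgm := hgc.measurable
    have h1 : ∀ i, ∫ w, G n i w ^ 2 * ψ (X i w) ∂P = ((n * h n * f x) ^ 2)⁻¹ *
        ∫ w, g (scaled X x (h n) 0 w) ^ 2 * ψ (X 0 w) ∂P := fun i => by
      have h2 := hD.integral_scaled_eq (hpos n) (F := fun s => g s ^ 2 * ψ (x - h n * s))
        (by fun_prop) i 0
      simp only [sub_mul_scaled (hpos n)] at h2
      rw [← h2, ← integral_const_mul]
      simp only [hGsq, mul_assoc]
    simp only [h1, Finset.sum_const, Finset.card_range, nsmul_eq_mul]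
    have hh := hpos n
    have hn0 : (n : ℝ) ≠ 0 := fun h0 => by simp [h0] at hn
    field_simp
  have hGlim := ((hD.tendsto_integral hpos hzero hgc.sq hτm hσx 0).const_mul
    (f x ^ 2)⁻¹).congr' ((hnh.eventually_gt_atTop 0).mono fun n hn => (hscale τ hτm n hn).symm)
  have hGlim1 := ((hD.tendsto_integral hpos hzero hgc.sq (τ := fun _ => 1) measurable_const
    continuousAt_const 0).const_mul (f x ^ 2)⁻¹).congr' ((hnh.eventually_gt_atTop 0).mono
      fun n hn => (hscale (fun _ => 1) measurable_const n hn).symm)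
  simp only [mul_one] at hGlim1
  have hdiff := tendsto_sub_of_forall_le (T := T) hGlim1 hDlim
    (a := fun n : ℕ => n * h n * ∑ i ∈ Finset.range n, ∫ w, F n i w ^ 2 ∂P)
    (b := fun n : ℕ => n * h n * ∑ i ∈ Finset.range n, ∫ w, G n i w ^ 2 * τ (X i w) ∂P) (by
      intro θ hθ
      filter_upwards [hpt θ hθ, hG1, hGτ, hDint, hFint, hnh.eventually_gt_atTop 0]
        with n h1 h2 h3 h4 h5 hn
      have h6 : ∀ i ∈ Finset.range n, |∫ w, F n i w ^ 2 ∂P - ∫ w, G n i w ^ 2 * τ (X i w) ∂P| ≤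
          T * (θ * ∫ w, G n i w ^ 2 ∂P + (1 + θ⁻¹) * ∫ w, D n i w ∂P) := fun i hi => by
        rw [← integral_sub (h5 i hi) (h3 i)]
        refine (abs_integral_le_integral_abs).trans ?_
        rw [← integral_const_mul, ← integral_const_mul, ← integral_add ((h2 i).const_mul _)
          ((h4 i hi).const_mul _), ← integral_const_mul]
        exact integral_mono_of_nonneg (ae_of_all _ fun w => abs_nonneg _)
          ((((h2 i).const_mul _).add ((h4 i hi).const_mul _)).const_mul _)
          (ae_of_all _ fun w => h1 i w)
      rw [← mul_sub, ← Finset.sum_sub_distrib, abs_mul, abs_of_pos hn]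
      calc _ ≤ n * h n * ∑ i ∈ Finset.range n,
            T * (θ * ∫ w, G n i w ^ 2 ∂P + (1 + θ⁻¹) * ∫ w, D n i w ∂P) :=
          mul_le_mul_of_nonneg_left ((Finset.abs_sum_le_sum_abs _ _).trans
            (Finset.sum_le_sum h6)) hn.le
        _ = _ := by
          rw [← Finset.mul_sum, Finset.sum_add_distrib, ← Finset.mul_sum, ← Finset.mul_sum]
          ring)
  have := hdiff.add hGlim
  simp only [sub_add_cancel, zero_add] at this
  convert this using 2
  simp only [hτ]
  field_simp

end IsDesign

end

/-! ### Assembly of the bias and variance expansions. -/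

section

theorem RegularAt.continuousAt_density {m f σ : ℝ → ℝ} {x : ℝ} (hr : RegularAt m f σ x) :
    ContinuousAt f x := by
  obtain ⟨c, α, hα, -, hf⟩ := hr.density_holder
  have h1 : ContinuousAt (fun y => c * |x - y| ^ α) x := by
    refine continuousAt_const.mul (ContinuousAt.rpow_const ?_ (Or.inr hα.le))
    fun_prop
  have h2 : Tendsto (fun y => c * |x - y| ^ α) (𝓝 x) (𝓝 0) := by
    simpa [Real.zero_rpow hα.ne'] using h1.tendsto
  have h3 : Tendsto (fun y => f x - f y) (𝓝 x) (𝓝 0) := squeeze_zero_norm' hf h2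
  rw [ContinuousAt]
  simpa using (tendsto_const_nhds (x := f x)).sub h3

variable {Ω : Type*} [MeasurableSpace Ω] {P : Measure Ω}
variable {m f σ : ℝ → ℝ} {X ε Y : ℕ → Ω → ℝ} {x : ℝ} {h : ℕ → ℝ} {K : ℝ → ℝ}

theorem IsRegressionSample.isDesign (hs : IsRegressionSample P m f σ X ε Y)
    (hr : RegularAt m f σ x) : IsDesign P f X x where
  measurable_f := hs.measurable_f
  f_nonneg := hs.f_nonneg
  measurable_X := hs.measurable_X
  independent := hs.independent.comp (fun _ p => p.1) fun _ => measurable_fst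
  law_X := hs.law_X
  continuousAt_f := hr.continuousAt_density

/-- Take square roots, using `a ^ 4 + b ≤ (a ^ 2 + √b) ^ 2`. -/
theorem isLittleO_of_sq_le {u v : ℕ → ℝ} {a b : ℕ → ℝ} (ha : ∀ n, 0 ≤ a n) (hb : ∀ n, 0 ≤ b n)
    (huv : ∀ᶠ n in atTop, u n ^ 2 ≤ v n)
    (hv : v =o[atTop] fun n => a n ^ 4 + b n) :
    u =o[atTop] fun n => a n ^ 2 + √(b n) := by
  rw [isLittleO_iff] at hv ⊢
  intro c hc
  filter_upwards [hv (show 0 < c ^ 2 by positivity), huv] with n h1 h2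
  have ha' := ha n
  have hb' := hb n
  rw [Real.norm_of_nonneg (show 0 ≤ a n ^ 4 + b n by positivity), Real.norm_eq_abs] at h1
  rw [Real.norm_of_nonneg (show 0 ≤ a n ^ 2 + √(b n) by positivity), Real.norm_eq_abs]
  refine abs_le_of_sq_le_sq ?_ (by positivity)
  have h3 : a n ^ 4 + b n ≤ (a n ^ 2 + √(b n)) ^ 2 := by
    have := Real.sq_sqrt hb'
    have : 0 ≤ a n ^ 2 * √(b n) := by positivity
    nlinarith
  calc u n ^ 2 ≤ c ^ 2 * (a n ^ 4 + b n) := h2.trans ((le_abs_self _).trans h1)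
    _ ≤ c ^ 2 * (a n ^ 2 + √(b n)) ^ 2 := by gcongr
    _ = _ := by ring

/-- The mean square of `H - c` is the variance of `H` plus its squared bias, so `bias_tilde`
controls both; the leading variance comes from the noise alone. The sign of `r` never matters, which
treats both estimators at once. -/
theorem hasBiasVarianceExpansion_mTilde [IsProbabilityMeasure P] (hK : IsKernel K)
    (hreg : RegularAt m f σ x) (hs : IsRegressionSample P m f σ X ε Y) (hpos : ∀ n, 0 < h n)
    (hzero : Tendsto h atTop (𝓝 0)) (hnh : Tendsto (fun n : ℕ => (n : ℝ) * h n) atTop atTop)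
    (δ : ℝ) {r : ℝ} (hr : r ^ 2 = 1 / 2) :
    HasBiasVarianceExpansion P K m f σ δ x h
      (fun n w => mTilde K δ r (h n) n (fun i => X i w) (fun i => Y i w) x) := by
  have hD := hs.isDesign hreg
  have hfx := hreg.density_pos
  set W : ℕ → ℕ → (ℕ → ℝ) → ℝ := fun n i u => tildeWeight K δ r (((n : ℝ) * h n) ^ 2)⁻¹
    (Finset.range n) (fun j => (x - u j) / h n) i with hW
  have hWm : ∀ n i, Measurable (W n i) := fun n i =>
    (measurable_tildeWeight hK.measurable δ r _ _ i).comp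
      (measurable_pi_lambda _ fun j => by fun_prop)
  set H : ℕ → (ℕ → ℝ) → ℝ := fun n u => ∑ i ∈ Finset.range n, W n i u * m (u i) with hH
  set F : ℕ → ℕ → (ℕ → ℝ) → ℝ := fun n i u => W n i u * σ (u i) with hF
  have hmm := hs.measurable_m
  have hσm := hs.measurable_sigma
  have hHm : ∀ n, Measurable (H n) := fun n => by
    have := hWm n
    exact Finset.measurable_sum _ fun i _ => by fun_prop
  have hFm : ∀ n i, Measurable (F n i) := fun n i => by
    have := hWm n i
    fun_prop
  set c : ℕ → ℝ := fun n => m x + 1 / 2 * deriv (deriv m) x * nu20 K * h n ^ 2 with hc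
  obtain ⟨hHL, hbias⟩ := hD.bias_tilde hreg hmm hK hpos hzero hnh δ r
    (H := fun n w => H n fun j => X j w) fun _ _ => rfl
  obtain ⟨hFL, hvar⟩ := hD.tendsto_noise_variance hfx hK hpos hzero hnh hσm
    hreg.continuousAt_variance δ r (F := fun n i w => F n i fun j => X j w) fun _ _ _ => rfl
  rw [hK.integral_interp_sq δ hr] at hvar
  have hZ : ∀ n, (fun w => mTilde K δ r (h n) n (fun i => X i w) (fun i => Y i w) x) =
      fun w => H n (fun j => X j w) +
        ∑ i ∈ Finset.range n, F n i (fun j => X j w) * ε i w := fun n => by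
    funext w
    rw [mTilde_eq K δ r (hpos n) n X Y x w, ← Finset.sum_add_distrib]
    refine Finset.sum_congr rfl fun i _ => ?_
    rw [hs.model]
    change W n i (fun j => X j w) * _ = _
    ring
  have hmv : ∀ᶠ n in atTop, _ := (hHL.and hFL).mono fun n hn =>
    hs.mean_variance_add_noise (hHm n) hn.1 (hFm n) hn.2
  refine ⟨?_, ?_, ?_⟩
  · filter_upwards [hmv] with n hn
    rw [hZ]
    exact hn.1
  · have h1 := isLittleO_of_sq_le (u := fun n => (∫ w, H n fun j => X j w ∂P) - c n)
      (a := h) (b := fun n : ℕ => ((n : ℝ) * h n)⁻¹) (fun n => (hpos n).le)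
      (fun n => inv_nonneg.2 (mul_nonneg n.cast_nonneg (hpos n).le)) (by
        filter_upwards [hHL] with n hn
        have := integral_sub_const_sq hn (c n)
        have h0 := variance_nonneg (fun w => H n fun j => X j w) P
        simp only [hc] at this ⊢
        linarith) hbias
    simp only [Real.sqrt_inv] at h1
    refine h1.congr' ?_ EventuallyEq.rfl
    filter_upwards [hmv] with n hn
    rw [hZ, hn.2.1]
    simp only [hc]
    ring
  · have h1 : (fun n => Var[fun w => H n fun j => X j w; P]) =o[atTop]
        fun n : ℕ => h n ^ 4 + ((n : ℝ) * h n)⁻¹ := by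
      refine IsBigO.trans_isLittleO (IsBigO.of_bound 1 ?_) hbias
      filter_upwards [hHL] with n hn
      have := integral_sub_const_sq hn (c n)
      have h0 := variance_nonneg (fun w => H n fun j => X j w) P
      rw [one_mul, Real.norm_of_nonneg h0, Real.norm_of_nonneg
        (integral_nonneg fun w => sq_nonneg _)]
      simp only [hc] at this ⊢
      nlinarith [sq_nonneg ((∫ w, H n fun j => X j w ∂P) -
        (m x + 1 / 2 * deriv (deriv m) x * nu20 K * h n ^ 2))]
    set V := σ x ^ 2 / f x * (nu02 K - varReduction K δ / 4) with hV
    have h2 : (fun n : ℕ => ((n : ℝ) * h n)⁻¹ * ((n : ℝ) * h n *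
        ∑ i ∈ Finset.range n, ∫ w, F n i (fun j => X j w) ^ 2 ∂P - V)) =o[atTop]
        fun n : ℕ => h n ^ 4 + ((n : ℝ) * h n)⁻¹ := by
      have h3 : (fun n : ℕ => (n : ℝ) * h n *
        ∑ i ∈ Finset.range n, ∫ w, F n i (fun j => X j w) ^ 2 ∂P - V) =o[atTop]
          fun _ => (1 : ℝ) := (isLittleO_one_iff ℝ).2 (by simpa using hvar.sub_const V)
      have h4 := (isBigO_refl (fun n : ℕ => ((n : ℝ) * h n)⁻¹) atTop).mul_isLittleO h3
      simp only [mul_one] at h4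
      refine h4.trans_isBigO (IsBigO.of_bound 1 (Eventually.of_forall fun n => ?_))
      have h5 : 0 ≤ ((n : ℝ) * h n)⁻¹ := inv_nonneg.2 (mul_nonneg n.cast_nonneg (hpos n).le)
      have h6 : 0 ≤ h n ^ 4 := by positivity
      rw [Real.norm_of_nonneg h5, Real.norm_of_nonneg (by positivity)]
      linarith
    refine (h1.add h2).congr' ?_ EventuallyEq.rfl
    filter_upwards [hmv, hnh.eventually_gt_atTop 0] with n hn hlam
    rw [hZ, hn.2.2, mul_sub, inv_mul_cancel_left₀ hlam.ne', hV]
    field_simp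
    ring

end

end LocalLinear

end

theorem corollary1 {Ω : Type*} [MeasurableSpace Ω] (P : Measure Ω) [IsProbabilityMeasure P]
    (K m f σ : ℝ → ℝ) (X ε Y : ℕ → Ω → ℝ) (x δ : ℝ) (h : ℕ → ℝ)
    (hK : LocalLinear.IsKernel K)
    (hreg : LocalLinear.RegularAt m f σ x)
    (hsample : LocalLinear.IsRegressionSample P m f σ X ε Y)
    (hδ : 0 < δ)
    (hpos : ∀ n, 0 < h n)
    (hzero : Tendsto h atTop (𝓝 0))
    (hnh : Tendsto (fun n : ℕ => (n : ℝ) * h n) atTop atTop) :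
    LocalLinear.HasBiasVarianceExpansion P K m f σ δ x h
      (fun n w => LocalLinear.mPlus K δ (h n) n (fun i => X i w) (fun i => Y i w) x) ∧
    LocalLinear.HasBiasVarianceExpansion P K m f σ δ x h
      (fun n w => LocalLinear.mMinus K δ (h n) n (fun i => X i w) (fun i => Y i w) x) := by
  have hr : (1 / √2 : ℝ) ^ 2 = 1 / 2 := by rw [div_pow, Real.sq_sqrt zero_le_two, one_pow]
  exact ⟨LocalLinear.hasBiasVarianceExpansion_mTilde hK hreg hsample hpos hzero hnh δ hr,
    LocalLinear.hasBiasVarianceExpansion_mTilde hK hreg hsample hpos hzero hnh δ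
      (by rw [neg_sq, hr])⟩
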